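/- **Setting.** Units are such that the speed of light and the particle rest mass equal $1$, and the Minkowski metric is $\mathrm{diag}(1,-1,-1,-1)$. For $\vec p\in\mathbb R^3$ put $p^0=\sqrt{1+|\vec p|^2}$. For $|\vec u|<1$ put $(U^\alpha)=(1-|\vec u|^2)^{-1/2}(1,\vec u)$ and $E=U_\alpha p^\alpha$. Let $q_i=-n_i^\alpha p_\alpha$ ($i=1,2,3$) be the rest-frame momentum, where $n_i^0=U^i$ and $n_i^j=\frac{U^iU^j}{U^0+1}+\delta_{ij}$, and let $(y,\phi)$ be the cosine of its polar angle and its azimuth, $q=\sqrt{E^2-1}\,(\sqrt{1-y^2}\cos\phi,\sqrt{1-y^2}\sin\phi,y)$. For $\theta>0$ and $\zeta=1/\theta$ let $K_2$ be the modified Bessel function of the second kind, $g_{[\vec u,\theta]}=\frac{\zeta}{4\pi K_2(\zeta)}e^{-E/\theta}$, and $\langle f,h\rangle_{[\vec u,\theta]}=\int_{\mathbb R^3} \frac{1}{g_{[\vec u,\theta]}}\,f\,h\,\frac{d^3\vec p}{p^0}$. Let $P^{(\ell)}_k(\cdot\,;\zeta)$ (degree $k$, leading coefficient $c^{(\ell)}_k>0$)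 be the orthonormal polynomials on $[1,\infty)$ for the weight $\frac{\zeta (x^2-1)^{\ell+1/2}}{(2\ell+1)K_2(\zeta)}e^{-\zeta x}$, and let $Y_{\ell,m}$ be the real spherical harmonics normalised by $\int_{-1}^1\int_0^{2\pi} Y_{\ell,m}^2\,d\phi\, dy=\frac{4\pi}{2\ell+1}$. Put $$\tilde P^{(\ell)}_{k,m}[\vec u,\theta]=g_{[\vec u,\theta]}\,P^{(\ell)}_k(E;\zeta)\,(E^2-1)^{\ell/2}\,Y_{\ell,m}(y,\phi),$$ and, for an integer $M\ge1$, let $\Pi_M[\vec u,\theta]f=\sum_{\ell+k\le M,\ |m|\le \ell}\langle f,\tilde P^{(\ell)}_{k,m}\rangle_{[\vec u,\theta]}\,\tilde P^{(\ell)}_{k,m}$. **Moment system.** The unknown vector $W$ consists of $n$, $\vec u$, $\theta$; for $M\ge2$ also of the bulk viscous pressure $\Pi$ and $\tilde f_{m}$ ($m=-1,0,1$); and of all $f^{(\ell)}_{k,m}$ ($\ell+k\le M$, $|m|\le\ell$) with $k\ge3$ if $\ell=0$, with $k\ge 2$ if $\ell=1$, and with $k\ge0$ if $\ell\ge2$.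 It represents the distribution $F(W)=\sum_{\ell+k\le M,\ |m|\le\ell} f^{(\ell)}_{k,m}\tilde P^{(\ell)}_{k,m}[\vec u,\theta]$, whose remaining coefficients are $$f^{(0)}_{k,0}=\delta_{k,0}\,\frac{n}{c^{(0)}_0}-3\Pi\,P^{(0)}_k(0;\zeta)\ \ (k\le2),\qquad f^{(1)}_{k,m}=\tilde f_{m}\,P^{(1)}_k(0;\zeta)\ \ (k\le1)$$ (with $\Pi=\tilde f_m=0$ if $M=1$). These express that, with $f^{(0)}=n\,g_{[\vec u,\theta]}$ and all integrals taken with respect to $d^3\vec p/p^0$: $\int E F=n$, $\int E^2F=\int E^2 f^{(0)}$, $\int E\,q_i F=0$ (Landau–Lifshitz frame), $\int F=\int f^{(0)}-3\Pi$, and $\tilde f_m=f^{(1)}_{0,m}/c^{(1)}_0$. With the Anderson–Witting collision term $Q=-\frac{E}{\tau}(F-f^{(0)})$, where $\tau=\tau(n,\theta)>0$, the moment system is $$\Pi_M\big(p^\alpha\,\Pi_M\,\partial_{x^\alpha} F(W)\big)=\Pi_M Q,\qquad\text{i.e., in coefficients,}\qquad B^\alpha_M(W)\,\partial_{x^\alpha}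 W=S(W),$$ where $\Pi_M=\Pi_M[\vec u,\theta]$ and $x^0=t$. **Theorem (linear stability).** Let $M\ge1$, $n_0>0$, $|\vec u_0|<1$, $\theta_0>0$, and let $W^{(0)}=(n_0,\vec u_0,\theta_0,0,\dots,0)$. The moment system linearized at $W^{(0)}$, $$B^\alpha_M(W^{(0)})\,\partial_{x^\alpha}\bar W=Q_M\bar W,\qquad Q_M=\frac{\partial S}{\partial W}(W^{(0)}),$$ is linearly stable in time: for every $\vec k\in\mathbb R^3$ and $\omega\in\mathbb C$, if it has a plane wave solution $\bar W=A\,e^{i(\omega t-\vec k\cdot\vec x)}$ with complex amplitude $A\neq0$, then $\operatorname{Im}\omega\ge0$. Equivalently, $\operatorname{Im}\omega\ge 0$ for every root $\omega$ of the dispersion relation $\det\big(i\omega B^0_M-ik_jB^j_M-Q_M\big)\big|_{W^{(0)}}=0$. -/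

import Mathlib

/-! Units: the speed of light and the particle rest mass are `1`; the Minkowski metric is
`diag (1, -1, -1, -1)`; `ζ = 1 / θ`. -/

namespace RelMoment

noncomputable section

/-! ### Orthogonal polynomials of Grad type -/

/-- The modified Bessel function of the second kind `K_ν(ζ)`. -/
def besselK (ν ζ : ℝ) : ℝ :=
  ∫ s in Set.Ioi (0 : ℝ), Real.cosh (ν * s) * Real.exp (-ζ * Real.cosh s)

/-- The weight `ω^{(ℓ)}(x; ζ)` on `[1, ∞)`. -/
def weight (l : ℕ) (ζ x : ℝ) : ℝ :=
  ζ * (x ^ 2 - 1) ^ ((l : ℝ) + 1 / 2) / ((2 * l + 1) * besselK 2 ζ) * Real.exp (-ζ * x)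

/-- The inner product of two polynomials in `L²([1, ∞), ω^{(ℓ)})`. -/
def polyInner (l : ℕ) (ζ : ℝ) (P Q : Polynomial ℝ) : ℝ :=
  ∫ x in Set.Ici (1 : ℝ), P.eval x * Q.eval x * weight l ζ x

/-- The monic orthogonal polynomial of degree `k` for `ω^{(ℓ)}` (Gram-Schmidt on `1, x, x², …`). -/
def monicOrtho (l : ℕ) (ζ : ℝ) (k : ℕ) : Polynomial ℝ :=
  Polynomial.X ^ k - ∑ i : Fin k,
    Polynomial.C (polyInner l ζ (Polynomial.X ^ k) (monicOrtho l ζ i) /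
      polyInner l ζ (monicOrtho l ζ i) (monicOrtho l ζ i)) * monicOrtho l ζ i
termination_by k
decreasing_by all_goals exact i.2

/-- The orthonormal polynomial `P_k^{(ℓ)}(·; ζ)`, of degree `k` and with positive leading
coefficient. -/
def orthoPoly (l : ℕ) (ζ : ℝ) (k : ℕ) : Polynomial ℝ :=
  Polynomial.C (1 / Real.sqrt (polyInner l ζ (monicOrtho l ζ k) (monicOrtho l ζ k))) *
    monicOrtho l ζ k

/-! ### Real spherical harmonics -/

/-- The associated Legendre function `P̂_ℓ^m(y)`, `0 ≤ m ≤ ℓ`, `-1 ≤ y ≤ 1`. -/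
def assocLegendre (l m : ℕ) (y : ℝ) : ℝ :=
  (-1) ^ m * Real.sqrt (1 - y ^ 2) ^ m * (1 / (2 ^ l * (l.factorial : ℝ))) *
    (Polynomial.derivative^[l + m] ((Polynomial.X ^ 2 - 1 : Polynomial ℝ) ^ l)).eval y

/-- The normalised associated Legendre function `√((ℓ-m)! / (ℓ+m)!) P̂_ℓ^m(y)`, `0 ≤ m ≤ ℓ`. -/
def normLegendre (l m : ℕ) (y : ℝ) : ℝ :=
  Real.sqrt (((l - m).factorial : ℝ) / ((l + m).factorial : ℝ)) * assocLegendre l m y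

/-- The real spherical harmonic `Y_{ℓ,m}(y, φ)`, where `y` is the cosine of the polar angle. -/
def sphHarm (l : ℕ) (m : ℤ) (y φ : ℝ) : ℝ :=
  if m < 0 then Real.sqrt 2 * normLegendre l m.natAbs y * Real.sin ((m.natAbs : ℝ) * φ)
  else if m = 0 then normLegendre l 0 y
  else Real.sqrt 2 * normLegendre l m.natAbs y * Real.cos ((m.natAbs : ℝ) * φ)

/-! ### Kinematics -/

/-- The space of (spatial) momenta `p = (p¹, p², p³)`. -/
abbrev Mom : Type := EuclideanSpace ℝ (Fin 3)

/-- The contravariant momentum 4-vector on the mass shell, `p⁰ = √(1 + |p|²)`. -/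
def fourMom (p : Mom) : Fin 4 → ℝ :=
  Fin.cons (Real.sqrt (1 + ∑ i, p i ^ 2)) (fun i => p i)

/-- The contravariant velocity 4-vector `U = γ(u) (1, u)`. -/
def fourVel (u : Fin 3 → ℝ) : Fin 4 → ℝ :=
  Fin.cons (1 / Real.sqrt (1 - ∑ i, u i ^ 2)) (fun i => u i / Real.sqrt (1 - ∑ i, u i ^ 2))

/-- The Minkowski product `a_α b^α` of two contravariant 4-vectors. -/
def minkowski (a b : Fin 4 → ℝ) : ℝ :=
  a 0 * b 0 - ∑ i : Fin 3, a i.succ * b i.succ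

/-- The energy in the local rest frame, `E = U_α p^α`. -/
def restEnergy (u : Fin 3 → ℝ) (p : Mom) : ℝ :=
  minkowski (fourVel u) (fourMom p)

/-- The space-like tetrad: `n_i⁰ = U^i`, `n_i^j = U^i U^j / (U⁰ + 1) + δ_{ij}`
(note `(U⁰ - 1) / ((U⁰)² - 1) = 1 / (U⁰ + 1)`). -/
def tetrad (u : Fin 3 → ℝ) (i : Fin 3) : Fin 4 → ℝ :=
  Fin.cons (fourVel u i.succ)
    (fun j => fourVel u i.succ * fourVel u j.succ / (fourVel u 0 + 1) + if i = j then 1 else 0)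

/-- The momentum components in the local rest frame, `-n_i^α p_α`. Their Euclidean norm is
`√(E² - 1)`. -/
def restMom (u : Fin 3 → ℝ) (p : Mom) (i : Fin 3) : ℝ :=
  -minkowski (tetrad u i) (fourMom p)

/-- The cosine `y` of the polar angle of the rest-frame momentum. -/
def polarCos (u : Fin 3 → ℝ) (p : Mom) : ℝ :=
  restMom u p 2 / Real.sqrt (restEnergy u p ^ 2 - 1)

/-- The azimuth `φ` of the rest-frame momentum. -/
def azimuth (u : Fin 3 → ℝ) (p : Mom) : ℝ :=
  Complex.arg ⟨restMom u p 0, restMom u p 1⟩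

/-! ### Weighted polynomial space, basis and projection -/

/-- The weight function `g^{(0)}_{[u,θ]}` (normalised Maxwell-Jüttner distribution). -/
def juttner (u : Fin 3 → ℝ) (θ : ℝ) (p : Mom) : ℝ :=
  θ⁻¹ / (4 * Real.pi * besselK 2 θ⁻¹) * Real.exp (-(restEnergy u p / θ))

/-- The inner product `∫ f h / g^{(0)}_{[u,θ]} d³p / p⁰`. -/
def wInner (u : Fin 3 → ℝ) (θ : ℝ) (f h : Mom → ℝ) : ℝ :=
  ∫ p : Mom, 1 / juttner u θ p * f p * h p / fourMom p 0

/-- The basis function `P̃_{k,m}^{(ℓ)}[u,θ] = g^{(0)} P_k^{(ℓ)}(E; 1/θ) (E² - 1)^{ℓ/2} Y_{ℓ,m}`. -/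
def basisFun (u : Fin 3 → ℝ) (θ : ℝ) (l k : ℕ) (m : ℤ) (p : Mom) : ℝ :=
  juttner u θ p * (orthoPoly l θ⁻¹ k).eval (restEnergy u p) *
    (Real.sqrt (restEnergy u p ^ 2 - 1) ^ l * sphHarm l m (polarCos u p) (azimuth u p))

/-- The labels `(ℓ, k, m)` of the basis of the space of weighted polynomials of degree at most `M`:
`ℓ ≤ M`, `k ≤ M - ℓ`, `|m| ≤ ℓ` (the order `m` is stored as `m + ℓ ∈ {0, …, 2ℓ}`). -/
abbrev Idx (M : ℕ) : Type :=
  Σ l : Fin (M + 1), Fin (M + 1 - (l : ℕ)) × Fin (2 * (l : ℕ) + 1)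

/-- The label `ℓ`. -/
def Idx.ell {M : ℕ} (j : Idx M) : ℕ := j.1

/-- The label `k`. -/
def Idx.deg {M : ℕ} (j : Idx M) : ℕ := j.2.1

/-- The label `m`. -/
def Idx.ord {M : ℕ} (j : Idx M) : ℤ := (j.2.2 : ℤ) - (j.1 : ℤ)

/-- The basis function with label `j`. -/
def basisAt {M : ℕ} (u : Fin 3 → ℝ) (θ : ℝ) (j : Idx M) : Mom → ℝ :=
  basisFun u θ j.ell j.deg j.ord

/-! ### The vector of unknowns

The unknown vector has as many entries as the basis. The entry labelled `(0,0,0)` is `n`, `(0,1,0)`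
is `θ`, `(1,0,i-1)` is the velocity component number `i ∈ {0,1,2}`, and, for `M ≥ 2`, `(0,2,0)` is
the bulk viscous pressure `Π`, `(1,1,m)` is `f̃_{0,m}^{(1)} = f_{0,m}^{(1)} / c_0^{(1)}`; every other
entry `(ℓ,k,m)` is the moment `f_{k,m}^{(ℓ)}` itself. -/

/-- The entry of `W` with label `(l, k, m)`, and `0` if there is no such label. -/
def entry {M : ℕ} (W : Idx M → ℝ) (l k : ℕ) (m : ℤ) : ℝ :=
  ∑ j : Idx M, if j.ell = l ∧ j.deg = k ∧ j.ord = m then W j else 0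

/-- The number density `n`. -/
def density {M : ℕ} (W : Idx M → ℝ) : ℝ := entry W 0 0 0

/-- The temperature `θ`. -/
def temperature {M : ℕ} (W : Idx M → ℝ) : ℝ := entry W 0 1 0

/-- The velocity `u`. -/
def velocity {M : ℕ} (W : Idx M → ℝ) (i : Fin 3) : ℝ := entry W 1 0 ((i : ℤ) - 1)

/-- The bulk viscous pressure `Π` (zero if `M = 1`). -/
def bulk {M : ℕ} (W : Idx M → ℝ) : ℝ := entry W 0 2 0

/-- The diffusion variables `f̃_{0,m}^{(1)}` (zero if `M = 1`). -/
def diffusion {M : ℕ} (W : Idx M → ℝ) (m : ℤ) : ℝ := entry W 1 1 m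

/-- The coefficient `f_{k,m}^{(ℓ)}` of the distribution with unknown vector `W`.
The matching conditions `∫ E f = n`, `∫ E² f = ∫ E² f⁽⁰⁾`, `∫ E p^{<α>} f = 0` (Landau frame) and
the definition of `Π`, i.e. `∫ f = ∫ f⁽⁰⁾ - 3 Π` (all with respect to `d³p / p⁰`), give
`f_{k,0}^{(0)} = δ_{k,0} n / c_0^{(0)} - 3 Π P_k^{(0)}(0)` for `k ≤ 2` and
`f_{k,m}^{(1)} = f̃_{0,m}^{(1)} P_k^{(1)}(0)` for `k ≤ 1`, where `c_k^{(ℓ)}` is the leading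
coefficient of `P_k^{(ℓ)}`. -/
def coeff {M : ℕ} (W : Idx M → ℝ) (j : Idx M) : ℝ :=
  if j.ell = 0 ∧ j.deg ≤ 2 then
    (if j.deg = 0 then density W / (orthoPoly 0 (temperature W)⁻¹ 0).leadingCoeff else 0)
      - 3 * bulk W * (orthoPoly 0 (temperature W)⁻¹ j.deg).eval 0
  else if j.ell = 1 ∧ j.deg ≤ 1 then
    diffusion W j.ord * (orthoPoly 1 (temperature W)⁻¹ j.deg).eval 0
  else W j

/-- The projected distribution function `Π_M[u,θ] f` with unknown vector `W`. -/
def distribution {M : ℕ} (W : Idx M → ℝ) (p : Mom) : ℝ :=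
  ∑ j : Idx M, coeff W j * basisAt (velocity W) (temperature W) j p

/-! ### The moment system -/

/-- The matrix `M_M^α` of the projected multiplication by `p^α`. -/
def momMat {M : ℕ} (W : Idx M → ℝ) (α : Fin 4) : Matrix (Idx M) (Idx M) ℝ :=
  Matrix.of fun j k => wInner (velocity W) (temperature W)
    (fun p => fourMom p α * basisAt (velocity W) (temperature W) k p)
    (basisAt (velocity W) (temperature W) j)

/-- The matrix `D_M`: the coefficients of `Π_M[u,θ] ∂_s (Π_M[u,θ] f)` are `D_M ∂_s W`. -/
def diffMat {M : ℕ} (W : Idx M → ℝ) : Matrix (Idx M) (Idx M) ℝ :=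
  Matrix.of fun j k => wInner (velocity W) (temperature W)
    (fun p => deriv (fun s => distribution (Function.update W k s) p) (W k))
    (basisAt (velocity W) (temperature W) j)

/-- The matrices `B_M^α = M_M^α D_M`. -/
def fluxMat {M : ℕ} (W : Idx M → ℝ) (α : Fin 4) : Matrix (Idx M) (Idx M) ℝ :=
  momMat W α * diffMat W

/-- The Anderson-Witting collision term `-(U_α p^α / τ) (f - f⁽⁰⁾)`, `f⁽⁰⁾ = n g^{(0)}_{[u,θ]}`,
with relaxation time `τ = τ(n, θ)`. -/
def collision {M : ℕ} (τ : ℝ → ℝ → ℝ) (W : Idx M → ℝ) (p : Mom) : ℝ :=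
  -(restEnergy (velocity W) p / τ (density W) (temperature W)) *
    (distribution W p - density W * juttner (velocity W) (temperature W) p)

/-- The source term `S(W)`: the coefficients of the projected collision term. The moment system is
`∑ α, B_M^α(W) ∂_α W = S(W)`. -/
def source {M : ℕ} (τ : ℝ → ℝ → ℝ) (W : Idx M → ℝ) (j : Idx M) : ℝ :=
  wInner (velocity W) (temperature W) (collision τ W)
    (basisAt (velocity W) (temperature W) j)

/-! ### Linearization at a local equilibrium -/

/-- The local equilibrium `(n₀, u₀, θ₀, 0, …, 0)`. -/
def equilibrium (M : ℕ) (n₀ : ℝ) (u₀ : Fin 3 → ℝ) (θ₀ : ℝ) (j : Idx M) : ℝ :=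
  if j.ell = 0 ∧ j.deg = 0 then n₀
  else if j.ell = 0 ∧ j.deg = 1 then θ₀
  else if j.ell = 1 ∧ j.deg = 0 then u₀ (Fin.ofNat 3 j.2.2)
  else 0

/-- The relaxation matrix: the Jacobian matrix of the source term. -/
def relaxMat {M : ℕ} (τ : ℝ → ℝ → ℝ) (W : Idx M → ℝ) : Matrix (Idx M) (Idx M) ℝ :=
  Matrix.of fun j k => deriv (fun s => source τ (Function.update W k s) j) (W k)

/-- `V`, a complex field on space-time with coordinates `(x⁰, x¹, x², x³) = (t, x)`, solves the
moment system linearized at the constant state `W₀`: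
`∑ α, B_M^α(W₀) ∂_α V = DS(W₀) V`. -/
def SolvesLinearized {M : ℕ} (τ : ℝ → ℝ → ℝ) (W₀ : Idx M → ℝ)
    (V : (Fin 4 → ℝ) → Idx M → ℂ) : Prop :=
  ∀ x : Fin 4 → ℝ,
    ∑ α : Fin 4, ((fluxMat W₀ α).map Complex.ofReal).mulVec
        (fun j => deriv (fun s : ℝ => V (Function.update x α s) j) (x α)) =
      ((relaxMat τ W₀).map Complex.ofReal).mulVec (V x)

/-- The plane wave `A exp(i (ω t - k · x))`. -/
def planeWave {M : ℕ} (A : Idx M → ℂ) (ω : ℂ) (k : Fin 3 → ℝ) (x : Fin 4 → ℝ) (j : Idx M) : ℂ :=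
  A j * Complex.exp (Complex.I * (ω * (x 0 : ℂ) - ∑ i : Fin 3, (k i : ℂ) * (x i.succ : ℂ)))

/-- The matrix `i ω B_M^0 - i k_j B_M^j - Q_M` at `W₀`, whose determinant gives the dispersion
relation. -/
def dispersionMat {M : ℕ} (τ : ℝ → ℝ → ℝ) (W₀ : Idx M → ℝ) (ω : ℂ) (k : Fin 3 → ℝ) :
    Matrix (Idx M) (Idx M) ℂ :=
  (Complex.I * ω) • (fluxMat W₀ 0).map Complex.ofReal
    - ∑ i : Fin 3, (Complex.I * (k i : ℂ)) • (fluxMat W₀ i.succ).map Complex.ofReal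
    - (relaxMat τ W₀).map Complex.ofReal

end

end RelMoment

/-!
The linearized moment system is dissipative in the energy that is natural for the basis, and this
excludes plane waves that grow in time.

**Structure of the matrices.** The basis functions are orthonormal, so that `B^α = M^α D` with `M^α`
the symmetric matrix of the compression of the multiplication by `p^α`, and `M⁰ ≥ 1` since
`p⁰ ≥ 1`. At an equilibrium `D = C + H`: the columns of `H` (`fluidMat`) are the coefficients of the
derivatives of the local equilibrium `n g` in `n`, `θ` and `u`, which are combinations of
the collision invariants `g`, `g E` and `g q_i`; the columns of `C` (`devMat`) are the coefficients
of the deviation from local equilibrium (`diffMat_eq`). The source is linear in the deviation, so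
that its Jacobian matrix is `-(1/τ) N C` with `N` the symmetric matrix of the multiplication by `E`,
`N ≥ 1` (`relaxMat_eq`). No differentiability of `τ` is needed, because the deviation vanishes at
equilibrium.

**Energy estimate.** The Landau-Lifshitz matching conditions say that `N C` has no component along
the collision invariants, hence `Hᵀ N C = 0` (`mulMat_energy_mul_devMat`). In terms of the
coefficients this holds because `∑ k ≤ d, P_k(0) P_k` reproduces the value at `0` of polynomials of
degree at most `d`, and `x P_k(x)` vanishes at `0`. If `A ≠ 0` solves the eigenvalue problem and
`v = D A`, then testing with `v` gives `Im ω ⟨v, M⁰ v⟩ = ⟨C A, N C A⟩ / τ ≥ 0`. Moreover `v ≠ 0`: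
from `D A = 0` it follows that `⟨C A, N C A⟩ = ⟨C A, N D A⟩ = 0`, so `C A = 0` and `H A = 0`, and
these determine the non-fluid unknowns (`eq_zero_of_devCoeff_eq_zero`) and the fluid ones
(`eq_zero_of_fluidMat_mulVec_eq_zero`); see `im_nonneg_of_energy_estimate`.

**Analytic input.** In the coordinates `(E, y, φ)` the invariant measure `d³p / p⁰` becomes
`√(E² - 1) dE dy dφ` (`map_restCoord`): the boost to the rest frame has Jacobian `E / p⁰`, and the
rest is two applications of polar coordinates in the plane. There the products of basis functions
separate, and the orthogonality of the polynomials `P_k^{(ℓ)}`, of the associated Legendre functions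
(by Rodrigues' formula and integration by parts) and of the trigonometric functions yields
`wInner_basisFun`, from which all matrix entries are read off.
-/

open MeasureTheory Set Filter Asymptotics Topology
open Polynomial (C X)

namespace RelMoment

/-! ### Exponentially decaying integrands and the Bessel function `K₂` -/

theorem pow_mul_exp_neg_isBigO (n : ℕ) {ζ : ℝ} (hζ : 0 < ζ) :
    (fun t : ℝ => t ^ n * Real.exp (-ζ * t)) =O[atTop] fun t => Real.exp (-(ζ / 2) * t) := by
  have h := (isLittleO_pow_exp_pos_mul_atTop n (half_pos hζ)).isBigO.mul
    (isBigO_refl (fun t : ℝ => Real.exp (-ζ * t)) atTop)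
  refine h.congr_right fun t => ?_
  rw [← Real.exp_add]
  congr 1
  ring

theorem integrableOn_cosh_pow_mul_exp (n : ℕ) {ζ : ℝ} (hζ : 0 < ζ) :
    IntegrableOn (fun s : ℝ => Real.cosh s ^ n * Real.exp (-ζ * Real.cosh s)) (Ioi 0) := by
  have hle : ∀ s : ℝ, s ≤ Real.cosh s := fun s => by
    have h1 := Real.add_one_le_exp s
    have h2 := Real.exp_pos (-s)
    have h3 := Real.quadratic_le_exp_of_nonneg (x := |s|) (abs_nonneg s)
    rw [← Real.cosh_abs, Real.cosh_eq]
    have h4 := Real.exp_pos (-|s|)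
    have h5 := le_abs_self s
    nlinarith [sq_abs s, Real.add_one_le_exp (-|s|), sq_nonneg (|s| - 1)]
  refine integrable_of_isBigO_exp_neg (half_pos hζ) (by fun_prop) ?_
  have ht : Tendsto Real.cosh atTop atTop := tendsto_atTop_mono hle tendsto_id
  refine ((pow_mul_exp_neg_isBigO n hζ).comp_tendsto ht).trans ?_
  refine IsBigO.of_bound 1 (Eventually.of_forall fun s => ?_)
  simp only [Function.comp, Real.norm_eq_abs, Real.abs_exp, one_mul, Real.exp_le_exp]
  nlinarith [hle s]

theorem integrableOn_besselK_two_integrand {ζ : ℝ} (hζ : 0 < ζ) :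
    IntegrableOn (fun s : ℝ => Real.cosh (2 * s) * Real.exp (-ζ * Real.cosh s)) (Ioi 0) := by
  refine (((integrableOn_cosh_pow_mul_exp 2 hζ).const_mul 2).sub
    (integrableOn_cosh_pow_mul_exp 0 hζ)).congr (Eventually.of_forall fun s => ?_)
  simp only [Pi.sub_apply, Real.cosh_two_mul, Real.sinh_sq]
  ring

theorem besselK_two_pos {ζ : ℝ} (hζ : 0 < ζ) : 0 < besselK 2 ζ := by
  have hpos : ∀ s : ℝ, 0 < Real.cosh (2 * s) * Real.exp (-ζ * Real.cosh s) :=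
    fun s => mul_pos (Real.cosh_pos _) (Real.exp_pos _)
  rw [besselK, setIntegral_pos_iff_support_of_nonneg_ae
    (Eventually.of_forall fun s => (hpos s).le) (integrableOn_besselK_two_integrand hζ)]
  rw [Function.support_eq_univ fun s => (hpos s).ne']
  simp

theorem differentiableAt_besselK_two {ζ : ℝ} (hζ : 0 < ζ) : DifferentiableAt ℝ (besselK 2) ζ := by
  have hball : ∀ x ∈ Metric.ball ζ (ζ / 2), ζ / 2 < x := fun x hx => by
    rw [Metric.mem_ball, Real.dist_eq, abs_lt] at hx
    linarith
  have h := hasDerivAt_integral_of_dominated_loc_of_deriv_le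
    (μ := volume.restrict (Ioi (0 : ℝ))) (x₀ := ζ) (s := Metric.ball ζ (ζ / 2))
    (F := fun z s => Real.cosh (2 * s) * Real.exp (-z * Real.cosh s))
    (F' := fun z s => Real.cosh (2 * s) * (Real.exp (-z * Real.cosh s) * (-1 * Real.cosh s)))
    (bound := fun s => 2 * (Real.cosh s ^ 3 * Real.exp (-(ζ / 2) * Real.cosh s)))
    (Metric.ball_mem_nhds ζ (half_pos hζ))
    (Eventually.of_forall fun z => Continuous.aestronglyMeasurable (by fun_prop))
    (integrableOn_besselK_two_integrand hζ)
    (Continuous.aestronglyMeasurable (by fun_prop))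
    (Eventually.of_forall fun s x hx => ?_)
    ((integrableOn_cosh_pow_mul_exp 3 (half_pos hζ)).const_mul 2)
    (Eventually.of_forall fun s x _ => ?_)
  · exact h.2.differentiableAt
  · have hc := Real.one_le_cosh s
    have he : Real.exp (-x * Real.cosh s) ≤ Real.exp (-(ζ / 2) * Real.cosh s) := by
      rw [Real.exp_le_exp]
      nlinarith [hball x hx]
    have h2 : Real.cosh (2 * s) ≤ 2 * Real.cosh s ^ 2 := by
      rw [Real.cosh_two_mul, Real.sinh_sq]
      linarith
    rw [norm_mul, norm_mul, norm_mul, Real.norm_eq_abs, Real.norm_eq_abs, Real.norm_eq_abs,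
      Real.norm_eq_abs, Real.abs_exp, abs_of_pos (Real.cosh_pos _), abs_of_pos (Real.cosh_pos _)]
    calc _ ≤ 2 * Real.cosh s ^ 2 * (Real.exp (-(ζ / 2) * Real.cosh s) * (|-1| * Real.cosh s)) := by
          gcongr
      _ = _ := by
          simp only [abs_neg, abs_one]
          ring
  · exact ((((hasDerivAt_id x).neg.mul_const (Real.cosh s)).exp).const_mul _)

/-! ### The weights and the orthonormal polynomials -/

theorem integrableOn_eval_mul_sqrt_pow_mul_exp (P : Polynomial ℝ) (n : ℕ) {ζ : ℝ} (hζ : 0 < ζ) :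
    IntegrableOn (fun x : ℝ => P.eval x * √(x ^ 2 - 1) ^ n * Real.exp (-ζ * x)) (Ioi 1) := by
  refine integrable_of_isBigO_exp_neg (half_pos hζ) (by fun_prop) ?_
  have hP : (fun x : ℝ => P.eval x) =O[atTop] fun x => x ^ P.natDegree := by
    have := Polynomial.isBigO_atTop_of_degree_le (P := P) (Q := X ^ P.natDegree) (by
      simp [Polynomial.degree_le_natDegree])
    simpa using this
  have hs : (fun x : ℝ => √(x ^ 2 - 1) ^ n) =O[atTop] fun x => x ^ n := by
    refine IsBigO.pow (IsBigO.of_bound 1 ?_) n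
    filter_upwards [eventually_ge_atTop 0] with x hx
    rw [one_mul, Real.norm_eq_abs, Real.norm_eq_abs, abs_of_nonneg (Real.sqrt_nonneg _)]
    rw [abs_of_nonneg hx]
    exact Real.sqrt_le_iff.2 ⟨hx, by linarith⟩
  refine ((hP.mul hs).mul (isBigO_refl _ _)).trans ?_
  refine (pow_mul_exp_neg_isBigO (P.natDegree + n) hζ).congr_left fun x => ?_
  rw [pow_add]

theorem weight_eq {l : ℕ} {ζ x : ℝ} (hx : 1 ≤ x) :
    weight l ζ x =
      ζ / ((2 * l + 1) * besselK 2 ζ) * (√(x ^ 2 - 1) ^ (2 * l + 1) * Real.exp (-ζ * x)) := by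
  have h : 0 ≤ x ^ 2 - 1 := by nlinarith
  have hs : √(x ^ 2 - 1) ^ (2 * l + 1) = (x ^ 2 - 1) ^ ((l : ℝ) + 1 / 2) := by
    rw [Real.sqrt_eq_rpow, ← Real.rpow_mul_natCast h]
    congr 1
    push_cast
    ring
  rw [weight, hs]
  ring

theorem integrableOn_eval_mul_weight (l : ℕ) {ζ : ℝ} (hζ : 0 < ζ) (P : Polynomial ℝ) :
    IntegrableOn (fun x : ℝ => P.eval x * weight l ζ x) (Ici 1) := by
  rw [integrableOn_Ici_iff_integrableOn_Ioi]
  refine IntegrableOn.congr_fun ((integrableOn_eval_mul_sqrt_pow_mul_exp P (2 * l + 1) hζ).const_mul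
    (ζ / ((2 * l + 1) * besselK 2 ζ))) (fun x hx => ?_) measurableSet_Ioi
  simp only [weight_eq (le_of_lt (mem_Ioi.1 hx))]
  ring

theorem polyInner_comm (l : ℕ) (ζ : ℝ) (P Q : Polynomial ℝ) :
    polyInner l ζ P Q = polyInner l ζ Q P := by
  simp only [polyInner, mul_comm (P.eval _)]

theorem polyInner_mul_shift (l : ℕ) (ζ : ℝ) (P Q R : Polynomial ℝ) :
    polyInner l ζ (R * P) Q = polyInner l ζ P (R * Q) := by
  simp only [polyInner, Polynomial.eval_mul]
  congr 1 with x
  ring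

theorem polyInner_add_right (l : ℕ) {ζ : ℝ} (hζ : 0 < ζ) (P Q R : Polynomial ℝ) :
    polyInner l ζ P (Q + R) = polyInner l ζ P Q + polyInner l ζ P R := by
  have h : ∀ Q : Polynomial ℝ, IntegrableOn (fun x => P.eval x * Q.eval x * weight l ζ x) (Ici 1) :=
      fun Q => by
    simpa using integrableOn_eval_mul_weight l hζ (P * Q)
  rw [polyInner, polyInner, polyInner, ← integral_add (h Q) (h R)]
  simp only [Polynomial.eval_add]
  congr 1 with x
  ring

theorem polyInner_C_mul_right (l : ℕ) (ζ : ℝ) (a : ℝ) (P Q : Polynomial ℝ) :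
    polyInner l ζ P (C a * Q) = a * polyInner l ζ P Q := by
  rw [polyInner, polyInner, ← integral_const_mul]
  simp only [Polynomial.eval_mul, Polynomial.eval_C]
  congr 1 with x
  ring

theorem polyInner_C_mul_left (l : ℕ) (ζ : ℝ) (a : ℝ) (P Q : Polynomial ℝ) :
    polyInner l ζ (C a * P) Q = a * polyInner l ζ P Q := by
  rw [polyInner_comm, polyInner_C_mul_right, polyInner_comm]

theorem polyInner_zero_right (l : ℕ) (ζ : ℝ) (P : Polynomial ℝ) : polyInner l ζ P 0 = 0 := by
  simp [polyInner]

theorem polyInner_sub_right (l : ℕ) {ζ : ℝ} (hζ : 0 < ζ) (P Q R : Polynomial ℝ) :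
    polyInner l ζ P (Q - R) = polyInner l ζ P Q - polyInner l ζ P R := by
  have h := polyInner_add_right l hζ P (Q - R) R
  rw [sub_add_cancel] at h
  linarith

theorem polyInner_sum_right (l : ℕ) {ζ : ℝ} (hζ : 0 < ζ) {ι : Type*} (s : Finset ι)
    (P : Polynomial ℝ) (Q : ι → Polynomial ℝ) :
    polyInner l ζ P (∑ i ∈ s, Q i) = ∑ i ∈ s, polyInner l ζ P (Q i) := by
  classical
  induction s using Finset.induction_on with
  | empty => simp [polyInner_zero_right]
  | insert a s ha ih => rw [Finset.sum_insert ha, Finset.sum_insert ha,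
      polyInner_add_right l hζ, ih]

theorem weight_pos (l : ℕ) {ζ x : ℝ} (hζ : 0 < ζ) (hx : 1 < x) : 0 < weight l ζ x := by
  have h1 : 0 < x ^ 2 - 1 := by nlinarith
  have h2 := besselK_two_pos hζ
  rw [weight_eq hx.le]
  have := Real.sqrt_pos.2 h1
  positivity

theorem polyInner_self_pos (l : ℕ) {ζ : ℝ} (hζ : 0 < ζ) {P : Polynomial ℝ} (hP : P ≠ 0) :
    0 < polyInner l ζ P P := by
  have hint : IntegrableOn (fun x => P.eval x * P.eval x * weight l ζ x) (Ioi 1) := by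
    rw [← integrableOn_Ici_iff_integrableOn_Ioi]
    simpa using integrableOn_eval_mul_weight l hζ (P * P)
  rw [polyInner, integral_Ici_eq_integral_Ioi, setIntegral_pos_iff_support_of_nonneg_ae _ hint]
  · have hsub : Ioi (1 : ℝ) \ (P.roots.toFinset : Set ℝ) ⊆
        (Function.support fun x => P.eval x * P.eval x * weight l ζ x) ∩ Ioi 1 := by
      rintro x ⟨hx, hr⟩
      refine ⟨?_, hx⟩
      have h0 : P.eval x ≠ 0 := by simpa [hP] using hr
      exact mul_ne_zero (mul_ne_zero h0 h0) (weight_pos l hζ hx).ne'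
    refine lt_of_lt_of_le ?_ (measure_mono hsub)
    rw [measure_sdiff_null (Finset.measure_zero _ _)]
    simp
  · filter_upwards [ae_restrict_mem measurableSet_Ioi] with x hx
    exact mul_nonneg (mul_self_nonneg _) (weight_pos l hζ hx).le

theorem monicOrtho_monic_natDegree (l : ℕ) (ζ : ℝ) (k : ℕ) :
    (monicOrtho l ζ k).Monic ∧ (monicOrtho l ζ k).natDegree = k := by
  induction k using Nat.strong_induction_on with
  | _ k ih =>
    have hlt : (∑ i : Fin k, C (polyInner l ζ (X ^ k) (monicOrtho l ζ i) /
        polyInner l ζ (monicOrtho l ζ i) (monicOrtho l ζ i)) * monicOrtho l ζ i).degree <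
        (k : WithBot ℕ) := by
      refine (Polynomial.degree_sum_le _ _).trans_lt ?_
      refine (Finset.sup_lt_iff (WithBot.bot_lt_coe k)).2 fun i _ => ?_
      rw [← Polynomial.smul_eq_C_mul]
      refine (Polynomial.degree_smul_le _ _).trans_lt ?_
      rw [Polynomial.degree_eq_natDegree (ih i i.2).1.ne_zero, (ih i i.2).2]
      exact Nat.cast_lt.2 i.2
    rw [monicOrtho]
    have hm := Polynomial.monic_X_pow_sub hlt
    refine ⟨hm, ?_⟩
    refine Polynomial.natDegree_eq_of_degree_eq_some ?_
    rw [Polynomial.degree_sub_eq_left_of_degree_lt (by rwa [Polynomial.degree_X_pow]),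
      Polynomial.degree_X_pow]

theorem polyInner_monicOrtho_of_lt (l : ℕ) {ζ : ℝ} (hζ : 0 < ζ) (k : ℕ) :
    ∀ i < k, polyInner l ζ (monicOrtho l ζ i) (monicOrtho l ζ k) = 0 := by
  induction k using Nat.strong_induction_on with
  | _ k ih =>
    intro i hi
    have horth : ∀ j < k, j ≠ i →
        polyInner l ζ (monicOrtho l ζ i) (monicOrtho l ζ j) = 0 := fun j hj hji => by
      rcases lt_or_gt_of_ne hji with h | h
      · rw [polyInner_comm, ih i hi j h]
      · exact ih j hj i h
    rw [monicOrtho.eq_1 l ζ k, polyInner_sub_right l hζ, polyInner_sum_right l hζ,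
      Finset.sum_eq_single (⟨i, hi⟩ : Fin k)]
    · rw [polyInner_C_mul_right, polyInner_comm l ζ (X ^ k),
        div_mul_cancel₀ _ (polyInner_self_pos l hζ (monicOrtho_monic_natDegree l ζ i).1.ne_zero).ne',
        sub_self]
    · intro j _ hj
      rw [polyInner_C_mul_right, horth j j.2 fun h => hj (Fin.ext h), mul_zero]
    · simp

theorem polyInner_orthoPoly (l : ℕ) {ζ : ℝ} (hζ : 0 < ζ) (i j : ℕ) :
    polyInner l ζ (orthoPoly l ζ i) (orthoPoly l ζ j) = if i = j then 1 else 0 := by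
  rw [orthoPoly, orthoPoly, polyInner_C_mul_right, polyInner_C_mul_left]
  split_ifs with h
  · subst h
    have hp := polyInner_self_pos l hζ (monicOrtho_monic_natDegree l ζ i).1.ne_zero
    have := Real.mul_self_sqrt hp.le
    have h0 := (Real.sqrt_pos.2 hp).ne'
    field_simp
    linarith
  · have : polyInner l ζ (monicOrtho l ζ i) (monicOrtho l ζ j) = 0 := by
      rcases lt_or_gt_of_ne h with h | h
      · exact polyInner_monicOrtho_of_lt l hζ j i h
      · rw [polyInner_comm, polyInner_monicOrtho_of_lt l hζ i j h]
    rw [this, mul_zero, mul_zero]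

theorem orthoPoly_leadingCoeff_pos (l : ℕ) {ζ : ℝ} (hζ : 0 < ζ) (k : ℕ) :
    0 < (orthoPoly l ζ k).leadingCoeff := by
  have h := monicOrtho_monic_natDegree l ζ k
  rw [orthoPoly, Polynomial.leadingCoeff_mul, h.1.leadingCoeff, mul_one,
    Polynomial.leadingCoeff_C]
  have := Real.sqrt_pos.2 (polyInner_self_pos l hζ h.1.ne_zero)
  positivity

theorem orthoPoly_natDegree (l : ℕ) {ζ : ℝ} (hζ : 0 < ζ) (k : ℕ) :
    (orthoPoly l ζ k).natDegree = k := by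
  have h := monicOrtho_monic_natDegree l ζ k
  have := Real.sqrt_pos.2 (polyInner_self_pos l hζ h.1.ne_zero)
  rw [orthoPoly, Polynomial.natDegree_C_mul (by positivity), h.2]

theorem orthoPoly_degree (l : ℕ) {ζ : ℝ} (hζ : 0 < ζ) (k : ℕ) :
    (orthoPoly l ζ k).degree = k := by
  rw [Polynomial.degree_eq_natDegree, orthoPoly_natDegree l hζ]
  rw [← Polynomial.leadingCoeff_ne_zero]
  exact (orthoPoly_leadingCoeff_pos l hζ k).ne'

theorem orthoPoly_zero (l : ℕ) {ζ : ℝ} (hζ : 0 < ζ) :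
    orthoPoly l ζ 0 = C (orthoPoly l ζ 0).leadingCoeff := by
  have h := orthoPoly_natDegree l hζ 0
  rw [Polynomial.leadingCoeff, h]
  exact Polynomial.eq_C_of_natDegree_eq_zero h

/-- The expansion of a polynomial of degree less than `n` in the orthonormal polynomials. -/
theorem eq_sum_polyInner_orthoPoly (l : ℕ) {ζ : ℝ} (hζ : 0 < ζ) (n : ℕ) :
    ∀ R : Polynomial ℝ, R.degree < n →
      R = ∑ k ∈ Finset.range n, C (polyInner l ζ (orthoPoly l ζ k) R) * orthoPoly l ζ k := by
  induction n with
  | zero =>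
    intro R hR
    simpa using hR
  | succ n ih =>
    intro R hR
    set P := orthoPoly l ζ with hPdef
    have hlead := (orthoPoly_leadingCoeff_pos l hζ n).ne'
    set c := R.coeff n / (P n).leadingCoeff with hc
    have hdeg : (R - C c * P n).degree < n := by
      rw [Polynomial.degree_lt_iff_coeff_zero]
      intro m hm
      rcases hm.eq_or_lt with rfl | hm
      · rw [Polynomial.coeff_sub, Polynomial.coeff_C_mul]
        have : (P n).coeff n = (P n).leadingCoeff := by
          rw [Polynomial.leadingCoeff, orthoPoly_natDegree l hζ]
        rw [this, hc, div_mul_cancel₀ _ hlead, sub_self]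
      · rw [Polynomial.coeff_sub, Polynomial.coeff_C_mul,
          Polynomial.coeff_eq_zero_of_natDegree_lt (p := P n)
            (by rw [orthoPoly_natDegree l hζ]; exact hm),
          Polynomial.coeff_eq_zero_of_degree_lt (hR.trans_le (by exact_mod_cast hm))]
        simp
    have hexp := ih _ hdeg
    have hk : ∀ k, polyInner l ζ (P k) (R - C c * P n) =
        polyInner l ζ (P k) R - if k = n then c else 0 := fun k => by
      rw [polyInner_sub_right l hζ, polyInner_C_mul_right, polyInner_orthoPoly l hζ]
      simp
    have hn : polyInner l ζ (P n) (R - C c * P n) = 0 := by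
      rw [hexp, polyInner_sum_right l hζ]
      refine Finset.sum_eq_zero fun k hk => ?_
      rw [polyInner_C_mul_right, polyInner_orthoPoly l hζ,
        if_neg (Finset.mem_range.1 hk).ne', mul_zero]
    rw [hk, if_pos rfl, sub_eq_zero] at hn
    rw [Finset.sum_range_succ, hn]
    rw [← sub_eq_iff_eq_add, hexp]
    refine Finset.sum_congr rfl fun k hk' => ?_
    rw [hk, if_neg (Finset.mem_range.1 hk').ne, sub_zero]

theorem polyInner_orthoPoly_eq_zero_of_degree_lt (l : ℕ) {ζ : ℝ} (hζ : 0 < ζ) {k : ℕ}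
    {R : Polynomial ℝ} (hR : R.degree < k) : polyInner l ζ (orthoPoly l ζ k) R = 0 := by
  rw [eq_sum_polyInner_orthoPoly l hζ k R hR, polyInner_sum_right l hζ]
  refine Finset.sum_eq_zero fun i hi => ?_
  rw [polyInner_C_mul_right, polyInner_orthoPoly l hζ, if_neg (Finset.mem_range.1 hi).ne',
    mul_zero]

/-- The Christoffel-Darboux kernel `∑ k < n, P_k(x) P_k(a)` reproduces the value at `a` of a
polynomial of degree less than `n`. -/
theorem sum_eval_mul_polyInner_orthoPoly (l : ℕ) {ζ : ℝ} (hζ : 0 < ζ) {n : ℕ} {R : Polynomial ℝ}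
    (hR : R.degree < n) (a : ℝ) :
    ∑ k ∈ Finset.range n, (orthoPoly l ζ k).eval a * polyInner l ζ (orthoPoly l ζ k) R =
      R.eval a := by
  conv_rhs => rw [eq_sum_polyInner_orthoPoly l hζ n R hR, Polynomial.eval_finsetSum]
  simp only [Polynomial.eval_mul, Polynomial.eval_C, mul_comm]

theorem polyInner_X_mul_orthoPoly_pos (l : ℕ) {ζ : ℝ} (hζ : 0 < ζ) :
    0 < polyInner l ζ (X * orthoPoly l ζ 0) (orthoPoly l ζ 1) := by
  have h0 := orthoPoly_leadingCoeff_pos l hζ 0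
  have h1 := orthoPoly_leadingCoeff_pos l hζ 1
  set c := (orthoPoly l ζ 1).leadingCoeff
  have hX : orthoPoly l ζ 1 = C c * X + C ((orthoPoly l ζ 1).coeff 0) := by
    have := Polynomial.eq_X_add_C_of_natDegree_le_one (orthoPoly_natDegree l hζ 1).le
    have hc : c = (orthoPoly l ζ 1).coeff 1 := by
      change (orthoPoly l ζ 1).leadingCoeff = _
      rw [Polynomial.leadingCoeff, orthoPoly_natDegree l hζ]
    rwa [← hc] at this
  have h11 := polyInner_orthoPoly l hζ 1 1
  have h10 : polyInner l ζ (orthoPoly l ζ 1) (C ((orthoPoly l ζ 1).coeff 0)) = 0 :=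
    polyInner_orthoPoly_eq_zero_of_degree_lt l hζ
      (Polynomial.degree_C_le.trans_lt (by norm_num))
  have : polyInner l ζ (orthoPoly l ζ 1) (orthoPoly l ζ 1) =
      c * polyInner l ζ (orthoPoly l ζ 1) X := by
    conv_lhs => arg 4; rw [hX]
    rw [polyInner_add_right l hζ, h10, polyInner_C_mul_right, add_zero]
  rw [if_pos rfl, this] at h11
  rw [orthoPoly_zero l hζ, mul_comm X, polyInner_C_mul_left, polyInner_comm]
  refine mul_pos h0 ?_
  have : polyInner l ζ (orthoPoly l ζ 1) X = 1 / c := by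
    field_simp
    linarith
  rw [this]
  positivity

/-! ### Associated Legendre functions -/

theorem integral_eval_derivative (p : Polynomial ℝ) (a b : ℝ) :
    ∫ x in a..b, (Polynomial.derivative p).eval x = p.eval b - p.eval a :=
  intervalIntegral.integral_eq_sub_of_hasDerivAt (fun x _ => p.hasDerivAt x)
    (Continuous.intervalIntegrable (by fun_prop) _ _)

/-- Repeated integration by parts for polynomials without boundary terms. -/
theorem integral_iterate_derivative_mul (a b : ℝ) (f : Polynomial ℝ) (n : ℕ) :
    ∀ g : Polynomial ℝ,
      (∀ i < n, (Polynomial.derivative^[n - 1 - i] f * Polynomial.derivative^[i] g).eval a = 0 ∧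
        (Polynomial.derivative^[n - 1 - i] f * Polynomial.derivative^[i] g).eval b = 0) →
      ∫ x in a..b, (Polynomial.derivative^[n] f * g).eval x =
        (-1) ^ n * ∫ x in a..b, (f * Polynomial.derivative^[n] g).eval x := by
  induction n with
  | zero => intro g _; simp
  | succ n ih =>
    intro g h
    have h0 := h 0 n.succ_pos
    simp only [Nat.add_sub_cancel, Nat.sub_zero, Function.iterate_zero, id] at h0
    have hparts := integral_eval_derivative (Polynomial.derivative^[n] f * g) a b
    rw [h0.1, h0.2, sub_zero, Polynomial.derivative_mul] at hparts
    simp only [Polynomial.eval_add] at hparts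
    rw [intervalIntegral.integral_add (Continuous.intervalIntegrable (by fun_prop) _ _)
      (Continuous.intervalIntegrable (by fun_prop) _ _)] at hparts
    rw [Function.iterate_succ_apply', eq_neg_of_add_eq_zero_left hparts,
      ih (Polynomial.derivative g)]
    · rw [← Function.iterate_succ_apply, pow_succ]
      ring
    · intro i hi
      have := h (i + 1) (by omega)
      rwa [show n + 1 - 1 - (i + 1) = n - 1 - i by omega, Function.iterate_succ_apply] at this

theorem integral_X_sq_sub_one_pow (l : ℕ) :
    ∫ x in (-1 : ℝ)..1, ((X ^ 2 - 1 : Polynomial ℝ) ^ l).eval x =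
      (-1) ^ l * (2 * (2 ^ l * (l.factorial : ℝ)) ^ 2 / ((2 * l + 1).factorial : ℝ)) := by
  induction l with
  | zero => norm_num
  | succ l ih =>
    have h := integral_eval_derivative (X * (X ^ 2 - 1 : Polynomial ℝ) ^ (l + 1)) (-1) 1
    have hd : Polynomial.derivative (X * (X ^ 2 - 1 : Polynomial ℝ) ^ (l + 1)) =
        C ((2 * l + 3 : ℝ)) * (X ^ 2 - 1) ^ (l + 1) + C ((2 * l + 2 : ℝ)) * (X ^ 2 - 1) ^ l := by
      simp only [Polynomial.derivative_mul, Polynomial.derivative_X, Polynomial.derivative_pow,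
        Polynomial.derivative_sub, Polynomial.derivative_one, map_add, map_mul,
        map_ofNat, map_natCast, Nat.cast_add, Nat.cast_one, Nat.cast_ofNat, sub_zero, map_one,
        Nat.add_one_sub_one]
      ring
    rw [hd] at h
    simp only [Polynomial.eval_add, Polynomial.eval_mul, Polynomial.eval_C, Polynomial.eval_X] at h
    rw [intervalIntegral.integral_add (Continuous.intervalIntegrable (by fun_prop) _ _)
      (Continuous.intervalIntegrable (by fun_prop) _ _), intervalIntegral.integral_const_mul,
      intervalIntegral.integral_const_mul, ih] at h
    have hz : ((X ^ 2 - 1 : Polynomial ℝ) ^ (l + 1)).eval 1 = 0 := by simp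
    have hz' : ((X ^ 2 - 1 : Polynomial ℝ) ^ (l + 1)).eval (-1) = 0 := by simp
    rw [hz, hz'] at h
    have h3 : (2 * l + 3 : ℝ) ≠ 0 := by positivity
    have hfac : ((2 * (l + 1) + 1).factorial : ℝ) =
        (2 * l + 3) * ((2 * l + 2) * (2 * l + 1).factorial) := by
      rw [show 2 * (l + 1) + 1 = (2 * l + 1) + 1 + 1 by ring, Nat.factorial_succ,
        Nat.factorial_succ]
      push_cast
      ring
    have hfpos : ((2 * l + 1).factorial : ℝ) ≠ 0 := by positivity
    have key : ∫ x in (-1 : ℝ)..1, ((X ^ 2 - 1 : Polynomial ℝ) ^ (l + 1)).eval x =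
        -((2 * l + 2) * ((-1) ^ l * (2 * (2 ^ l * (l.factorial : ℝ)) ^ 2 /
          ((2 * l + 1).factorial : ℝ)))) / (2 * l + 3) := by
      field_simp at h ⊢
      linarith
    rw [key, hfac, Nat.factorial_succ l]
    push_cast
    field_simp
    ring

theorem eval_iterate_derivative_eq_zero {p w : Polynomial ℝ} {n j : ℕ} {x : ℝ} (hp : w ^ n ∣ p)
    (hj : j < n) (hx : w.eval x = 0) : (Polynomial.derivative^[j] p).eval x = 0 := by
  have h := Polynomial.pow_sub_dvd_iterate_derivative_of_pow_dvd j hp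
  refine Polynomial.eval_eq_zero_of_dvd_of_eval_eq_zero h ?_
  rw [Polynomial.eval_pow, hx, zero_pow (by omega)]

theorem natDegree_X_sq_sub_one_pow (l : ℕ) :
    ((X ^ 2 - 1 : Polynomial ℝ) ^ l).natDegree = 2 * l ∧
      ((X ^ 2 - 1 : Polynomial ℝ) ^ l).coeff (2 * l) = 1 := by
  have hm : (X ^ 2 - 1 : Polynomial ℝ).Monic := by
    simpa using Polynomial.monic_X_pow_sub_C (1 : ℝ) (two_ne_zero)
  have hd : (X ^ 2 - 1 : Polynomial ℝ).natDegree = 2 := by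
    simpa using Polynomial.natDegree_X_pow_sub_C (n := 2) (r := (1 : ℝ))
  have hl : ((X ^ 2 - 1 : Polynomial ℝ) ^ l).natDegree = 2 * l := by
    rw [hm.natDegree_pow, hd, mul_comm]
  refine ⟨hl, ?_⟩
  have := (hm.pow l).coeff_natDegree
  rwa [hl] at this

/-- Orthogonality of the derivatives in Rodrigues' formula, for `l' ≤ l`. -/
theorem integral_rodrigues (l l' m : ℕ) (hm : m ≤ l') (hl : l' ≤ l) :
    ∫ x in (-1 : ℝ)..1, (Polynomial.derivative^[l + m] ((X ^ 2 - 1 : Polynomial ℝ) ^ l) *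
        ((X ^ 2 - 1) ^ m * Polynomial.derivative^[l' + m] ((X ^ 2 - 1 : Polynomial ℝ) ^ l'))).eval x
      = if l = l' then (-1) ^ m * (2 / (2 * l + 1) * (2 ^ l * (l.factorial : ℝ)) ^ 2 *
          ((l + m).factorial / (l - m).factorial)) else 0 := by
  set w : Polynomial ℝ := X ^ 2 - 1 with hw
  have hw1 : w.eval 1 = 0 := by simp [hw]
  have hw2 : w.eval (-1) = 0 := by simp [hw]
  set g := w ^ m * Polynomial.derivative^[l' + m] (w ^ l') with hg
  have hbd : ∀ x, w.eval x = 0 → ∀ i < l + m,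
      (Polynomial.derivative^[l + m - 1 - i] (w ^ l) * Polynomial.derivative^[i] g).eval x = 0 := by
    intro x hx i hi
    rw [Polynomial.eval_mul]
    -- The boundary terms vanish: for `i < m` because of the factor `w ^ m` of `g`, and otherwise
    -- because fewer than `l` derivatives fall on `w ^ l`.
    rcases lt_or_ge i m with h | h
    · rw [eval_iterate_derivative_eq_zero (p := g) (dvd_mul_right _ _) h hx, mul_zero]
    · rw [eval_iterate_derivative_eq_zero (dvd_refl (w ^ l)) (by omega) hx, zero_mul]
  rw [integral_iterate_derivative_mul _ _ _ _ g fun i hi => ⟨hbd _ hw2 i hi, hbd _ hw1 i hi⟩]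
  have hA : (Polynomial.derivative^[l' + m] (w ^ l')).natDegree ≤ l' - m := by
    refine (Polynomial.natDegree_iterate_derivative _ _).trans ?_
    rw [(natDegree_X_sq_sub_one_pow l').1]
    omega
  have hgdeg : g.natDegree ≤ l' + m := by
    refine Polynomial.natDegree_mul_le.trans ?_
    rw [(natDegree_X_sq_sub_one_pow m).1]
    omega
  split_ifs with h
  · subst h
    have hconst : Polynomial.derivative^[l + m] g = C ((l + m).factorial * g.coeff (l + m)) := by
      have h0 : (Polynomial.derivative^[l + m] g).natDegree = 0 := by
        have := Polynomial.natDegree_iterate_derivative g (l + m)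
        omega
      rw [Polynomial.eq_C_of_natDegree_eq_zero h0, Polynomial.coeff_iterate_derivative]
      simp [Nat.descFactorial_self]
    have hcoef : g.coeff (l + m) = (2 * l).factorial / (l - m).factorial := by
      rw [show l + m = 2 * m + (l - m) by omega, hg,
        Polynomial.coeff_mul_add_eq_of_natDegree_le (natDegree_X_sq_sub_one_pow m).1.le hA,
        (natDegree_X_sq_sub_one_pow m).2, Polynomial.coeff_iterate_derivative,
        show l - m + (l + m) = 2 * l by omega, (natDegree_X_sq_sub_one_pow l).2,
        Nat.descFactorial_eq_div (by omega), show 2 * l - (l + m) = l - m by omega, one_mul,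
        nsmul_eq_mul, mul_one, Nat.cast_div (Nat.factorial_dvd_factorial (by omega))
          (by positivity)]
    rw [hconst, hcoef]
    simp only [Polynomial.eval_mul, Polynomial.eval_C]
    rw [intervalIntegral.integral_mul_const, integral_X_sq_sub_one_pow l, Nat.factorial_succ]
    have h1 : ((2 * l).factorial : ℝ) ≠ 0 := by positivity
    have h2 : ((-1 : ℝ) ^ (l + m)) * (-1) ^ l = (-1) ^ m := by
      rw [pow_add, mul_right_comm, ← mul_pow]
      simp
    push_cast
    field_simp
    linear_combination h2
  · rw [Polynomial.iterate_derivative_eq_zero (p := g) (by omega)]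
    simp

theorem continuous_normLegendre (l m : ℕ) : Continuous (normLegendre l m) := by
  unfold normLegendre assocLegendre
  fun_prop

theorem integral_normLegendre_mul (l l' m : ℕ) (hl : m ≤ l) (hl' : m ≤ l') :
    ∫ y in Ioo (-1 : ℝ) 1, normLegendre l m y * normLegendre l' m y =
      if l = l' then (2 / (2 * l + 1) : ℝ) else 0 := by
  wlog h : l' ≤ l generalizing l l'
  · have := this l' l hl' hl (by omega)
    simp only [mul_comm (normLegendre l m _), this]
    rw [if_neg (by omega), if_neg (by omega)]
  rw [← integral_Ioc_eq_integral_Ioo, ← intervalIntegral.integral_of_le (by norm_num)]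
  have hrod := integral_rodrigues l l' m hl' h
  set c : ℕ → ℝ := fun l => √(((l - m).factorial : ℝ) / ((l + m).factorial : ℝ)) *
    (1 / (2 ^ l * (l.factorial : ℝ))) with hc
  have hpt : ∀ y ∈ uIcc (-1 : ℝ) 1, normLegendre l m y * normLegendre l' m y =
      c l * c l' * (-1) ^ m * (Polynomial.derivative^[l + m] ((X ^ 2 - 1 : Polynomial ℝ) ^ l) *
        ((X ^ 2 - 1) ^ m *
          Polynomial.derivative^[l' + m] ((X ^ 2 - 1 : Polynomial ℝ) ^ l'))).eval y := by
    intro y hy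
    rw [uIcc_of_le (by norm_num)] at hy
    have hy' : 0 ≤ 1 - y ^ 2 := by nlinarith [hy.1, hy.2]
    have hs : √(1 - y ^ 2) ^ m * √(1 - y ^ 2) ^ m = (-1) ^ m * (y ^ 2 - 1) ^ m := by
      rw [← mul_pow, Real.mul_self_sqrt hy', ← mul_pow]
      congr 1
      ring
    have h1 : ((-1 : ℝ) ^ m) * (-1) ^ m = 1 := by rw [← mul_pow]; simp
    simp only [normLegendre, assocLegendre, hc, Polynomial.eval_mul, Polynomial.eval_pow,
      Polynomial.eval_sub, Polynomial.eval_X, Polynomial.eval_one]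
    linear_combination (√(((l - m).factorial : ℝ) / ((l + m).factorial : ℝ)) *
      (1 / (2 ^ l * (l.factorial : ℝ))) * (√(((l' - m).factorial : ℝ) / ((l' + m).factorial : ℝ)) *
      (1 / (2 ^ l' * (l'.factorial : ℝ)))) *
      (Polynomial.derivative^[l + m] ((X ^ 2 - 1 : Polynomial ℝ) ^ l)).eval y *
      (Polynomial.derivative^[l' + m] ((X ^ 2 - 1 : Polynomial ℝ) ^ l')).eval y) *
      (hs * ((-1) ^ m * (-1) ^ m) + (-1) ^ m * (y ^ 2 - 1) ^ m * h1)
  rw [intervalIntegral.integral_congr hpt, intervalIntegral.integral_const_mul, hrod]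
  split_ifs with hll
  · subst hll
    have h1 : ((-1 : ℝ) ^ m) * (-1) ^ m = 1 := by rw [← mul_pow]; simp
    have h2 : √(((l - m).factorial : ℝ) / ((l + m).factorial : ℝ)) *
        √(((l - m).factorial : ℝ) / ((l + m).factorial : ℝ)) =
        ((l - m).factorial : ℝ) / ((l + m).factorial : ℝ) :=
      Real.mul_self_sqrt (by positivity)
    have h3 : c l * c l = ((l - m).factorial : ℝ) / ((l + m).factorial : ℝ) *
        (1 / (2 ^ l * (l.factorial : ℝ))) ^ 2 := by
      rw [← h2, hc]
      ring
    rw [h3, ← mul_assoc, mul_assoc _ _ ((-1 : ℝ) ^ m), h1]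
    have h4 : (2 * l + 1 : ℝ) ≠ 0 := by positivity
    field_simp
  · simp

/-! ### Trigonometric factors and the real spherical harmonics -/

/-- The dependence of the real spherical harmonic of order `m` on the azimuth. -/
noncomputable def azimuthal (m : ℤ) (φ : ℝ) : ℝ :=
  if m < 0 then √2 * Real.sin ((m.natAbs : ℝ) * φ)
  else if m = 0 then 1
  else √2 * Real.cos ((m.natAbs : ℝ) * φ)

theorem sphHarm_eq (l : ℕ) (m : ℤ) (y φ : ℝ) :
    sphHarm l m y φ = normLegendre l m.natAbs y * azimuthal m φ := by
  unfold sphHarm azimuthal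
  split_ifs with h1 h2
  · ring
  · subst h2
    simp
  · ring

theorem continuous_azimuthal (m : ℤ) : Continuous (azimuthal m) := by
  unfold azimuthal
  split_ifs <;> fun_prop

theorem integral_cos_int_mul (n : ℤ) :
    ∫ φ in (-Real.pi)..Real.pi, Real.cos ((n : ℝ) * φ) = if n = 0 then 2 * Real.pi else 0 := by
  split_ifs with h
  · subst h
    simp
    ring
  · have hn : (n : ℝ) ≠ 0 := by exact_mod_cast h
    rw [intervalIntegral.integral_comp_mul_left (fun x => Real.cos x) hn, integral_cos]
    simp [Real.sin_int_mul_pi]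

theorem integral_sin_int_mul (n : ℤ) :
    ∫ φ in (-Real.pi)..Real.pi, Real.sin ((n : ℝ) * φ) = 0 := by
  by_cases h : n = 0
  · subst h
    simp
  · have hn : (n : ℝ) ≠ 0 := by exact_mod_cast h
    rw [intervalIntegral.integral_comp_mul_left (fun x => Real.sin x) hn, integral_sin]
    simp

theorem integral_cos_mul_cos (a b : ℤ) :
    ∫ φ in (-Real.pi)..Real.pi, Real.cos (a * φ) * Real.cos (b * φ) =
      ((if a = b then 2 * Real.pi else 0) + if a + b = 0 then 2 * Real.pi else 0) / 2 := by
  have h : ∀ φ : ℝ, Real.cos (a * φ) * Real.cos (b * φ) =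
      (Real.cos (((a - b : ℤ) : ℝ) * φ) + Real.cos (((a + b : ℤ) : ℝ) * φ)) / 2 := fun φ => by
    push_cast
    rw [sub_mul, add_mul, Real.cos_sub, Real.cos_add]
    ring
  simp only [h]
  rw [intervalIntegral.integral_div, intervalIntegral.integral_add
    (Continuous.intervalIntegrable (by fun_prop) _ _)
    (Continuous.intervalIntegrable (by fun_prop) _ _), integral_cos_int_mul, integral_cos_int_mul]
  simp only [sub_eq_zero]

theorem integral_sin_mul_sin (a b : ℤ) :
    ∫ φ in (-Real.pi)..Real.pi, Real.sin (a * φ) * Real.sin (b * φ) =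
      ((if a = b then 2 * Real.pi else 0) - if a + b = 0 then 2 * Real.pi else 0) / 2 := by
  have h : ∀ φ : ℝ, Real.sin (a * φ) * Real.sin (b * φ) =
      (Real.cos (((a - b : ℤ) : ℝ) * φ) - Real.cos (((a + b : ℤ) : ℝ) * φ)) / 2 := fun φ => by
    push_cast
    rw [sub_mul, add_mul, Real.cos_sub, Real.cos_add]
    ring
  simp only [h]
  rw [intervalIntegral.integral_div, intervalIntegral.integral_sub
    (Continuous.intervalIntegrable (by fun_prop) _ _)
    (Continuous.intervalIntegrable (by fun_prop) _ _), integral_cos_int_mul, integral_cos_int_mul]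
  simp only [sub_eq_zero]

theorem integral_sin_mul_cos (a b : ℤ) :
    ∫ φ in (-Real.pi)..Real.pi, Real.sin (a * φ) * Real.cos (b * φ) = 0 := by
  have h : ∀ φ : ℝ, Real.sin (a * φ) * Real.cos (b * φ) =
      (Real.sin (((a - b : ℤ) : ℝ) * φ) + Real.sin (((a + b : ℤ) : ℝ) * φ)) / 2 := fun φ => by
    push_cast
    rw [sub_mul, add_mul, Real.sin_sub, Real.sin_add]
    ring
  simp only [h]
  rw [intervalIntegral.integral_div, intervalIntegral.integral_add
    (Continuous.intervalIntegrable (by fun_prop) _ _)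
    (Continuous.intervalIntegrable (by fun_prop) _ _), integral_sin_int_mul, integral_sin_int_mul]
  simp

theorem azimuthal_neg {m : ℤ} (h : m < 0) (φ : ℝ) :
    azimuthal m φ = -√2 * Real.sin ((m : ℝ) * φ) := by
  have : (m.natAbs : ℝ) = -(m : ℝ) := by
    rw [Nat.cast_natAbs, abs_of_neg h]
    simp
  rw [azimuthal, if_pos h, this, neg_mul, Real.sin_neg]
  ring

theorem azimuthal_pos {m : ℤ} (h : 0 < m) (φ : ℝ) :
    azimuthal m φ = √2 * Real.cos ((m : ℝ) * φ) := by
  have : (m.natAbs : ℝ) = (m : ℝ) := by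
    rw [Nat.cast_natAbs, abs_of_pos h]
  rw [azimuthal, if_neg h.le.not_gt, if_neg h.ne', this]

theorem azimuthal_zero (φ : ℝ) : azimuthal 0 φ = Real.cos (((0 : ℤ) : ℝ) * φ) := by
  simp [azimuthal]

theorem integral_azimuthal_mul (m m' : ℤ) :
    ∫ φ in Ioo (-Real.pi) Real.pi, azimuthal m φ * azimuthal m' φ =
      if m = m' then 2 * Real.pi else 0 := by
  rw [← integral_Ioc_eq_integral_Ioo,
    ← intervalIntegral.integral_of_le (by linarith [Real.pi_pos])]
  have h2 : √2 * √2 = (2 : ℝ) := Real.mul_self_sqrt zero_le_two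
  have hcc : ∀ (a b : ℝ) (m m' : ℤ), ∫ φ in (-Real.pi)..Real.pi,
      (a * Real.cos (m * φ)) * (b * Real.cos (m' * φ)) =
      a * b * (((if m = m' then 2 * Real.pi else 0) + if m + m' = 0 then 2 * Real.pi else 0) / 2) :=
    fun a b m m' => by
      rw [← integral_cos_mul_cos, ← intervalIntegral.integral_const_mul]
      congr 1 with φ
      ring
  have hss : ∀ (a b : ℝ) (m m' : ℤ), ∫ φ in (-Real.pi)..Real.pi,
      (a * Real.sin (m * φ)) * (b * Real.sin (m' * φ)) =
      a * b * (((if m = m' then 2 * Real.pi else 0) - if m + m' = 0 then 2 * Real.pi else 0) / 2) :=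
    fun a b m m' => by
      rw [← integral_sin_mul_sin, ← intervalIntegral.integral_const_mul]
      congr 1 with φ
      ring
  have hsc : ∀ (a b : ℝ) (m m' : ℤ), ∫ φ in (-Real.pi)..Real.pi,
      (a * Real.sin (m * φ)) * (b * Real.cos (m' * φ)) = 0 :=
    fun a b m m' => by
      rw [← mul_zero (a * b), ← integral_sin_mul_cos m m', ← intervalIntegral.integral_const_mul]
      congr 1 with φ
      ring
  have hcs : ∀ (a b : ℝ) (m m' : ℤ), ∫ φ in (-Real.pi)..Real.pi,
      (a * Real.cos (m * φ)) * (b * Real.sin (m' * φ)) = 0 :=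
    fun a b m m' => by
      rw [← hsc b a m' m]
      congr 1 with φ
      ring
  have hz : ∀ φ, azimuthal 0 φ = 1 * Real.cos (((0 : ℤ) : ℝ) * φ) := fun φ => by
    rw [azimuthal_zero, one_mul]
  rcases lt_trichotomy m 0 with hm | rfl | hm <;> rcases lt_trichotomy m' 0 with hm' | rfl | hm'
  · simp only [azimuthal_neg hm, azimuthal_neg hm', hss]
    rw [if_neg (show ¬ m + m' = 0 by omega)]
    split_ifs
    · linear_combination (Real.pi) * h2
    · ring
  · simp only [azimuthal_neg hm, hz, hsc]
    rw [if_neg (by omega)]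
  · simp only [azimuthal_neg hm, azimuthal_pos hm', hsc]
    rw [if_neg (by omega)]
  · simp only [azimuthal_neg hm', hz, hcs]
    rw [if_neg (by omega)]
  · simp only [hz, hcc]
    simp
  · simp only [azimuthal_pos hm', hz, hcc]
    rw [if_neg (by omega), if_neg (by omega)]
    simp only [zero_add, zero_div, mul_zero]
  · simp only [azimuthal_neg hm', azimuthal_pos hm, hcs]
    rw [if_neg (by omega)]
  · simp only [azimuthal_pos hm, hz, hcc]
    rw [if_neg (by omega), if_neg (by omega)]
    simp only [zero_add, zero_div, mul_zero]
  · simp only [azimuthal_pos hm, azimuthal_pos hm', hcc]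
    rw [if_neg (show ¬ m + m' = 0 by omega)]
    split_ifs
    · linear_combination (Real.pi) * h2
    · ring

/-! ### The Lorentz boost to the local rest frame -/

theorem fourMom_zero_sq (p : Mom) : fourMom p 0 ^ 2 = 1 + ∑ i, p i ^ 2 :=
  Real.sq_sqrt (by positivity)

theorem fourMom_zero_eq (p : Mom) : fourMom p 0 = √(1 + ‖p‖ ^ 2) := by
  rw [EuclideanSpace.real_norm_sq_eq]
  rfl

theorem one_le_fourMom_zero (p : Mom) : 1 ≤ fourMom p 0 := by
  rw [fourMom_zero_eq]
  exact Real.one_le_sqrt.2 (by nlinarith [sq_nonneg ‖p‖])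

theorem fourVel_zero_pos {u : Fin 3 → ℝ} (hu : ∑ i, u i ^ 2 < 1) : 0 < fourVel u 0 :=
  one_div_pos.2 (Real.sqrt_pos.2 (sub_pos.2 hu))

theorem fourVel_zero_sq {u : Fin 3 → ℝ} (hu : ∑ i, u i ^ 2 < 1) :
    fourVel u 0 ^ 2 = 1 + ∑ i : Fin 3, fourVel u i.succ ^ 2 := by
  simp only [fourVel, Fin.cons_zero, Fin.cons_succ, div_pow, ← Finset.sum_div]
  have h : 0 < 1 - ∑ i, u i ^ 2 := sub_pos.2 hu
  rw [Real.sq_sqrt h.le]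
  field_simp
  ring

theorem fourVel_neg (u : Fin 3 → ℝ) :
    fourVel (-u) 0 = fourVel u 0 ∧ ∀ i : Fin 3, fourVel (-u) i.succ = -fourVel u i.succ := by
  simp [fourVel, neg_div]

theorem restEnergy_eq (u : Fin 3 → ℝ) (p : Mom) :
    restEnergy u p = fourVel u 0 * fourMom p 0 - ∑ i : Fin 3, fourVel u i.succ * p i := by
  simp [restEnergy, minkowski, fourMom]

theorem restMom_eq (u : Fin 3 → ℝ) (p : Mom) (i : Fin 3) :
    restMom u p i = p i + fourVel u i.succ *
      ((∑ j : Fin 3, fourVel u j.succ * p j) / (fourVel u 0 + 1) - fourMom p 0) := by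
  simp only [restMom, minkowski, tetrad, Fin.cons_zero, Fin.cons_succ, fourMom]
  fin_cases i <;> simp [Fin.sum_univ_three] <;> ring

/-- The mass shell relation `E² = 1 + |q|²` holds in the rest frame, because the tetrad is
Minkowski-orthonormal. -/
theorem restEnergy_sq {u : Fin 3 → ℝ} (hu : ∑ i, u i ^ 2 < 1) (p : Mom) :
    restEnergy u p ^ 2 = 1 + ∑ i, restMom u p i ^ 2 := by
  have h0 := fourVel_zero_pos hu
  have h1 := fourVel_zero_sq hu
  have h2 := fourMom_zero_sq p
  simp only [restEnergy_eq, restMom_eq, Fin.sum_univ_three] at *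
  generalize fourVel u 0 = U at *
  generalize fourMom p 0 = P at *
  generalize fourVel u (Fin.succ 0) = a at *
  generalize fourVel u (Fin.succ 1) = b at *
  generalize fourVel u (Fin.succ 2) = c at *
  have h3 : U + 1 ≠ 0 := by positivity
  generalize hs : (a * p 0 + b * p 1 + c * p 2) = s at *
  have hd : s = (s / (U + 1)) * (U + 1) := by field_simp
  generalize s / (U + 1) = d at *
  have hsum : p 0 ^ 2 + p 1 ^ 2 + p 2 ^ 2 = P ^ 2 - 1 := by linarith
  have hU : a ^ 2 + b ^ 2 + c ^ 2 = U ^ 2 - 1 := by linarith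
  linear_combination (-1) * hsum - (d - P) ^ 2 * hU - 2 * (d - P) * hs +
    (s + d * (U + 1) - 2 * U * P - 2 * (d - P)) * hd

theorem restEnergy_pos {u : Fin 3 → ℝ} (hu : ∑ i, u i ^ 2 < 1) (p : Mom) :
    0 < restEnergy u p := by
  have h0 := fourVel_zero_pos hu
  have h1 := fourVel_zero_sq hu
  have h2 := fourMom_zero_sq p
  have h3 := one_le_fourMom_zero p
  rw [restEnergy_eq, sub_pos]
  refine lt_of_pow_lt_pow_left₀ 2 (by positivity) ?_
  have hcs := Finset.sum_mul_sq_le_sq_mul_sq Finset.univ (fun i : Fin 3 => fourVel u i.succ)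
    (fun i => p i)
  refine hcs.trans_lt ?_
  rw [mul_pow, h1, h2]
  have ha : 0 ≤ ∑ i : Fin 3, fourVel u i.succ ^ 2 := by positivity
  have hb : 0 ≤ ∑ i, p i ^ 2 := by positivity
  nlinarith

theorem restEnergy_eq_sqrt {u : Fin 3 → ℝ} (hu : ∑ i, u i ^ 2 < 1) (p : Mom) :
    restEnergy u p = √(1 + ∑ i, restMom u p i ^ 2) := by
  rw [← restEnergy_sq hu, Real.sqrt_sq (restEnergy_pos hu p).le]

theorem one_le_restEnergy {u : Fin 3 → ℝ} (hu : ∑ i, u i ^ 2 < 1) (p : Mom) :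
    1 ≤ restEnergy u p := by
  rw [restEnergy_eq_sqrt hu, Real.one_le_sqrt]
  have : 0 ≤ ∑ i, restMom u p i ^ 2 := by positivity
  linarith

/-- The momentum in the local rest frame, as a vector. -/
noncomputable def boost (u : Fin 3 → ℝ) (p : Mom) : Mom := WithLp.toLp 2 (restMom u p)

theorem fourMom_boost_zero {u : Fin 3 → ℝ} (hu : ∑ i, u i ^ 2 < 1) (p : Mom) :
    fourMom (boost u p) 0 = restEnergy u p := by
  rw [restEnergy_eq_sqrt hu]
  rfl

/-- The inverse boost, expressing `p` through the rest-frame momentum and energy. -/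
theorem restMom_eq_sub {u : Fin 3 → ℝ} (hu : ∑ i, u i ^ 2 < 1) (p : Mom) (i : Fin 3) :
    p i = restMom u p i + fourVel u i.succ *
      ((∑ j : Fin 3, fourVel u j.succ * restMom u p j) / (fourVel u 0 + 1) + restEnergy u p) := by
  have h0 := fourVel_zero_pos hu
  have h1 := fourVel_zero_sq hu
  have h3 : fourVel u 0 + 1 ≠ 0 := by positivity
  have key : (∑ j : Fin 3, fourVel u j.succ * p j) / (fourVel u 0 + 1) - fourMom p 0 +
      ((∑ j : Fin 3, fourVel u j.succ * restMom u p j) / (fourVel u 0 + 1) + restEnergy u p)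
      = 0 := by
    simp only [restEnergy_eq, restMom_eq, Fin.sum_univ_three] at *
    generalize fourVel u 0 = U at *
    generalize fourMom p 0 = P at *
    generalize fourVel u (Fin.succ 0) = a at *
    generalize fourVel u (Fin.succ 1) = b at *
    generalize fourVel u (Fin.succ 2) = c at *
    have hU : a ^ 2 = U ^ 2 - 1 - b ^ 2 - c ^ 2 := by linarith
    field_simp
    ring_nf
    have hU3 : a ^ 3 = a * (U ^ 2 - 1 - b ^ 2 - c ^ 2) := by rw [← hU]; ring
    simp only [hU, hU3]
    ring
  rw [restMom_eq u p i]
  linear_combination -(fourVel u i.succ) * key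

theorem sum_neg_sq {u : Fin 3 → ℝ} (hu : ∑ i, u i ^ 2 < 1) : ∑ i, (-u) i ^ 2 < 1 := by
  simpa using hu

theorem boost_neg_boost {u : Fin 3 → ℝ} (hu : ∑ i, u i ^ 2 < 1) (p : Mom) :
    boost (-u) (boost u p) = p := by
  ext i
  change restMom (-u) (boost u p) i = p i
  rw [restMom_eq, fourMom_boost_zero hu, (fourVel_neg u).1, (fourVel_neg u).2,
    restMom_eq_sub hu p i]
  simp only [boost, (fourVel_neg u).2, neg_mul, Finset.sum_neg_distrib]
  ring

theorem boost_bijective {u : Fin 3 → ℝ} (hu : ∑ i, u i ^ 2 < 1) :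
    Function.Bijective (boost u) := by
  refine Function.bijective_iff_has_inverse.2 ⟨boost (-u), boost_neg_boost hu, fun p => ?_⟩
  have := boost_neg_boost (sum_neg_sq hu) p
  rwa [neg_neg] at this

/-- The Jacobian determinant of the boost is `E / p⁰`: the derivative is a rank-one perturbation of
the identity. -/
theorem exists_hasFDerivAt_boost (u : Fin 3 → ℝ) (hu : ∑ i, u i ^ 2 < 1) (p : Mom) :
    ∃ B : Mom →L[ℝ] Mom, HasFDerivAt (boost u) B p ∧ B.det = restEnergy u p / fourMom p 0 := by
  set a : Mom := WithLp.toLp 2 (fun i : Fin 3 => fourVel u i.succ) with ha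
  set φ : Mom →L[ℝ] ℝ :=
    (fourVel u 0 + 1)⁻¹ • innerSL ℝ a - (1 / (2 * √(1 + ‖p‖ ^ 2))) • (2 • innerSL ℝ p) with hφ
  have hin : ∀ v : Mom, inner ℝ a v = ∑ i : Fin 3, fourVel u i.succ * v i := fun v => by
    simp [PiLp.inner_apply, ha, mul_comm]
  have hboost : boost u = fun p : Mom =>
      p + ((fourVel u 0 + 1)⁻¹ * inner ℝ a p - √(1 + ‖p‖ ^ 2)) • a := by
    funext p
    ext i
    change restMom u p i =
      p i + ((fourVel u 0 + 1)⁻¹ * inner ℝ a p - √(1 + ‖p‖ ^ 2)) * fourVel u i.succ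
    rw [hin, restMom_eq, fourMom_zero_eq]
    ring
  refine ⟨ContinuousLinearMap.id ℝ Mom + φ.smulRight a, ?_, ?_⟩
  · rw [hboost]
    refine (hasFDerivAt_id p).add (HasFDerivAt.smul_const ?_ a)
    refine HasFDerivAt.sub ?_ ?_
    · exact ((innerSL ℝ a).hasFDerivAt).const_mul _
    · exact ((hasStrictFDerivAt_norm_sq p).hasFDerivAt.const_add 1).sqrt (by positivity)
  · have hlin : ((ContinuousLinearMap.id ℝ Mom + φ.smulRight a : Mom →L[ℝ] Mom) : Mom →ₗ[ℝ] Mom) =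
        LinearMap.transvection (φ : Mom →ₗ[ℝ] ℝ) a := by
      ext v
      simp [LinearMap.transvection.apply]
    rw [ContinuousLinearMap.det, hlin, LinearMap.transvection.det]
    have h0 := fourVel_zero_pos hu
    have h1 := fourVel_zero_sq hu
    have h2 := one_le_fourMom_zero p
    have haa : inner ℝ a a = fourVel u 0 ^ 2 - 1 := by
      rw [hin, h1]
      simp [ha, pow_two]
    have hpa : inner ℝ p a = ∑ i : Fin 3, fourVel u i.succ * p i := by
      rw [real_inner_comm, hin]
    simp only [hφ, ContinuousLinearMap.coe_coe, sub_apply,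
      smul_apply, innerSL_apply_apply, smul_eq_mul, nsmul_eq_mul, haa, hpa,
      ← fourMom_zero_eq, restEnergy_eq, Nat.cast_ofNat]
    field_simp
    ring

theorem lintegral_boost {u : Fin 3 → ℝ} (hu : ∑ i, u i ^ 2 < 1) (G : Mom → ENNReal) :
    ∫⁻ q, G q = ∫⁻ p, ENNReal.ofReal (restEnergy u p / fourMom p 0) * G (boost u p) := by
  choose B hB hdet using exists_hasFDerivAt_boost u hu
  have h := lintegral_image_eq_lintegral_abs_det_fderiv_mul (volume : Measure Mom)
    MeasurableSet.univ (fun x _ => (hB x).hasFDerivWithinAt)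
    (boost_bijective hu).injective.injOn G
  rw [image_univ, (boost_bijective hu).surjective.range_eq] at h
  simp only [setLIntegral_univ] at h
  rw [h]
  congr 1 with p
  rw [hdet, abs_of_nonneg (div_nonneg (restEnergy_pos hu p).le
    (zero_le_one.trans (one_le_fourMom_zero p)))]

/-! ### Spherical coordinates -/

/-- The integral over momentum space in cylindrical order: the third coordinate outside, the plane of
the first two inside. -/
theorem lintegral_mom_eq (f : Mom → ENNReal) (hf : Measurable f) :
    ∫⁻ q, f q = ∫⁻ z : ℝ, ∫⁻ w : ℝ × ℝ, f (!₂[w.1, w.2, z]) := by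
  have e1 := (PiLp.volume_preserving_toLp (Fin 3)).lintegral_comp hf
  have e2 := ((volume_preserving_piFinSuccAbove (fun _ : Fin 3 => ℝ) 2).symm).lintegral_comp
    (f := fun q : Fin 3 → ℝ => f (WithLp.toLp 2 q)) (by fun_prop)
  have e3 := (((MeasurePreserving.id (volume : Measure ℝ)).prod
    (volume_preserving_finTwoArrow ℝ)).symm (e := (MeasurableEquiv.refl ℝ).prodCongr
      (MeasurableEquiv.finTwoArrow (α := ℝ)))).lintegral_comp
    (f := fun q : ℝ × (Fin 2 → ℝ) =>
      f (WithLp.toLp 2 ((MeasurableEquiv.piFinSuccAbove (fun _ : Fin 3 => ℝ) 2).symm q)))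
      (by fun_prop)
  rw [← e1, ← e2]
  refine e3.symm.trans ?_
  rw [lintegral_prod]
  · congr 1 with z
    congr 1 with w
    congr 1
    ext i
    fin_cases i <;> rfl
  · exact Measurable.aemeasurable (by fun_prop)

/-- Since `ENNReal.ofReal r = 0` for `r ≤ 0`, the radial integral may be extended to all of `ℝ`. -/
theorem setLIntegral_Ioi_ofReal_mul (g : ℝ → ENNReal) :
    ∫⁻ r in Ioi (0 : ℝ), ENNReal.ofReal r * g r = ∫⁻ r, ENNReal.ofReal r * g r := by
  rw [← lintegral_indicator measurableSet_Ioi]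
  congr 1 with r
  by_cases h : r ∈ Ioi (0 : ℝ)
  · rw [indicator_of_mem h]
  · rw [indicator_of_notMem h, ENNReal.ofReal_of_nonpos (not_lt.1 h), zero_mul]

/-- Polar coordinates, with the Jacobian factor extended by zero to negative radii. -/
theorem lintegral_polar (f : ℝ × ℝ → ENNReal) (hf : Measurable f) :
    ∫⁻ w, f w = ∫⁻ r in Ioi (0 : ℝ), ∫⁻ φ in Ioo (-Real.pi) Real.pi,
      ENNReal.ofReal r * f (r * Real.cos φ, r * Real.sin φ) := by
  rw [← lintegral_comp_polarCoord_symm, polarCoord_target, Measure.volume_eq_prod,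
    ← Measure.prod_restrict, lintegral_prod]
  · rfl
  · refine Measurable.aemeasurable ?_
    have : Measurable fun p : ℝ × ℝ => (p.1 * Real.cos p.2, p.1 * Real.sin p.2) := by fun_prop
    exact (ENNReal.measurable_ofReal.comp measurable_fst).mul (hf.comp this)

/-- Spherical coordinates, obtained by applying polar coordinates twice: to the plane of the first two
components, with radius `r`, and then to the half-plane of the pairs `(z, r)`. -/
theorem lintegral_spherical (F : ℝ × ℝ × ℝ → ENNReal) (hF : Measurable F) :
    ∫⁻ q : Mom, F (‖q‖, q 2 / ‖q‖, Complex.arg ⟨q 0, q 1⟩) =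
      ∫⁻ r in Ioi (0 : ℝ), ∫⁻ ϑ in Ioo 0 Real.pi, ∫⁻ φ in Ioo (-Real.pi) Real.pi,
        ENNReal.ofReal (r ^ 2 * Real.sin ϑ) * F (r, Real.cos ϑ, φ) := by
  set G : ℝ × ℝ → ENNReal := fun s => ∫⁻ φ in Ioo (-Real.pi) Real.pi, F (s.1, s.2, φ) with hG
  have hGm : Measurable G := by
    refine Measurable.lintegral_prod_right' (f := fun x : (ℝ × ℝ) × ℝ => F (x.1.1, x.1.2, x.2)) ?_
    fun_prop
  have harg : Measurable fun q : Mom => Complex.arg ⟨q 0, q 1⟩ := by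
    refine Complex.measurable_arg.comp ?_
    have : (fun q : Mom => (⟨q 0, q 1⟩ : ℂ)) = fun q => Complex.measurableEquivRealProd.symm
      (q 0, q 1) := rfl
    rw [this]
    fun_prop
  have hFm : Measurable fun q : Mom => F (‖q‖, q 2 / ‖q‖, Complex.arg ⟨q 0, q 1⟩) := by
    refine hF.comp (measurable_norm.prodMk (Measurable.prodMk ?_ harg))
    fun_prop
  rw [lintegral_mom_eq _ hFm]
  have hnorm : ∀ (r φ z : ℝ), ‖(!₂[r * Real.cos φ, r * Real.sin φ, z] : Mom)‖ =
      √(z ^ 2 + r ^ 2) := fun r φ z => by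
    rw [EuclideanSpace.norm_eq]
    congr 1
    simp [Fin.sum_univ_three]
    linear_combination r ^ 2 * Real.sin_sq_add_cos_sq φ
  have step2 : ∀ z : ℝ, ∫⁻ w : ℝ × ℝ, F (‖(!₂[w.1, w.2, z] : Mom)‖,
      (!₂[w.1, w.2, z] : Mom) 2 / ‖(!₂[w.1, w.2, z] : Mom)‖,
      Complex.arg ⟨(!₂[w.1, w.2, z] : Mom) 0, (!₂[w.1, w.2, z] : Mom) 1⟩) =
      ∫⁻ r : ℝ, ENNReal.ofReal r * G (√(z ^ 2 + r ^ 2), z / √(z ^ 2 + r ^ 2)) := by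
    intro z
    have hm : Measurable fun w : ℝ × ℝ => F (‖(!₂[w.1, w.2, z] : Mom)‖,
        (!₂[w.1, w.2, z] : Mom) 2 / ‖(!₂[w.1, w.2, z] : Mom)‖,
        Complex.arg ⟨(!₂[w.1, w.2, z] : Mom) 0, (!₂[w.1, w.2, z] : Mom) 1⟩) :=
      hFm.comp (by fun_prop : Measurable fun w : ℝ × ℝ => (!₂[w.1, w.2, z] : Mom))
    rw [lintegral_polar _ hm, ← setLIntegral_Ioi_ofReal_mul]
    refine setLIntegral_congr_fun measurableSet_Ioi fun r hr => ?_
    simp only [hnorm]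
    rw [lintegral_const_mul' _ _ ENNReal.ofReal_ne_top]
    congr 1
    refine setLIntegral_congr_fun measurableSet_Ioo fun φ hφ => ?_
    have ha : Complex.arg ⟨r * Real.cos φ, r * Real.sin φ⟩ = φ := by
      have hc : (⟨r * Real.cos φ, r * Real.sin φ⟩ : ℂ) =
          r * (Complex.cos φ + Complex.sin φ * Complex.I) := by
        apply Complex.ext <;> simp [Complex.cos_ofReal_re, Complex.sin_ofReal_re]
      rw [hc, Complex.arg_mul_cos_add_sin_mul_I hr ⟨hφ.1, hφ.2.le⟩]
    simp [ha]
  simp only [step2]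
  have hm2 : Measurable fun w : ℝ × ℝ =>
      ENNReal.ofReal w.2 * G (√(w.1 ^ 2 + w.2 ^ 2), w.1 / √(w.1 ^ 2 + w.2 ^ 2)) :=
    (ENNReal.measurable_ofReal.comp measurable_snd).mul (hGm.comp (by fun_prop))
  have hprod := lintegral_prod (μ := (volume : Measure ℝ)) (ν := (volume : Measure ℝ)) _
    hm2.aemeasurable
  refine hprod.symm.trans ((lintegral_polar _ hm2).trans ?_)
  refine setLIntegral_congr_fun measurableSet_Ioi fun r hr => ?_
  rw [mem_Ioi] at hr
  have hr2 : ∀ ϑ, √((r * Real.cos ϑ) ^ 2 + (r * Real.sin ϑ) ^ 2) = r := fun ϑ => by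
    rw [show (r * Real.cos ϑ) ^ 2 + (r * Real.sin ϑ) ^ 2 = r ^ 2 by
      linear_combination r ^ 2 * Real.sin_sq_add_cos_sq ϑ, Real.sqrt_sq hr.le]
  simp only [hr2, mul_div_cancel_left₀ _ hr.ne']
  rw [← lintegral_indicator measurableSet_Ioo, ← lintegral_indicator measurableSet_Ioo]
  congr 1 with ϑ
  by_cases h : ϑ ∈ Ioo 0 Real.pi
  · have h' : ϑ ∈ Ioo (-Real.pi) Real.pi := ⟨by linarith [h.1, Real.pi_pos], h.2⟩
    rw [indicator_of_mem h, indicator_of_mem h',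
      lintegral_const_mul' _ _ ENNReal.ofReal_ne_top, ← mul_assoc, ← ENNReal.ofReal_mul hr.le]
    congr 2
    ring
  · rw [indicator_of_notMem h]
    by_cases h' : ϑ ∈ Ioo (-Real.pi) Real.pi
    · rw [indicator_of_mem h']
      have hle : ϑ ≤ 0 := by
        by_contra hc
        exact h ⟨not_le.1 hc, h'.2⟩
      have hs := Real.sin_nonpos_of_nonpos_of_neg_pi_le hle h'.1.le
      rw [ENNReal.ofReal_of_nonpos (mul_nonpos_of_nonneg_of_nonpos hr.le hs)]
      simp
    · rw [indicator_of_notMem h']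

theorem lintegral_Ioo_cos (H : ℝ → ENNReal) :
    ∫⁻ y in Ioo (-1 : ℝ) 1, H y =
      ∫⁻ ϑ in Ioo 0 Real.pi, ENNReal.ofReal (Real.sin ϑ) * H (Real.cos ϑ) := by
  have himg : Real.cos '' Ioo 0 Real.pi = Ioo (-1 : ℝ) 1 := by
    ext y
    constructor
    · rintro ⟨ϑ, ⟨h0, h1⟩, rfl⟩
      constructor
      · rw [← Real.cos_pi]
        exact Real.cos_lt_cos_of_nonneg_of_le_pi h0.le le_rfl h1
      · rw [← Real.cos_zero]
        exact Real.cos_lt_cos_of_nonneg_of_le_pi le_rfl h1.le h0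
    · rintro ⟨h0, h1⟩
      refine ⟨Real.arccos y, ⟨Real.arccos_pos.2 h1, ?_⟩, Real.cos_arccos h0.le h1.le⟩
      exact lt_of_le_of_ne (Real.arccos_le_pi y) fun h => h0.not_ge (Real.arccos_eq_pi.1 h)
  rw [← himg, lintegral_image_eq_lintegral_abs_deriv_mul measurableSet_Ioo
    (fun x _ => (Real.hasDerivAt_cos x).hasDerivWithinAt)
    (Real.injOn_cos.mono Ioo_subset_Icc_self)]
  refine setLIntegral_congr_fun measurableSet_Ioo fun ϑ hϑ => ?_
  simp only [abs_neg, abs_of_pos (Real.sin_pos_of_mem_Ioo hϑ)]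

theorem lintegral_Ioi_sqrt (H : ℝ → ENNReal) :
    ∫⁻ x in Ioi (1 : ℝ), H x =
      ∫⁻ r in Ioi (0 : ℝ), ENNReal.ofReal (r / √(1 + r ^ 2)) * H (√(1 + r ^ 2)) := by
  have himg : (fun r : ℝ => √(1 + r ^ 2)) '' Ioi 0 = Ioi 1 := by
    ext x
    constructor
    · rintro ⟨r, hr, rfl⟩
      rw [mem_Ioi] at hr
      rw [mem_Ioi, Real.lt_sqrt zero_le_one]
      nlinarith
    · intro hx
      rw [mem_Ioi] at hx
      refine ⟨√(x ^ 2 - 1), Real.sqrt_pos.2 (by nlinarith), ?_⟩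
      simp only
      rw [Real.sq_sqrt (by nlinarith), add_sub_cancel, Real.sqrt_sq (by linarith)]
  have hderiv : ∀ r ∈ Ioi (0 : ℝ),
      HasDerivWithinAt (fun r : ℝ => √(1 + r ^ 2)) (r / √(1 + r ^ 2)) (Ioi 0) r := by
    intro r _
    have h := (((hasDerivAt_id r).pow 2).const_add 1).sqrt (by simp; positivity)
    refine h.hasDerivWithinAt.congr_deriv ?_
    simp only [id, Pi.pow_apply, Nat.cast_ofNat]
    have : √(1 + r ^ 2) ≠ 0 := by positivity
    field_simp
    norm_num
  have hinj : InjOn (fun r : ℝ => √(1 + r ^ 2)) (Ioi 0) := by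
    intro r hr s hs h
    rw [mem_Ioi] at hr hs
    have h' : 1 + r ^ 2 = 1 + s ^ 2 := (Real.sqrt_inj (by positivity) (by positivity)).1 h
    nlinarith
  rw [← himg, lintegral_image_eq_lintegral_abs_deriv_mul measurableSet_Ioi hderiv hinj]
  refine setLIntegral_congr_fun measurableSet_Ioi fun r hr => ?_
  rw [mem_Ioi] at hr
  simp only [abs_of_nonneg (div_nonneg hr.le (Real.sqrt_nonneg (1 + r ^ 2)))]

/-! ### The invariant measure in rest-frame coordinates -/

/-- The Lorentz-invariant measure `d³p / p⁰` on the mass shell. -/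
noncomputable def shellMeasure : Measure Mom :=
  volume.withDensity fun p => ENNReal.ofReal (1 / fourMom p 0)

/-- The rest-frame coordinates `(E, y, φ)` of a momentum. -/
noncomputable def restCoord (u : Fin 3 → ℝ) (p : Mom) : ℝ × ℝ × ℝ :=
  (restEnergy u p, polarCos u p, azimuth u p)

/-- The image of `d³p / p⁰` in the coordinates `(E, y, φ)`: `√(E² - 1) dE dy dφ`. -/
noncomputable def coordMeasure : Measure (ℝ × ℝ × ℝ) :=
  ((volume.restrict (Ioi 1)).withDensity fun x => ENNReal.ofReal √(x ^ 2 - 1)).prod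
    ((volume.restrict (Ioo (-1) 1)).prod (volume.restrict (Ioo (-Real.pi) Real.pi)))

theorem continuous_fourMom (α : Fin 4) : Continuous fun p : Mom => fourMom p α := by
  refine Fin.cases ?_ (fun i => ?_) α
  · simp only [fourMom_zero_eq]
    fun_prop
  · simp only [fourMom, Fin.cons_succ]
    fun_prop

theorem continuous_restEnergy (u : Fin 3 → ℝ) : Continuous (restEnergy u) := by
  have h := continuous_fourMom
  unfold restEnergy minkowski
  fun_prop

theorem continuous_restMom (u : Fin 3 → ℝ) (i : Fin 3) : Continuous fun p => restMom u p i := by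
  have h := continuous_fourMom
  unfold restMom minkowski
  fun_prop

theorem measurable_restCoord (u : Fin 3 → ℝ) : Measurable (restCoord u) := by
  have h1 := (continuous_restEnergy u).measurable
  have h2 := fun i => (continuous_restMom u i).measurable
  refine h1.prodMk (Measurable.prodMk ?_ ?_)
  · unfold polarCos
    fun_prop
  · refine Complex.measurable_arg.comp ?_
    exact Complex.measurableEquivRealProd.symm.measurable.comp ((h2 0).prodMk (h2 1))

/-- The boost has Jacobian `E / p⁰`, so that `d³p / p⁰` is invariant; spherical coordinates and the
substitution `E = √(1 + r²)` do the rest. -/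
theorem map_restCoord {u : Fin 3 → ℝ} (hu : ∑ i, u i ^ 2 < 1) :
    shellMeasure.map (restCoord u) = coordMeasure := by
  refine Measure.ext_of_lintegral _ fun F hF => ?_
  have hp0 : Measurable fun p : Mom => ENNReal.ofReal (1 / fourMom p 0) := by
    have := (continuous_fourMom 0).measurable
    fun_prop
  rw [lintegral_map hF (measurable_restCoord u), shellMeasure,
    lintegral_withDensity_eq_lintegral_mul _ hp0 (g := fun p => F (restCoord u p))
      (hF.comp (measurable_restCoord u))]
  have hFr : Measurable fun s : ℝ × ℝ × ℝ =>
      ENNReal.ofReal (1 / √(1 + s.1 ^ 2)) * F (√(1 + s.1 ^ 2), s.2) := by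
    fun_prop
  have h1 := lintegral_boost hu fun q : Mom => ENNReal.ofReal (1 / √(1 + ‖q‖ ^ 2)) *
    F (√(1 + ‖q‖ ^ 2), q 2 / ‖q‖, Complex.arg ⟨q 0, q 1⟩)
  have h2 : ∀ p, ENNReal.ofReal (restEnergy u p / fourMom p 0) *
      (ENNReal.ofReal (1 / √(1 + ‖boost u p‖ ^ 2)) * F (√(1 + ‖boost u p‖ ^ 2),
        boost u p 2 / ‖boost u p‖, Complex.arg ⟨boost u p 0, boost u p 1⟩)) =
      ENNReal.ofReal (1 / fourMom p 0) * F (restCoord u p) := fun p => by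
    have he : √(1 + ‖boost u p‖ ^ 2) = restEnergy u p := by
      rw [← fourMom_zero_eq, fourMom_boost_zero hu]
    have hn : ‖boost u p‖ = √(restEnergy u p ^ 2 - 1) := by
      rw [restEnergy_sq hu, add_sub_cancel_left, EuclideanSpace.norm_eq]
      simp [boost]
    have hE := restEnergy_pos hu p
    rw [he, ← mul_assoc, ← ENNReal.ofReal_mul (div_nonneg hE.le
      (zero_le_one.trans (one_le_fourMom_zero p))), hn]
    congr 2
    field_simp
  simp only [h2] at h1
  refine h1.symm.trans ?_
  have h3 := lintegral_spherical _ hFr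
  simp only at h3
  rw [h3, coordMeasure, lintegral_prod _ hF.aemeasurable]
  rw [lintegral_withDensity_eq_lintegral_mul _ (by fun_prop)
    (Measurable.lintegral_prod_right' (by fun_prop))]
  rw [lintegral_Ioi_sqrt]
  refine setLIntegral_congr_fun measurableSet_Ioi fun r hr => ?_
  rw [mem_Ioi] at hr
  simp only [Pi.mul_apply]
  rw [lintegral_prod _ (by fun_prop), lintegral_Ioo_cos, ← mul_assoc,
    ← ENNReal.ofReal_mul (by positivity), Real.sq_sqrt (by positivity), add_sub_cancel_left,
    Real.sqrt_sq hr.le, ← lintegral_const_mul' _ _ ENNReal.ofReal_ne_top]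
  refine setLIntegral_congr_fun measurableSet_Ioo fun ϑ hϑ => ?_
  have hs := (Real.sin_pos_of_mem_Ioo hϑ).le
  rw [← mul_assoc, ← ENNReal.ofReal_mul (by positivity),
    ← lintegral_const_mul' _ _ ENNReal.ofReal_ne_top]
  refine setLIntegral_congr_fun measurableSet_Ioo fun φ _ => ?_
  rw [← mul_assoc, ← ENNReal.ofReal_mul (by positivity)]
  congr 2
  ring

/-! ### The weighted inner product of basis functions -/

theorem juttner_pos (u : Fin 3 → ℝ) {θ : ℝ} (hθ : 0 < θ) (p : Mom) : 0 < juttner u θ p := by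
  have := besselK_two_pos (inv_pos.2 hθ)
  have := Real.pi_pos
  unfold juttner
  positivity

theorem wInner_eq_integral (u : Fin 3 → ℝ) (θ : ℝ) (f h : Mom → ℝ) :
    wInner u θ f h = ∫ p, 1 / juttner u θ p * f p * h p ∂shellMeasure := by
  have hp0 : Measurable fun p : Mom => ENNReal.ofReal (1 / fourMom p 0) := by
    have := (continuous_fourMom 0).measurable
    fun_prop
  rw [shellMeasure, integral_withDensity_eq_integral_toReal_smul hp0
    (Eventually.of_forall fun _ => ENNReal.ofReal_lt_top), wInner]
  congr 1 with p
  rw [ENNReal.toReal_ofReal (one_div_nonneg.2 (zero_le_one.trans (one_le_fourMom_zero p))),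
    smul_eq_mul]
  ring

/-- The product of two basis functions and a polynomial `R` in the energy, divided by the weight,
as a function of the coordinates `(E, y, φ)`, in which it separates. -/
noncomputable def basisProduct (θ : ℝ) (R : Polynomial ℝ) (l k l' k' : ℕ) (m m' : ℤ)
    (s : ℝ × ℝ × ℝ) : ℝ :=
  (θ⁻¹ / (4 * Real.pi * besselK 2 θ⁻¹) *
    ((R * orthoPoly l θ⁻¹ k * orthoPoly l' θ⁻¹ k').eval s.1 *
      √(s.1 ^ 2 - 1) ^ (l + l') * Real.exp (-θ⁻¹ * s.1))) *
    ((normLegendre l m.natAbs s.2.1 * normLegendre l' m'.natAbs s.2.1) *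
      (azimuthal m s.2.2 * azimuthal m' s.2.2))

theorem basisFun_mul_eq (u : Fin 3 → ℝ) {θ : ℝ} (hθ : 0 < θ) (R : Polynomial ℝ) (l k l' k' : ℕ)
    (m m' : ℤ) (p : Mom) :
    1 / juttner u θ p * (R.eval (restEnergy u p) * basisFun u θ l k m p) *
        basisFun u θ l' k' m' p =
      basisProduct θ R l k l' k' m m' (restCoord u p) := by
  have hg := (juttner_pos u hθ p).ne'
  have hexp : θ⁻¹ / (4 * Real.pi * besselK 2 θ⁻¹) * Real.exp (-θ⁻¹ * restEnergy u p) =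
      juttner u θ p := by
    rw [juttner]
    congr 2
    field_simp
  simp only [basisProduct, restCoord, basisFun, sphHarm_eq, Polynomial.eval_mul, pow_add]
  rw [show ∀ a b c d e f : ℝ, (a * (b * c * d)) * (e * f) = (a * d) * (b * c) * (e * f) from
    fun a b c d e f => by ring, hexp]
  field_simp

theorem integrable_basisFun_mul {u : Fin 3 → ℝ} (hu : ∑ i, u i ^ 2 < 1) {θ : ℝ} (hθ : 0 < θ)
    (R : Polynomial ℝ) (l k l' k' : ℕ) (m m' : ℤ) :
    Integrable (fun p => 1 / juttner u θ p * (R.eval (restEnergy u p) * basisFun u θ l k m p) *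
      basisFun u θ l' k' m' p) shellMeasure := by
  have hint : Integrable (basisProduct θ R l k l' k' m m') coordMeasure := by
    have hc1 := continuous_normLegendre l m.natAbs
    have hc2 := continuous_normLegendre l' m'.natAbs
    have hc3 := continuous_azimuthal m
    have hc4 := continuous_azimuthal m'
    refine Integrable.mul_prod (f := fun x : ℝ => θ⁻¹ / (4 * Real.pi * besselK 2 θ⁻¹) *
          ((R * orthoPoly l θ⁻¹ k * orthoPoly l' θ⁻¹ k').eval x *
            √(x ^ 2 - 1) ^ (l + l') * Real.exp (-θ⁻¹ * x)))
        (g := fun s : ℝ × ℝ => (normLegendre l m.natAbs s.1 * normLegendre l' m'.natAbs s.1) *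
          (azimuthal m s.2 * azimuthal m' s.2)) (Integrable.const_mul ?_ _)
        (Integrable.mul_prod (f := fun y => normLegendre l m.natAbs y * normLegendre l' m'.natAbs y)
          (g := fun φ => azimuthal m φ * azimuthal m' φ) ?_ ?_)
    · rw [integrable_withDensity_iff (by fun_prop)
        (Eventually.of_forall fun _ => ENNReal.ofReal_lt_top)]
      refine (integrableOn_eval_mul_sqrt_pow_mul_exp
        (R * orthoPoly l θ⁻¹ k * orthoPoly l' θ⁻¹ k') (l + l' + 1) (inv_pos.2 hθ)).congr
        (Eventually.of_forall fun x => ?_)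
      simp only [ENNReal.toReal_ofReal (Real.sqrt_nonneg _)]
      ring
    · exact (Continuous.integrableOn_Icc (by fun_prop)).mono_set Ioo_subset_Icc_self
    · exact (Continuous.integrableOn_Icc (by fun_prop)).mono_set Ioo_subset_Icc_self
  rw [← map_restCoord hu] at hint
  refine (hint.comp_measurable (measurable_restCoord u)).congr (Eventually.of_forall fun p => ?_)
  exact (basisFun_mul_eq u hθ R l k l' k' m m' p).symm

/-- Multiplication by a function of the energy respects the decomposition by `(ℓ, m)`, and acts on
each summand as on the polynomials with weight `ω^{(ℓ)}`. -/
theorem wInner_basisFun {u : Fin 3 → ℝ} (hu : ∑ i, u i ^ 2 < 1) {θ : ℝ} (hθ : 0 < θ)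
    (R : Polynomial ℝ) {l l' : ℕ} (k k' : ℕ) {m m' : ℤ} (hm : m.natAbs ≤ l)
    (hm' : m'.natAbs ≤ l') :
    wInner u θ (fun p => R.eval (restEnergy u p) * basisFun u θ l k m p) (basisFun u θ l' k' m') =
      if l = l' ∧ m = m' then polyInner l θ⁻¹ (R * orthoPoly l θ⁻¹ k) (orthoPoly l θ⁻¹ k')
      else 0 := by
  have hc1 := continuous_normLegendre l m.natAbs
  have hc2 := continuous_normLegendre l' m'.natAbs
  have hc3 := continuous_azimuthal m
  have hc4 := continuous_azimuthal m'
  rw [wInner_eq_integral]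
  simp only [basisFun_mul_eq u hθ R l k l' k' m m']
  rw [← integral_map (measurable_restCoord u).aemeasurable
    (Continuous.aestronglyMeasurable (by unfold basisProduct; fun_prop)), map_restCoord hu,
    coordMeasure]
  simp only [basisProduct]
  rw [integral_prod_mul (f := fun x : ℝ => θ⁻¹ / (4 * Real.pi * besselK 2 θ⁻¹) *
      ((R * orthoPoly l θ⁻¹ k * orthoPoly l' θ⁻¹ k').eval x *
        √(x ^ 2 - 1) ^ (l + l') * Real.exp (-θ⁻¹ * x)))
    (g := fun s : ℝ × ℝ => (normLegendre l m.natAbs s.1 * normLegendre l' m'.natAbs s.1) *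
      (azimuthal m s.2 * azimuthal m' s.2)),
    integral_prod_mul (f := fun y => normLegendre l m.natAbs y * normLegendre l' m'.natAbs y)
      (g := fun φ => azimuthal m φ * azimuthal m' φ), integral_azimuthal_mul]
  by_cases hmm : m = m'
  · subst hmm
    rw [integral_normLegendre_mul l l' m.natAbs hm hm']
    by_cases hll : l = l'
    · subst hll
      simp only [and_self, if_true]
      rw [integral_withDensity_eq_integral_toReal_smul (by fun_prop)
        (Eventually.of_forall fun _ => ENNReal.ofReal_lt_top), polyInner,
        integral_Ici_eq_integral_Ioi, ← integral_mul_const]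
      refine setIntegral_congr_fun measurableSet_Ioi fun x hx => ?_
      simp only [weight_eq (le_of_lt (mem_Ioi.1 hx)), ENNReal.toReal_ofReal (Real.sqrt_nonneg _),
        smul_eq_mul, Polynomial.eval_mul]
      have := (besselK_two_pos (inv_pos.2 hθ)).ne'
      have := Real.pi_pos.ne'
      field_simp
      ring
    · simp [hll]
  · simp [hmm]

/-! ### The energy estimate for the dispersion relation -/

open Matrix in
theorem re_star_dotProduct_map_mulVec {ι : Type*} [Fintype ι] (S : Matrix ι ι ℝ) (v : ι → ℂ) :
    (star v ⬝ᵥ (S.map Complex.ofReal) *ᵥ v).re =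
      (fun i => (v i).re) ⬝ᵥ S *ᵥ (fun i => (v i).re) +
        (fun i => (v i).im) ⬝ᵥ S *ᵥ (fun i => (v i).im) := by
  simp only [dotProduct, mulVec, Finset.mul_sum, Complex.re_sum, ← Finset.sum_add_distrib]
  refine Finset.sum_congr rfl fun i _ => Finset.sum_congr rfl fun j _ => ?_
  simp

open Matrix in
theorem im_star_dotProduct_map_mulVec {ι : Type*} [Fintype ι] {S : Matrix ι ι ℝ}
    (hS : S.IsSymm) (v : ι → ℂ) : (star v ⬝ᵥ (S.map Complex.ofReal) *ᵥ v).im = 0 := by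
  have h : (S.map Complex.ofReal).IsHermitian := by
    ext i j
    simp only [conjTranspose_apply, map_apply, RCLike.star_def, Complex.conj_ofReal]
    rw [← hS.apply i j]
  exact h.im_star_dotProduct_mulVec_self v

open Matrix in
/-- The energy estimate. Let the fluxes be `M^α (C + H)` and the source `-r N C`, with `M^α`
symmetric, `M⁰ ≥ 1`, `N ≥ 1`, and let the range of `N C` be orthogonal to that of `H`. Testing the
eigenvalue problem with `v = (C + H) A` gives
`Im ω ⟨v, M⁰ v⟩ = r ⟨C A, N C A⟩ ≥ 0`, where `v ≠ 0`: otherwise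
`0 = ⟨C A, N v⟩ = ⟨C A, N C A⟩`, so that `C A = 0` and `H A = 0`. -/
theorem im_nonneg_of_energy_estimate {ι : Type*} [Fintype ι] {κ : Type*} [Fintype κ]
    (M₀ N C H : Matrix ι ι ℝ) (M : κ → Matrix ι ι ℝ) {r : ℝ} (hr : 0 < r)
    (hM₀ : M₀.IsSymm) (hM : ∀ i, (M i).IsSymm)
    (hM₀pos : ∀ x : ι → ℝ, x ⬝ᵥ x ≤ x ⬝ᵥ M₀ *ᵥ x) (hNpos : ∀ x : ι → ℝ, x ⬝ᵥ x ≤ x ⬝ᵥ N *ᵥ x)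
    (horth : Hᵀ * (N * C) = 0)
    (hinj : ∀ x : ι → ℝ, C *ᵥ x = 0 → H *ᵥ x = 0 → x = 0)
    (k : κ → ℝ) (ω : ℂ) (A : ι → ℂ) (hA : A ≠ 0)
    (hdisp : ((Complex.I * ω) • (M₀ * (C + H)).map Complex.ofReal
      - ∑ i, (Complex.I * (k i : ℂ)) • (M i * (C + H)).map Complex.ofReal
      - (-(r • (N * C))).map Complex.ofReal) *ᵥ A = 0) : 0 ≤ ω.im := by
  have hpos : ∀ (S : Matrix ι ι ℝ) (_ : ∀ x : ι → ℝ, x ⬝ᵥ x ≤ x ⬝ᵥ S *ᵥ x) (v : ι → ℂ),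
      0 ≤ (star v ⬝ᵥ (S.map Complex.ofReal) *ᵥ v).re ∧
        ((star v ⬝ᵥ (S.map Complex.ofReal) *ᵥ v).re ≤ 0 → v = 0) := by
    intro S hS v
    rw [re_star_dotProduct_map_mulVec]
    set a : ι → ℝ := fun i => (v i).re with ha
    set b : ι → ℝ := fun i => (v i).im with hb
    have h1 := hS a
    have h2 := hS b
    have h3 : 0 ≤ a ⬝ᵥ a := Finset.sum_nonneg fun i _ => mul_self_nonneg _
    have h4 : 0 ≤ b ⬝ᵥ b := Finset.sum_nonneg fun i _ => mul_self_nonneg _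
    refine ⟨by linarith, fun h => ?_⟩
    have h5 : a = 0 := dotProduct_self_eq_zero.1 (by linarith)
    have h6 : b = 0 := dotProduct_self_eq_zero.1 (by linarith)
    funext i
    exact Complex.ext (congrFun h5 i) (congrFun h6 i)
  set c : Matrix ι ι ℝ → Matrix ι ι ℂ := fun S => S.map Complex.ofReal with hc
  have hmul : ∀ S T : Matrix ι ι ℝ, c (S * T) = c S * c T := fun S T => by
    simp only [hc]
    exact Matrix.map_mul (f := Complex.ofRealHom)
  have hadd : ∀ S T : Matrix ι ι ℝ, c (S + T) = c S + c T := fun S T => by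
    ext
    simp [hc]
  have hneg : c (-(r • (N * C))) = -((r : ℂ) • (c N * c C)) := by
    rw [← hmul]
    ext
    simp [hc]
  set a := c C *ᵥ A with ha
  set h := c H *ᵥ A with hh
  set v := a + h with hv
  -- The source term has no component along the collision invariants in the range of `H`.
  have hzero : star h ⬝ᵥ (c N *ᵥ a) = 0 := by
    have hH : star h = star A ᵥ* (c H)ᴴ := by rw [hh, star_mulVec]
    have hHt : (c H)ᴴ = c Hᵀ := by
      ext i j
      simp [hc]
    rw [hH, hHt, ← dotProduct_mulVec, ha, mulVec_mulVec, mulVec_mulVec, ← hmul, ← hmul,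
      Matrix.mul_assoc, horth]
    have : c (0 : Matrix ι ι ℝ) = 0 := by
      ext
      simp [hc]
    rw [this, zero_mulVec, dotProduct_zero]
  have hdot : star v ⬝ᵥ (c N *ᵥ a) = star a ⬝ᵥ (c N *ᵥ a) := by
    rw [hv, star_add, add_dotProduct, hzero, add_zero]
  have hv0 : v ≠ 0 := by
    intro hv0
    have ha0 : a = 0 := by
      refine (hpos N hNpos a).2 ?_
      change (star a ⬝ᵥ (c N *ᵥ a)).re ≤ 0
      rw [← hdot, hv0]
      simp
    have hh0 : h = 0 := by rwa [hv, ha0, zero_add] at hv0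
    have hre : ∀ S : Matrix ι ι ℝ, c S *ᵥ A = 0 →
        S *ᵥ (fun i => (A i).re) = 0 ∧ S *ᵥ (fun i => (A i).im) = 0 := by
      intro S hS
      constructor
      · funext i
        have := congrArg Complex.re (congrFun hS i)
        simpa [hc, mulVec, dotProduct] using this
      · funext i
        have := congrArg Complex.im (congrFun hS i)
        simpa [hc, mulVec, dotProduct] using this
    have h1 := hinj _ (hre C ha0).1 (hre H hh0).1
    have h2 := hinj _ (hre C ha0).2 (hre H hh0).2
    exact hA (funext fun i => Complex.ext (congrFun h1 i) (congrFun h2 i))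
  have hCH : ∀ S : Matrix ι ι ℝ, c (S * (C + H)) *ᵥ A = c S *ᵥ v := fun S => by
    rw [hmul, hadd, ← mulVec_mulVec, add_mulVec]
  have heq := congrArg (fun w => (star v ⬝ᵥ w).re) hdisp
  change (star v ⬝ᵥ (((Complex.I * ω) • c (M₀ * (C + H))
      - ∑ i, (Complex.I * (k i : ℂ)) • c (M i * (C + H)) - c (-(r • (N * C)))) *ᵥ A)).re = _ at heq
  simp only [sub_mulVec, sum_mulVec, smul_mulVec, hCH, hneg, neg_mulVec, ← mulVec_mulVec,
    dotProduct_sub, dotProduct_sum, dotProduct_smul, dotProduct_neg, hdot, Complex.sub_re,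
    Complex.re_sum, smul_eq_mul, dotProduct_zero, Complex.zero_re, Complex.neg_re,
    ← ha] at heq
  have hMi : ∀ i, (Complex.I * (k i : ℂ) * (star v ⬝ᵥ c (M i) *ᵥ v)).re = 0 := fun i => by
    have := im_star_dotProduct_map_mulVec (hM i) v
    change (star v ⬝ᵥ c (M i) *ᵥ v).im = 0 at this
    simp [this]
  have hX := im_star_dotProduct_map_mulVec hM₀ v
  change (star v ⬝ᵥ c M₀ *ᵥ v).im = 0 at hX
  have hXpos : 0 < (star v ⬝ᵥ c M₀ *ᵥ v).re := by
    by_contra hcon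
    exact hv0 ((hpos M₀ hM₀pos v).2 (not_lt.1 hcon))
  have hZ : 0 ≤ (star a ⬝ᵥ c N *ᵥ a).re := (hpos N hNpos a).1
  simp only [hMi, Finset.sum_const_zero, Complex.mul_re, Complex.mul_im, hX, Complex.I_re,
    Complex.I_im, Complex.ofReal_re, Complex.ofReal_im] at heq
  have h1 : ω.im * (star v ⬝ᵥ c M₀ *ᵥ v).re = r * (star a ⬝ᵥ c N *ᵥ a).re := by linarith
  by_contra hneg'
  have h2 := mul_neg_of_neg_of_pos (not_le.1 hneg') hXpos
  have h3 := mul_nonneg hr.le hZ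
  linarith

variable {M : ℕ}

/-! ### Labels and entries of the vector of unknowns -/

theorem Idx.ext_labels {i j : Idx M} (h1 : i.ell = j.ell) (h2 : i.deg = j.deg)
    (h3 : i.ord = j.ord) : i = j := by
  obtain ⟨⟨l, hl⟩, ⟨k, hk⟩, ⟨m, hm⟩⟩ := i
  obtain ⟨⟨l', hl'⟩, ⟨k', hk'⟩, ⟨m', hm'⟩⟩ := j
  simp only [Idx.ell, Idx.deg, Idx.ord] at h1 h2 h3
  subst h1
  subst h2
  have : m = m' := by omega
  subst this
  rfl

theorem Idx.ext_iff_labels {i j : Idx M} :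
    i = j ↔ i.ell = j.ell ∧ i.deg = j.deg ∧ i.ord = j.ord :=
  ⟨fun h => by subst h; simp, fun h => Idx.ext_labels h.1 h.2.1 h.2.2⟩

theorem Idx.natAbs_ord_le (j : Idx M) : j.ord.natAbs ≤ j.ell := by
  obtain ⟨⟨l, hl⟩, ⟨k, hk⟩, ⟨m, hm⟩⟩ := j
  have hm' : m < 2 * l + 1 := hm
  change ((m : ℤ) - (l : ℤ)).natAbs ≤ l
  omega

theorem Idx.ell_add_deg_le (j : Idx M) : j.ell + j.deg ≤ M := by
  obtain ⟨⟨l, hl⟩, ⟨k, hk⟩, ⟨m, hm⟩⟩ := j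
  have hk' : k < M + 1 - l := hk
  change l + k ≤ M
  omega

theorem Idx.exists_labels {l k : ℕ} {m : ℤ} (hlk : l + k ≤ M) (hm : m.natAbs ≤ l) :
    ∃ j : Idx M, j.ell = l ∧ j.deg = k ∧ j.ord = m := by
  refine ⟨⟨⟨l, by omega⟩, ⟨k, ?_⟩, ⟨(m + l).toNat, ?_⟩⟩, rfl, rfl, ?_⟩
  · change k < M + 1 - l
    omega
  · change _ < 2 * l + 1
    omega
  · simp only [Idx.ord]
    omega

theorem entry_labels (W : Idx M → ℝ) (j : Idx M) : entry W j.ell j.deg j.ord = W j := by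
  rw [entry, Finset.sum_eq_single j]
  · simp
  · intro i _ hij
    rw [if_neg fun h => hij (Idx.ext_labels h.1 h.2.1 h.2.2)]
  · simp

theorem entry_eq (W : Idx M → ℝ) {j : Idx M} {l k : ℕ} {m : ℤ}
    (h : j.ell = l ∧ j.deg = k ∧ j.ord = m) : entry W l k m = W j := by
  obtain ⟨rfl, rfl, rfl⟩ := h
  exact entry_labels W j

theorem entry_update_of_ne (W : Idx M → ℝ) {i : Idx M} {l k : ℕ} {m : ℤ}
    (h : ¬(i.ell = l ∧ i.deg = k ∧ i.ord = m)) (s : ℝ) :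
    entry (Function.update W i s) l k m = entry W l k m := by
  refine Finset.sum_congr rfl fun j _ => ?_
  by_cases hj : j = i
  · subst hj
    rw [if_neg h, if_neg h]
  · rw [Function.update_of_ne hj]

theorem entry_add_smul (W V : Idx M → ℝ) (a : ℝ) (l k : ℕ) (m : ℤ) :
    entry (W + a • V) l k m = entry W l k m + a * entry V l k m := by
  simp only [entry, Finset.mul_sum, ← Finset.sum_add_distrib]
  refine Finset.sum_congr rfl fun j _ => ?_
  split_ifs <;> simp

/-- The labels of the unknowns `n`, `θ` and `u`. -/
def IsFluid (j : Idx M) : Prop := (j.ell = 0 ∧ j.deg ≤ 1) ∨ (j.ell = 1 ∧ j.deg = 0)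

theorem update_density {W : Idx M → ℝ} {i : Idx M} (hi : ¬IsFluid i) (s : ℝ) :
    density (Function.update W i s) = density W :=
  entry_update_of_ne W (fun h => hi (Or.inl ⟨h.1, by omega⟩)) s

theorem update_temperature {W : Idx M → ℝ} {i : Idx M} (hi : ¬IsFluid i) (s : ℝ) :
    temperature (Function.update W i s) = temperature W :=
  entry_update_of_ne W (fun h => hi (Or.inl ⟨h.1, by omega⟩)) s

theorem update_velocity {W : Idx M → ℝ} {i : Idx M} (hi : ¬IsFluid i) (s : ℝ) :
    velocity (Function.update W i s) = velocity W :=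
  funext fun _ => entry_update_of_ne W (fun h => hi (Or.inr ⟨h.1, by omega⟩)) s

/-- The coefficients of the deviation `F(W) - n g` from local equilibrium. -/
noncomputable def devCoeff (ζ : ℝ) (W : Idx M → ℝ) (j : Idx M) : ℝ :=
  if j.ell = 0 ∧ j.deg ≤ 2 then -3 * bulk W * (orthoPoly 0 ζ j.deg).eval 0
  else if j.ell = 1 ∧ j.deg ≤ 1 then diffusion W j.ord * (orthoPoly 1 ζ j.deg).eval 0
  else W j

theorem devCoeff_add_smul (ζ : ℝ) (W V : Idx M → ℝ) (a : ℝ) (j : Idx M) :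
    devCoeff ζ (W + a • V) j = devCoeff ζ W j + a * devCoeff ζ V j := by
  unfold devCoeff bulk diffusion
  simp only [entry_add_smul]
  split_ifs
  · ring
  · ring
  · simp

theorem devCoeff_eq_zero {W : Idx M → ℝ} (hW : ∀ j, ¬IsFluid j → W j = 0) (ζ : ℝ) (j : Idx M) :
    devCoeff ζ W j = 0 := by
  have hentry : ∀ l k m, ¬((l = 0 ∧ k ≤ 1) ∨ (l = 1 ∧ k = 0)) → entry W l k m = 0 := by
    intro l k m h
    refine Finset.sum_eq_zero fun i _ => ?_
    split_ifs with hi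
    · refine hW i ?_
      rw [IsFluid, hi.1, hi.2.1]
      exact h
    · rfl
  unfold devCoeff bulk diffusion
  split_ifs with h1 h2
  · rw [hentry 0 2 0 (by omega)]
    ring
  · rw [hentry 1 1 _ (by omega)]
    ring
  · refine hW j ?_
    unfold IsFluid
    omega

theorem devCoeff_update {W : Idx M → ℝ} (hW : ∀ j, ¬IsFluid j → W j = 0) (ζ : ℝ) (i : Idx M)
    (s : ℝ) (j : Idx M) :
    devCoeff ζ (Function.update W i s) j = (s - W i) * devCoeff ζ (Pi.single i 1) j := by
  have h : Function.update W i s = W + (s - W i) • Pi.single i (1 : ℝ) := by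
    funext k
    by_cases hk : k = i
    · subst hk
      simp
    · simp [hk]
  rw [h, devCoeff_add_smul, devCoeff_eq_zero hW, zero_add]

theorem devCoeff_single_of_isFluid {i : Idx M} (hi : IsFluid i) (ζ : ℝ) (j : Idx M) :
    devCoeff ζ (Pi.single i 1) j = 0 := by
  refine devCoeff_eq_zero (fun k hk => ?_) ζ j
  rw [Pi.single_eq_of_ne]
  rintro rfl
  exact hk hi

/-- The matrix of the linear map that sends the unknowns to the coefficients of `F(W) - n g`. -/
noncomputable def devMat (M : ℕ) (ζ : ℝ) : Matrix (Idx M) (Idx M) ℝ :=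
  Matrix.of fun j i => devCoeff ζ (Pi.single i 1) j

theorem devMat_mulVec (ζ : ℝ) (A : Idx M → ℝ) : (devMat M ζ).mulVec A = devCoeff ζ A := by
  have hsum : ∀ s : Finset (Idx M), ∀ j,
      devCoeff ζ (∑ i ∈ s, A i • Pi.single i (1 : ℝ)) j =
        ∑ i ∈ s, devCoeff ζ (Pi.single i 1) j * A i := by
    intro s j
    induction s using Finset.induction_on with
    | empty => simpa using devCoeff_eq_zero (W := (0 : Idx M → ℝ)) (by simp) ζ j
    | insert a s ha ih =>
      rw [Finset.sum_insert ha, Finset.sum_insert ha, add_comm, devCoeff_add_smul, ih]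
      ring
  funext j
  have hA : A = ∑ i, A i • Pi.single i (1 : ℝ) := by
    funext k
    simp [Finset.sum_apply, Pi.single_apply]
  conv_rhs => rw [hA]
  rw [hsum]
  rfl

/-- The deviation from equilibrium determines the unknowns other than `n`, `θ` and `u`. -/
theorem eq_zero_of_devCoeff_eq_zero {ζ : ℝ} (hζ : 0 < ζ) {A : Idx M → ℝ}
    (hA : devCoeff ζ A = 0) {j : Idx M} (hj : ¬IsFluid j) : A j = 0 := by
  have hP0 : ∀ l, (orthoPoly l ζ 0).eval 0 ≠ 0 := fun l => by
    rw [orthoPoly_zero l hζ, Polynomial.eval_C]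
    exact (orthoPoly_leadingCoeff_pos l hζ 0).ne'
  have hjM := j.ell_add_deg_le
  have hord := j.natAbs_ord_le
  unfold IsFluid at hj
  by_cases h1 : j.ell = 0 ∧ j.deg ≤ 2
  · obtain ⟨i, hi⟩ := Idx.exists_labels (M := M) (l := 0) (k := 0) (m := 0) (by omega) le_rfl
    have h := congrFun hA i
    rw [devCoeff, if_pos ⟨hi.1, by omega⟩, hi.2.1, bulk,
      entry_eq A (j := j) ⟨h1.1, by omega, by omega⟩] at h
    simpa [hP0 0] using h
  · by_cases h2 : j.ell = 1 ∧ j.deg ≤ 1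
    · obtain ⟨i, hi⟩ := Idx.exists_labels (M := M) (l := 1) (k := 0) (m := j.ord) (by omega)
        (by omega)
      have h := congrFun hA i
      rw [devCoeff, if_neg (by omega), if_pos ⟨hi.1, by omega⟩, hi.2.1, hi.2.2, diffusion,
        entry_eq A (j := j) ⟨h2.1, by omega, rfl⟩] at h
      simpa [hP0 1] using h
    · have h := congrFun hA j
      rwa [devCoeff, if_neg h1, if_neg h2] at h

theorem sphHarm_zero_zero (y φ : ℝ) : sphHarm 0 0 y φ = 1 := by
  simp [sphHarm, normLegendre, assocLegendre]

theorem basisFun_zero {u : Fin 3 → ℝ} {θ : ℝ} (hθ : 0 < θ) (p : Mom) :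
    basisFun u θ 0 0 0 p = (orthoPoly 0 θ⁻¹ 0).leadingCoeff * juttner u θ p := by
  rw [basisFun, sphHarm_zero_zero]
  conv_lhs => rw [orthoPoly_zero 0 (inv_pos.2 hθ)]
  rw [Polynomial.eval_C]
  ring

/-- The local equilibrium distribution `n g` with the fluid unknowns of `W`. -/
noncomputable def localEq (W : Idx M → ℝ) (p : Mom) : ℝ :=
  density W * juttner (velocity W) (temperature W) p

/-- The coefficients prescribed by the matching conditions split off the local equilibrium: it is the
first basis function up to the factor `n / c₀`. -/
theorem distribution_eq {W : Idx M → ℝ} (hθ : 0 < temperature W) (p : Mom) :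
    distribution W p = localEq W p + ∑ j, devCoeff (temperature W)⁻¹ W j *
      basisAt (velocity W) (temperature W) j p := by
  obtain ⟨i, hi⟩ := Idx.exists_labels (M := M) (l := 0) (k := 0) (m := 0) (by omega) le_rfl
  have hc := (orthoPoly_leadingCoeff_pos 0 (inv_pos.2 hθ) 0).ne'
  have hsplit : ∀ j, coeff W j = (if j = i then
      density W / (orthoPoly 0 (temperature W)⁻¹ 0).leadingCoeff else 0) +
      devCoeff (temperature W)⁻¹ W j := by
    intro j
    have hji : j = i ↔ j.ell = 0 ∧ j.deg = 0 := by
      have := j.natAbs_ord_le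
      rw [Idx.ext_iff_labels, hi.1, hi.2.1, hi.2.2]
      omega
    unfold coeff devCoeff
    by_cases h1 : j.ell = 0 ∧ j.deg ≤ 2
    · rw [if_pos h1, if_pos h1]
      by_cases h2 : j.deg = 0
      · rw [if_pos h2, if_pos (hji.2 ⟨h1.1, h2⟩)]
        ring
      · rw [if_neg h2, if_neg fun h => h2 (hji.1 h).2]
        ring
    · rw [if_neg h1, if_neg h1, if_neg fun h => h1 ⟨(hji.1 h).1, by have := (hji.1 h).2; omega⟩,
        zero_add]
  simp only [distribution, hsplit, add_mul, Finset.sum_add_distrib]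
  congr 1
  rw [Finset.sum_eq_single i]
  · rw [if_pos rfl, basisAt, hi.1, hi.2.1, hi.2.2, basisFun_zero hθ, localEq,
      ← mul_assoc, div_mul_cancel₀ _ hc]
  · intro j _ hj
    rw [if_neg hj, zero_mul]
  · simp

/-! ### Matrices of multiplication operators in the basis -/

/-- The matrix of the projected multiplication by the function `w` of the momentum. -/
noncomputable def mulMat (M : ℕ) (u : Fin 3 → ℝ) (θ : ℝ) (w : Mom → ℝ) :
    Matrix (Idx M) (Idx M) ℝ :=
  Matrix.of fun j k => wInner u θ (fun p => w p * basisAt u θ k p) (basisAt u θ j)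

theorem mulMat_isSymm (u : Fin 3 → ℝ) (θ : ℝ) (w : Mom → ℝ) : (mulMat M u θ w).IsSymm := by
  ext i j
  simp only [mulMat, Matrix.transpose_apply, Matrix.of_apply, wInner]
  congr 1 with p
  ring

theorem integrable_basisAt_mul {u : Fin 3 → ℝ} (hu : ∑ i, u i ^ 2 < 1) {θ : ℝ} (hθ : 0 < θ)
    (j k : Idx M) : Integrable (fun p => 1 / juttner u θ p * basisAt u θ k p * basisAt u θ j p)
      shellMeasure := by
  simpa [basisAt] using integrable_basisFun_mul hu hθ 1 k.ell k.deg j.ell j.deg k.ord j.ord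

theorem integrable_mul_basisAt_mul {u : Fin 3 → ℝ} (hu : ∑ i, u i ^ 2 < 1) {θ : ℝ} (hθ : 0 < θ)
    {w : Mom → ℝ} (hw : Continuous w) {c : ℝ} (hc : ∀ p, |w p| ≤ c * restEnergy u p)
    (j k : Idx M) :
    Integrable (fun p => 1 / juttner u θ p * (w p * basisAt u θ k p) * basisAt u θ j p)
      shellMeasure := by
  have h0 := integrable_basisAt_mul hu hθ j k
  have h1 := (integrable_basisFun_mul hu hθ X k.ell k.deg j.ell j.deg k.ord j.ord).const_mul c
  refine Integrable.mono h1 ?_ (Eventually.of_forall fun p => ?_)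
  · refine (hw.aestronglyMeasurable.mul h0.aestronglyMeasurable).congr
      (Eventually.of_forall fun p => ?_)
    simp only [Pi.mul_apply]
    ring
  · have hE := restEnergy_pos hu p
    have e1 : 1 / juttner u θ p * (w p * basisAt u θ k p) * basisAt u θ j p =
        w p * (1 / juttner u θ p * basisAt u θ k p * basisAt u θ j p) := by ring
    have e2 : c * (1 / juttner u θ p * (X.eval (restEnergy u p) * basisFun u θ k.ell k.deg k.ord p) *
        basisFun u θ j.ell j.deg j.ord p) = c * restEnergy u p *
          (1 / juttner u θ p * basisAt u θ k p * basisAt u θ j p) := by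
      simp only [Polynomial.eval_X, basisAt]
      ring
    rw [e1, e2, norm_mul (w p), norm_mul (c * restEnergy u p), Real.norm_eq_abs,
      Real.norm_eq_abs (c * restEnergy u p)]
    exact mul_le_mul_of_nonneg_right ((hc p).trans (le_abs_self _)) (norm_nonneg _)

open Matrix in
/-- The quadratic form of the multiplication by `w` on the span of the basis functions is the weighted
square integral of the function with the given coefficients. -/
theorem dotProduct_mulMat_mulVec {u : Fin 3 → ℝ} (hu : ∑ i, u i ^ 2 < 1) {θ : ℝ} (hθ : 0 < θ)
    {w : Mom → ℝ} (hw : Continuous w) {c : ℝ} (hc : ∀ p, |w p| ≤ c * restEnergy u p)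
    (a : Idx M → ℝ) :
    Integrable (fun p => w p * (1 / juttner u θ p * (∑ j, a j * basisAt u θ j p) ^ 2))
        shellMeasure ∧
      a ⬝ᵥ mulMat M u θ w *ᵥ a =
        ∫ p, w p * (1 / juttner u θ p * (∑ j, a j * basisAt u θ j p) ^ 2) ∂shellMeasure := by
  have hint := integrable_mul_basisAt_mul (M := M) hu hθ hw hc
  have hexp : ∀ p, w p * (1 / juttner u θ p * (∑ j, a j * basisAt u θ j p) ^ 2) =
      ∑ j, ∑ k, a j * (a k *
        (1 / juttner u θ p * (w p * basisAt u θ k p) * basisAt u θ j p)) := by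
    intro p
    rw [pow_two, Finset.sum_mul_sum, Finset.mul_sum, Finset.mul_sum]
    refine Finset.sum_congr rfl fun j _ => ?_
    rw [Finset.mul_sum, Finset.mul_sum]
    refine Finset.sum_congr rfl fun k _ => ?_
    ring
  simp only [hexp]
  refine ⟨integrable_finsetSum _ fun j _ => integrable_finsetSum _ fun k _ =>
    ((hint j k).const_mul _).const_mul _, ?_⟩
  rw [integral_finsetSum _ fun j _ => integrable_finsetSum _ fun k _ =>
    ((hint j k).const_mul _).const_mul _]
  simp only [dotProduct, mulVec, Finset.mul_sum]
  refine Finset.sum_congr rfl fun j _ => ?_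
  rw [integral_finsetSum _ fun k _ => ((hint j k).const_mul _).const_mul _]
  refine Finset.sum_congr rfl fun k _ => ?_
  rw [integral_const_mul, integral_const_mul, mulMat, of_apply, wInner_eq_integral]
  ring

theorem mulMat_eval_apply {u : Fin 3 → ℝ} (hu : ∑ i, u i ^ 2 < 1) {θ : ℝ} (hθ : 0 < θ)
    (R : Polynomial ℝ) (j k : Idx M) :
    mulMat M u θ (fun p => R.eval (restEnergy u p)) j k =
      if k.ell = j.ell ∧ k.ord = j.ord then
        polyInner k.ell θ⁻¹ (R * orthoPoly k.ell θ⁻¹ k.deg) (orthoPoly k.ell θ⁻¹ j.deg)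
      else 0 :=
  wInner_basisFun hu hθ R k.deg j.deg k.natAbs_ord_le j.natAbs_ord_le

theorem mulMat_one {u : Fin 3 → ℝ} (hu : ∑ i, u i ^ 2 < 1) {θ : ℝ} (hθ : 0 < θ) :
    mulMat M u θ (fun _ => 1) = 1 := by
  have h1 : (fun _ : Mom => (1 : ℝ)) = fun p => (1 : Polynomial ℝ).eval (restEnergy u p) := by
    simp
  ext j k
  rw [h1, mulMat_eval_apply hu hθ, one_mul, polyInner_orthoPoly _ (inv_pos.2 hθ),
    Matrix.one_apply]
  by_cases h : j = k
  · subst h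
    simp
  · rw [if_neg h]
    rw [Idx.ext_iff_labels] at h
    by_cases h' : k.ell = j.ell ∧ k.ord = j.ord
    · rw [if_pos h', if_neg fun h2 => h ⟨h'.1.symm, h2.symm, h'.2.symm⟩]
    · rw [if_neg h']

open Matrix in
/-- Since the basis is orthonormal, multiplication by a function `w ≥ 1` is bounded below by the
identity. -/
theorem dotProduct_self_le_mulMat {u : Fin 3 → ℝ} (hu : ∑ i, u i ^ 2 < 1) {θ : ℝ} (hθ : 0 < θ)
    {w : Mom → ℝ} (hw : Continuous w) {c : ℝ} (hc : ∀ p, |w p| ≤ c * restEnergy u p)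
    (hw1 : ∀ p, 1 ≤ w p) (a : Idx M → ℝ) : a ⬝ᵥ a ≤ a ⬝ᵥ mulMat M u θ w *ᵥ a := by
  have h1 := dotProduct_mulMat_mulVec (M := M) hu hθ (w := fun _ => 1) continuous_const (c := 1)
    (fun p => by simpa using one_le_restEnergy hu p) a
  have h2 := dotProduct_mulMat_mulVec hu hθ hw hc a
  rw [mulMat_one hu hθ, one_mulVec] at h1
  rw [h1.2, h2.2]
  refine integral_mono h1.1 h2.1 fun p => ?_
  have hg := juttner_pos u hθ p
  exact mul_le_mul_of_nonneg_right (hw1 p) (by positivity)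

/-- The components of `p` are dominated by `E`, so that multiplication by them keeps the products of
basis functions integrable. -/
theorem exists_abs_fourMom_le {u : Fin 3 → ℝ} (hu : ∑ i, u i ^ 2 < 1) (α : Fin 4) :
    ∃ c, ∀ p, |fourMom p α| ≤ c * restEnergy u p := by
  refine ⟨fourVel u 0 + ∑ i : Fin 3, |fourVel u i.succ|, fun p => ?_⟩
  have h0 : |fourMom p α| ≤ fourMom p 0 := by
    refine Fin.cases ?_ (fun i => ?_) α
    · rw [abs_of_nonneg (zero_le_one.trans (one_le_fourMom_zero p))]
    · refine abs_le_of_sq_le_sq ?_ (zero_le_one.trans (one_le_fourMom_zero p))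
      rw [fourMom_zero_sq]
      have : p i ^ 2 ≤ ∑ i, p i ^ 2 :=
        Finset.single_le_sum (f := fun i => p i ^ 2) (fun _ _ => sq_nonneg _) (Finset.mem_univ i)
      change p i ^ 2 ≤ _
      linarith
  have h1 : fourMom p 0 = fourVel u 0 * restEnergy u p +
      ∑ i : Fin 3, fourVel u i.succ * restMom u p i := by
    have h := fourMom_boost_zero (sum_neg_sq hu) (boost u p)
    rw [boost_neg_boost hu, restEnergy_eq, (fourVel_neg u).1, fourMom_boost_zero hu] at h
    simp only [(fourVel_neg u).2, neg_mul, Finset.sum_neg_distrib, sub_neg_eq_add] at h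
    exact h
  have h2 : ∀ i, |restMom u p i| ≤ restEnergy u p := fun i => by
    refine abs_le_of_sq_le_sq ?_ (restEnergy_pos hu p).le
    rw [restEnergy_sq hu]
    have : restMom u p i ^ 2 ≤ ∑ i, restMom u p i ^ 2 :=
      Finset.single_le_sum (f := fun i => restMom u p i ^ 2) (fun _ _ => sq_nonneg _)
        (Finset.mem_univ i)
    linarith
  refine h0.trans ?_
  rw [h1, add_mul, Finset.sum_mul]
  refine add_le_add le_rfl (Finset.sum_le_sum fun i _ => ?_)
  refine (le_abs_self _).trans ?_
  rw [abs_mul]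
  exact mul_le_mul_of_nonneg_left (h2 i) (abs_nonneg _)

/-! ### The collision operator annihilates the collision invariants -/

theorem sum_polyInner_mul_eq_zero (l : ℕ) {ζ : ℝ} (hζ : 0 < ζ) {N n : ℕ} {κ : ℝ}
    (hκ : κ = 0 ∨ n ≤ N) {R : Polynomial ℝ} (hR : R.degree < n) (hR0 : R.eval 0 = 0) {c : ℕ → ℝ}
    (hc : ∀ d < n, c d = κ * (orthoPoly l ζ d).eval 0) :
    ∑ d ∈ Finset.range N, polyInner l ζ (orthoPoly l ζ d) R * c d = 0 := by
  have hlarge : ∀ d, n ≤ d → polyInner l ζ (orthoPoly l ζ d) R = 0 := fun d hd =>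
    polyInner_orthoPoly_eq_zero_of_degree_lt l hζ (hR.trans_le (Nat.cast_le.2 hd))
  rcases hκ with rfl | hn
  · refine Finset.sum_eq_zero fun d _ => ?_
    rcases lt_or_ge d n with h | h
    · rw [hc d h, zero_mul, mul_zero]
    · rw [hlarge d h, zero_mul]
  · rw [← Finset.sum_subset (Finset.range_mono hn)]
    · have := sum_eval_mul_polyInner_orthoPoly l hζ hR 0
      rw [hR0] at this
      rw [← mul_zero κ, ← this, Finset.mul_sum]
      refine Finset.sum_congr rfl fun d hd => ?_
      rw [hc d (Finset.mem_range.1 hd)]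
      ring
    · intro d _ hd
      rw [hlarge d (by simpa using hd), zero_mul]

theorem entry_eq_zero (W : Idx M → ℝ) {l k : ℕ} (m : ℤ) (h : M < l + k) : entry W l k m = 0 := by
  refine Finset.sum_eq_zero fun j _ => ?_
  rw [if_neg]
  rintro ⟨h1, h2, -⟩
  have := j.ell_add_deg_le
  omega

/-- The deviation from equilibrium satisfies the Landau-Lifshitz matching conditions: its energy
flux has no component along `g`, `g E` and `g q_i`. By the definition of `devCoeff` this is the
vanishing at `0` of the polynomials `x P_k(x)`, expressed by the Christoffel-Darboux kernel. -/
theorem mulMat_energy_mul_devMat {u : Fin 3 → ℝ} (hu : ∑ i, u i ^ 2 < 1) {θ : ℝ} (hθ : 0 < θ)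
    {j : Idx M} (hj : IsFluid j) (i : Idx M) :
    (mulMat M u θ (restEnergy u) * devMat M θ⁻¹) j i = 0 := by
  have hζ := inv_pos.2 hθ
  have hmul : ∀ k, mulMat M u θ (restEnergy u) j k = if k.ell = j.ell ∧ k.ord = j.ord then
      polyInner k.ell θ⁻¹ (X * orthoPoly k.ell θ⁻¹ k.deg) (orthoPoly k.ell θ⁻¹ j.deg) else 0 := by
    intro k
    rw [← mulMat_eval_apply hu hθ]
    simp
  let e : Fin (M + 1 - (j.1 : ℕ)) → Idx M := fun d => ⟨j.1, (d, j.2.2)⟩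
  set A : Idx M → ℝ := Pi.single i 1 with hA
  have hsum : (mulMat M u θ (restEnergy u) * devMat M θ⁻¹) j i =
      ∑ d : Fin (M + 1 - (j.1 : ℕ)), polyInner j.ell θ⁻¹ (orthoPoly j.ell θ⁻¹ d)
        (X * orthoPoly j.ell θ⁻¹ j.deg) * devCoeff θ⁻¹ A (e d) := by
    rw [Matrix.mul_apply]
    symm
    refine Fintype.sum_of_injective e (fun a b h => ?_) _ _ (fun k hk => ?_) fun d => ?_
    · have := congrArg Idx.deg h
      exact Fin.ext this
    · rw [hmul, if_neg, zero_mul]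
      rintro ⟨h1, h2⟩
      refine hk ⟨⟨k.deg, ?_⟩, ?_⟩
      · have h3 := k.ell_add_deg_le
        rw [h1] at h3
        change k.deg < M + 1 - j.ell
        have : j.ell + k.deg ≤ M := h3
        omega
      · exact Idx.ext_labels h1.symm rfl h2.symm
    · rw [hmul, if_pos ⟨rfl, rfl⟩, ← polyInner_mul_shift]
      rfl
  have hdeg : (X * orthoPoly j.ell θ⁻¹ j.deg).degree = ((j.deg + 1 : ℕ) : WithBot ℕ) := by
    rw [Polynomial.degree_mul, Polynomial.degree_X, orthoPoly_degree _ hζ]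
    push_cast
    ring
  have h0 : (X * orthoPoly j.ell θ⁻¹ j.deg).eval 0 = 0 := by simp
  rw [hsum]
  set c : ℕ → ℝ := fun d => if h : d < M + 1 - (j.1 : ℕ) then devCoeff θ⁻¹ A (e ⟨d, h⟩) else
    (if j.ell = 0 then -3 * bulk A else diffusion A j.ord) * (orthoPoly j.ell θ⁻¹ d).eval 0 with hc
  have hcsum : ∑ d : Fin (M + 1 - (j.1 : ℕ)), polyInner j.ell θ⁻¹ (orthoPoly j.ell θ⁻¹ d)
        (X * orthoPoly j.ell θ⁻¹ j.deg) * devCoeff θ⁻¹ A (e d) =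
      ∑ d ∈ Finset.range (M + 1 - (j.1 : ℕ)), polyInner j.ell θ⁻¹ (orthoPoly j.ell θ⁻¹ d)
        (X * orthoPoly j.ell θ⁻¹ j.deg) * c d := by
    rw [Finset.sum_range]
    refine Finset.sum_congr rfl fun d _ => ?_
    simp only [hc, d.2, dif_pos]
  rw [hcsum]
  have hjM := j.ell_add_deg_le
  rcases hj with hj | hj
  · refine sum_polyInner_mul_eq_zero (n := 3) (κ := -3 * bulk A) _ hζ ?_ ?_ h0 fun d hd => ?_
    · rcases Nat.lt_or_ge M 2 with hM | hM
      · exact Or.inl (by rw [bulk, entry_eq_zero A 0 (by omega), mul_zero])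
      · refine Or.inr ?_
        change 3 ≤ M + 1 - j.ell
        omega
    · rw [hdeg]
      exact Nat.cast_lt.2 (by omega)
    · simp only [hc]
      split_ifs with h h'
      · rw [devCoeff, if_pos ⟨hj.1, by change d ≤ 2; omega⟩, hj.1]
        rfl
      · rfl
      · exact absurd hj.1 h'
  · refine sum_polyInner_mul_eq_zero (n := 2) (κ := diffusion A j.ord) _ hζ ?_ ?_ h0 fun d hd => ?_
    · rcases Nat.lt_or_ge M 2 with hM | hM
      · exact Or.inl (by rw [diffusion, entry_eq_zero A _ (by omega)])
      · refine Or.inr ?_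
        change 2 ≤ M + 1 - j.ell
        omega
    · rw [hdeg]
      exact Nat.cast_lt.2 (by omega)
    · simp only [hc]
      split_ifs with h h'
      · have hell : (e ⟨d, h⟩).ell = 1 := hj.1
        rw [devCoeff, if_neg (by omega), if_pos ⟨hell, by change d ≤ 1; omega⟩, hj.1]
        rfl
      · omega
      · rfl

/-! ### Derivatives of the local equilibrium -/

theorem hasDerivAt_juttner_temperature (u : Fin 3 → ℝ) {θ : ℝ} (hθ : 0 < θ) :
    ∃ κ : ℝ, ∀ p, HasDerivAt (fun s => juttner u s p)
      (juttner u θ p * ((θ ^ 2)⁻¹ * restEnergy u p + κ)) θ := by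
  have hK := besselK_two_pos (inv_pos.2 hθ)
  have hinv : HasDerivAt (fun s : ℝ => s⁻¹) (-(θ ^ 2)⁻¹) θ := hasDerivAt_inv hθ.ne'
  have hN : DifferentiableAt ℝ (fun s : ℝ => s⁻¹ / (4 * Real.pi * besselK 2 s⁻¹)) θ := by
    have h1 : DifferentiableAt ℝ (fun s : ℝ => besselK 2 s⁻¹) θ :=
      (differentiableAt_besselK_two (inv_pos.2 hθ)).comp θ hinv.differentiableAt
    have hpi := Real.pi_pos
    exact hinv.differentiableAt.div (h1.const_mul _) (by positivity)
  set N : ℝ → ℝ := fun s => s⁻¹ / (4 * Real.pi * besselK 2 s⁻¹) with hNdef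
  have hNpos : N θ ≠ 0 := by
    have hpi := Real.pi_pos
    simp only [hNdef]
    positivity
  refine ⟨deriv N θ / N θ, fun p => ?_⟩
  have hE : HasDerivAt (fun s => Real.exp (-(restEnergy u p / s)))
      (Real.exp (-(restEnergy u p / θ)) * (-(restEnergy u p * -(θ ^ 2)⁻¹))) θ := by
    simpa only [div_eq_mul_inv] using ((hinv.const_mul (restEnergy u p)).fun_neg).exp
  refine (hN.hasDerivAt.mul hE).congr_deriv ?_
  change _ = N θ * Real.exp (-(restEnergy u p / θ)) * _
  field_simp
  ring

/-- Changing the fluid velocity changes `E` by a linear form in the rest-frame momentum `q`; hence the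
velocity derivatives of the equilibrium have angular index `ℓ = 1`. -/
theorem hasDerivAt_restEnergy_velocity {u : Fin 3 → ℝ} (hu : ∑ i, u i ^ 2 < 1) (i : Fin 3)
    (p : Mom) :
    HasDerivAt (fun s => restEnergy (Function.update u i s) p)
      (-(fourVel u 0 * ∑ l, ((if l = i then 1 else 0) +
        fourVel u i.succ * fourVel u l.succ / (fourVel u 0 + 1)) * restMom u p l)) (u i) := by
  have hE : ∀ v : Fin 3 → ℝ, restEnergy v p =
      (fourMom p 0 - ∑ j, v j * p j) / √(1 - ∑ j, v j ^ 2) := fun v => by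
    rw [restEnergy_eq, sub_div, Finset.sum_div]
    simp only [fourVel, Fin.cons_zero, Fin.cons_succ]
    congr 1
    · ring
    · refine Finset.sum_congr rfl fun j _ => ?_
      ring
  have hupd : ∀ (s : ℝ) (F : Fin 3 → ℝ → ℝ), ∑ j, F j (Function.update u i s j) =
      F i s + ∑ j ∈ Finset.univ.erase i, F j (u j) := fun s F => by
    rw [← Finset.add_sum_erase _ _ (Finset.mem_univ i), Function.update_self]
    congr 1
    refine Finset.sum_congr rfl fun j hj => ?_
    rw [Function.update_of_ne (Finset.ne_of_mem_erase hj)]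
  have h1 : HasDerivAt (fun s => fourMom p 0 - ∑ j, Function.update u i s j * p j)
      (-(p i)) (u i) := by
    have : (fun s => fourMom p 0 - ∑ j, Function.update u i s j * p j) =
        fun s => fourMom p 0 - (s * p i + ∑ j ∈ Finset.univ.erase i, u j * p j) :=
      funext fun s => by rw [hupd s fun j x => x * p j]
    rw [this]
    simpa using (((hasDerivAt_id (u i)).mul_const (p i)).add_const
      (∑ j ∈ Finset.univ.erase i, u j * p j)).const_sub (fourMom p 0)
  have h2 : HasDerivAt (fun s => 1 - ∑ j, Function.update u i s j ^ 2) (-(2 * u i)) (u i) := by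
    have : (fun s => 1 - ∑ j, Function.update u i s j ^ 2) =
        fun s => 1 - (s ^ 2 + ∑ j ∈ Finset.univ.erase i, u j ^ 2) :=
      funext fun s => by rw [hupd s fun j x => x ^ 2]
    rw [this]
    simpa using (((hasDerivAt_id (u i)).pow 2).add_const
      (∑ j ∈ Finset.univ.erase i, u j ^ 2)).const_sub 1
  have hpos : 0 < 1 - ∑ j, u j ^ 2 := sub_pos.2 hu
  have hself : 1 - ∑ j, Function.update u i (u i) j ^ 2 = 1 - ∑ j, u j ^ 2 := by
    rw [Function.update_eq_self]
  have h3 := h2.sqrt (by rw [hself]; exact hpos.ne')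
  have h4 := h1.div h3 (by rw [hself]; exact (Real.sqrt_pos.2 hpos).ne')
  simp only [Function.update_eq_self] at h4
  have hfun : (fun s => restEnergy (Function.update u i s) p) = fun s =>
      (fourMom p 0 - ∑ j, Function.update u i s j * p j) /
        √(1 - ∑ j, Function.update u i s j ^ 2) := funext fun s => hE _
  rw [hfun]
  refine h4.congr_deriv ?_
  have hp := restMom_eq_sub hu p i
  have hsum : ∑ l, ((if l = i then 1 else 0) +
      fourVel u i.succ * fourVel u l.succ / (fourVel u 0 + 1)) * restMom u p l =
      restMom u p i + fourVel u i.succ *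
        ((∑ l : Fin 3, fourVel u l.succ * restMom u p l) / (fourVel u 0 + 1)) := by
    simp only [add_mul, Finset.sum_add_distrib, ite_mul, one_mul, zero_mul, Finset.sum_ite_eq',
      Finset.mem_univ, if_true, Finset.sum_div, Finset.mul_sum]
    congr 1
    refine Finset.sum_congr rfl fun l _ => ?_
    ring
  have hq : restMom u p i + fourVel u i.succ *
      ((∑ l : Fin 3, fourVel u l.succ * restMom u p l) / (fourVel u 0 + 1)) =
      p i - fourVel u i.succ * restEnergy u p := by
    linear_combination -hp
  rw [hsum, hq, hE u]
  simp only [fourVel, Fin.cons_zero, Fin.cons_succ]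
  have hs : √(1 - ∑ j, u j ^ 2) ≠ 0 := (Real.sqrt_pos.2 hpos).ne'
  field_simp
  ring

theorem hasDerivAt_juttner_velocity {u : Fin 3 → ℝ} (hu : ∑ i, u i ^ 2 < 1) (θ : ℝ) (i : Fin 3)
    (p : Mom) :
    HasDerivAt (fun s => juttner (Function.update u i s) θ p)
      (∑ l, fourVel u 0 / θ * ((if l = i then 1 else 0) +
        fourVel u i.succ * fourVel u l.succ / (fourVel u 0 + 1)) *
          (juttner u θ p * restMom u p l)) (u i) := by
  have h := (((hasDerivAt_restEnergy_velocity hu i p).div_const θ).fun_neg.exp).const_mul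
    (θ⁻¹ / (4 * Real.pi * besselK 2 θ⁻¹))
  rw [Function.update_eq_self] at h
  refine h.congr_deriv ?_
  rw [← mul_assoc]
  change juttner u θ p * _ = _
  rw [neg_div, neg_neg, mul_div_assoc, mul_comm, mul_div_assoc', Finset.mul_sum, Finset.sum_div,
    Finset.sum_mul]
  refine Finset.sum_congr rfl fun l _ => ?_
  ring

/-! ### The basis functions that span the collision invariants -/

/-- The order `m` for which `|q| Y_{1,m}` is, up to sign, the `i`-th Cartesian coordinate of `q`. -/
def axisOrd : Fin 3 → ℤ := ![1, -1, 0]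

/-- The sign in `|q| Y_{1,m} = ± q_i`, due to the Condon-Shortley phase. -/
noncomputable def axisSign : Fin 3 → ℝ := ![-1, -1, 1]

theorem axisSign_mul_self (i : Fin 3) : axisSign i * axisSign i = 1 := by
  fin_cases i <;> simp [axisSign]

theorem normLegendre_one_zero (y : ℝ) : normLegendre 1 0 y = y := by
  simp [normLegendre, assocLegendre]
  ring

theorem normLegendre_one_one (y : ℝ) : √2 * normLegendre 1 1 y = -√(1 - y ^ 2) := by
  have h : √2 * √((2 : ℝ)⁻¹) = 1 := by
    rw [← Real.sqrt_mul zero_le_two]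
    norm_num
  have h2 : normLegendre 1 1 y = √((2 : ℝ)⁻¹) * -√(1 - y ^ 2) := by
    simp [normLegendre, assocLegendre]
    ring
  rw [h2, ← mul_assoc, h, one_mul]

theorem norm_mul_sphHarm_one {u : Fin 3 → ℝ} (hu : ∑ i, u i ^ 2 < 1) (p : Mom) (i : Fin 3) :
    √(restEnergy u p ^ 2 - 1) * sphHarm 1 (axisOrd i) (polarCos u p) (azimuth u p) =
      axisSign i * restMom u p i := by
  have hr : restEnergy u p ^ 2 - 1 = ∑ i, restMom u p i ^ 2 := by
    rw [restEnergy_sq hu, add_sub_cancel_left]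
  set r := √(restEnergy u p ^ 2 - 1) with hrdef
  set z : ℂ := ⟨restMom u p 0, restMom u p 1⟩ with hz
  have hsq : r ^ 2 = restMom u p 0 ^ 2 + restMom u p 1 ^ 2 + restMom u p 2 ^ 2 := by
    rw [hrdef, Real.sq_sqrt (by rw [hr]; positivity), hr, Fin.sum_univ_three]
  have hr0 : 0 ≤ r := Real.sqrt_nonneg _
  have hy : r * polarCos u p = restMom u p 2 := by
    rw [polarCos, ← hrdef]
    rcases eq_or_ne r 0 with h | h
    · rw [h] at hsq ⊢
      have h0 := sq_nonneg (restMom u p 0)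
      have h1 := sq_nonneg (restMom u p 1)
      have h2 := sq_nonneg (restMom u p 2)
      have : restMom u p 2 ^ 2 = 0 := by linarith
      rw [zero_mul, (pow_eq_zero_iff two_ne_zero).1 this]
    · field_simp
  have hnorm : r * √(1 - polarCos u p ^ 2) = ‖z‖ := by
    rw [Complex.norm_eq_sqrt_sq_add_sq]
    conv_lhs => rw [← Real.sqrt_sq hr0]
    rw [← Real.sqrt_mul (sq_nonneg r)]
    congr 1
    rw [mul_sub, ← mul_pow, hy, hsq]
    simp only [hz]
    ring
  have hcos : ‖z‖ * Real.cos (azimuth u p) = restMom u p 0 := Complex.norm_mul_cos_arg z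
  have hsin : ‖z‖ * Real.sin (azimuth u p) = restMom u p 1 := Complex.norm_mul_sin_arg z
  fin_cases i
  · have : sphHarm 1 1 (polarCos u p) (azimuth u p) =
        √2 * normLegendre 1 1 (polarCos u p) * Real.cos (azimuth u p) := by
      simp [sphHarm]
    change r * sphHarm 1 1 _ _ = (-1) * restMom u p 0
    rw [this, normLegendre_one_one, ← hcos, ← hnorm]
    ring
  · have : sphHarm 1 (-1) (polarCos u p) (azimuth u p) =
        √2 * normLegendre 1 1 (polarCos u p) * Real.sin (azimuth u p) := by
      simp [sphHarm]
    change r * sphHarm 1 (-1) _ _ = (-1) * restMom u p 1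
    rw [this, normLegendre_one_one, ← hsin, ← hnorm]
    ring
  · have : sphHarm 1 0 (polarCos u p) (azimuth u p) = polarCos u p := by
      simp [sphHarm, normLegendre_one_zero]
    change r * sphHarm 1 0 _ _ = 1 * restMom u p 2
    rw [this, hy, one_mul]

theorem juttner_mul_restMom {u : Fin 3 → ℝ} (hu : ∑ i, u i ^ 2 < 1) {θ : ℝ} (hθ : 0 < θ)
    (p : Mom) (i : Fin 3) :
    juttner u θ p * restMom u p i =
      axisSign i / (orthoPoly 1 θ⁻¹ 0).leadingCoeff * basisFun u θ 1 0 (axisOrd i) p := by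
  have hc := (orthoPoly_leadingCoeff_pos 1 (inv_pos.2 hθ) 0).ne'
  have h0 : (orthoPoly 1 θ⁻¹ 0).eval (restEnergy u p) = (orthoPoly 1 θ⁻¹ 0).leadingCoeff := by
    conv_lhs => rw [orthoPoly_zero 1 (inv_pos.2 hθ)]
    rw [Polynomial.eval_C]
  rw [basisFun, pow_one, norm_mul_sphHarm_one hu, h0]
  generalize (orthoPoly 1 θ⁻¹ 0).leadingCoeff = c at *
  field_simp
  rw [mul_right_comm, pow_two, axisSign_mul_self]
  ring

theorem wInner_sum_left {u : Fin 3 → ℝ} {θ : ℝ} {ι : Type*} (s : Finset ι) (a : ι → ℝ)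
    (f : ι → Mom → ℝ) (h : Mom → ℝ)
    (hint : ∀ i ∈ s, Integrable (fun p => 1 / juttner u θ p * f i p * h p) shellMeasure) :
    wInner u θ (fun p => ∑ i ∈ s, a i * f i p) h = ∑ i ∈ s, a i * wInner u θ (f i) h := by
  simp only [wInner_eq_integral]
  have : ∀ p, 1 / juttner u θ p * (∑ i ∈ s, a i * f i p) * h p =
      ∑ i ∈ s, a i * (1 / juttner u θ p * f i p * h p) := fun p => by
    rw [Finset.mul_sum, Finset.sum_mul]
    refine Finset.sum_congr rfl fun i _ => ?_
    ring
  simp only [this]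
  rw [integral_finsetSum _ fun i hi => (hint i hi).const_mul _]
  refine Finset.sum_congr rfl fun i _ => ?_
  rw [integral_const_mul]

theorem wInner_const_mul_left (u : Fin 3 → ℝ) (θ a : ℝ) (f h : Mom → ℝ) :
    wInner u θ (fun p => a * f p) h = a * wInner u θ f h := by
  rw [wInner, wInner, ← integral_const_mul]
  congr 1 with p
  ring

theorem wInner_basisAt {u : Fin 3 → ℝ} (hu : ∑ i, u i ^ 2 < 1) {θ : ℝ} (hθ : 0 < θ)
    (j k : Idx M) : wInner u θ (basisAt u θ k) (basisAt u θ j) = if j = k then 1 else 0 := by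
  have h := congrFun (congrFun (mulMat_one (M := M) hu hθ) j) k
  simpa only [mulMat, Matrix.of_apply, one_mul, Matrix.one_apply] using h

/-! ### The derivative of the local equilibrium in the fluid unknowns -/

/-- The coefficients of the derivative of the local equilibrium distribution `n g` with respect to
the unknowns. -/
noncomputable def fluidMat (W : Idx M → ℝ) : Matrix (Idx M) (Idx M) ℝ :=
  Matrix.of fun j k => wInner (velocity W) (temperature W)
    (fun p => deriv (fun s => localEq (Function.update W k s) p) (W k))
    (basisAt (velocity W) (temperature W) j)

theorem fluidMat_of_not_isFluid (W : Idx M → ℝ) {k : Idx M} (hk : ¬IsFluid k) (j : Idx M) :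
    fluidMat W j k = 0 := by
  simp only [fluidMat, Matrix.of_apply, localEq, update_density hk, update_temperature hk,
    update_velocity hk, deriv_const]
  simp [wInner]

theorem fluidMat_density {W : Idx M → ℝ} (hu : ∑ i, velocity W i ^ 2 < 1)
    (hθ : 0 < temperature W) {k : Idx M} (hk : k.ell = 0 ∧ k.deg = 0) (j : Idx M) :
    fluidMat W j k = if j = k then ((orthoPoly 0 (temperature W)⁻¹ 0).leadingCoeff)⁻¹ else 0 := by
  have hord : k.ord = 0 := by
    have := k.natAbs_ord_le
    omega
  have hc := (orthoPoly_leadingCoeff_pos 0 (inv_pos.2 hθ) 0).ne'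
  set c := (orthoPoly 0 (temperature W)⁻¹ 0).leadingCoeff with hcdef
  have hv : ∀ s, velocity (Function.update W k s) = velocity W := fun s =>
    funext fun i => entry_update_of_ne W (by omega) s
  have ht : ∀ s, temperature (Function.update W k s) = temperature W := fun s =>
    entry_update_of_ne W (by omega) s
  have hd : ∀ s, density (Function.update W k s) = s := fun s => by
    rw [density, entry_eq _ ⟨hk.1, hk.2, hord⟩, Function.update_self]
  have hder : ∀ p, deriv (fun s => localEq (Function.update W k s) p) (W k) =
      c⁻¹ * basisAt (velocity W) (temperature W) k p := fun p => by
    simp only [localEq, hv, ht, hd]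
    rw [basisAt, hk.1, hk.2, hord, basisFun_zero hθ, ← hcdef, inv_mul_cancel_left₀ hc]
    simp
  simp only [fluidMat, Matrix.of_apply, hder]
  rw [wInner_const_mul_left, wInner_basisAt hu hθ]
  split_ifs <;> simp

theorem fluidMat_temperature {W : Idx M → ℝ} (hu : ∑ i, velocity W i ^ 2 < 1)
    (hθ : 0 < temperature W) :
    ∃ κ : ℝ, ∀ k : Idx M, k.ell = 0 ∧ k.deg = 1 → ∀ j : Idx M,
      fluidMat W j k = if j.ell = 0 then density W / (orthoPoly 0 (temperature W)⁻¹ 0).leadingCoeff *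
        polyInner 0 (temperature W)⁻¹ ((C (temperature W ^ 2)⁻¹ * X + C κ) *
          orthoPoly 0 (temperature W)⁻¹ 0) (orthoPoly 0 (temperature W)⁻¹ j.deg) else 0 := by
  obtain ⟨κ, hκ⟩ := hasDerivAt_juttner_temperature (velocity W) hθ
  refine ⟨κ, fun k hk j => ?_⟩
  have hord : k.ord = 0 := by
    have := k.natAbs_ord_le
    omega
  have hc := (orthoPoly_leadingCoeff_pos 0 (inv_pos.2 hθ) 0).ne'
  set c := (orthoPoly 0 (temperature W)⁻¹ 0).leadingCoeff with hcdef
  have hv : ∀ s, velocity (Function.update W k s) = velocity W := fun s =>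
    funext fun i => entry_update_of_ne W (by omega) s
  have ht : ∀ s, temperature (Function.update W k s) = s := fun s => by
    rw [temperature, entry_eq _ ⟨hk.1, hk.2, hord⟩, Function.update_self]
  have hd : ∀ s, density (Function.update W k s) = density W := fun s =>
    entry_update_of_ne W (by omega) s
  have hWk : W k = temperature W := by rw [temperature, entry_eq _ ⟨hk.1, hk.2, hord⟩]
  have hder : ∀ p, deriv (fun s => localEq (Function.update W k s) p) (W k) =
      density W / c * ((C (temperature W ^ 2)⁻¹ * X + C κ).eval (restEnergy (velocity W) p) *
        basisFun (velocity W) (temperature W) 0 0 0 p) := fun p => by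
    simp only [localEq, hv, ht, hd]
    rw [hWk, ((hκ p).const_mul (density W)).deriv, basisFun_zero hθ, ← hcdef]
    simp only [Polynomial.eval_add, Polynomial.eval_mul, Polynomial.eval_C, Polynomial.eval_X]
    field_simp
  simp only [fluidMat, Matrix.of_apply, hder]
  rw [wInner_const_mul_left, basisAt,
    wInner_basisFun hu hθ _ _ _ (m := 0) (l := 0) le_rfl j.natAbs_ord_le]
  by_cases hj : j.ell = 0
  · have hj' : 0 = j.ord := by
      have := j.natAbs_ord_le
      omega
    rw [if_pos ⟨hj.symm, hj'⟩, if_pos hj]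
  · rw [if_neg fun h => hj h.1.symm, if_neg hj, mul_zero]

theorem fluidMat_velocity {W : Idx M → ℝ} (hu : ∑ i, velocity W i ^ 2 < 1)
    (hθ : 0 < temperature W) {k : Idx M} {i : Fin 3}
    (hk : k.ell = 1 ∧ k.deg = 0 ∧ k.ord = (i : ℤ) - 1) (j : Idx M) :
    fluidMat W j k = ∑ l : Fin 3, density W * (fourVel (velocity W) 0 / temperature W *
      ((if l = i then 1 else 0) + fourVel (velocity W) i.succ * fourVel (velocity W) l.succ /
        (fourVel (velocity W) 0 + 1)) *
        (axisSign l / (orthoPoly 1 (temperature W)⁻¹ 0).leadingCoeff)) *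
      if j.ell = 1 ∧ j.deg = 0 ∧ j.ord = axisOrd l then 1 else 0 := by
  have hv : ∀ s, velocity (Function.update W k s) = Function.update (velocity W) i s := fun s => by
    funext l
    by_cases hl : l = i
    · subst hl
      rw [Function.update_self, velocity, entry_eq _ hk, Function.update_self]
    · rw [Function.update_of_ne hl]
      refine entry_update_of_ne W (fun h => hl ?_) s
      have := h.2.2
      exact Fin.ext (by omega)
  have ht : ∀ s, temperature (Function.update W k s) = temperature W := fun s =>
    entry_update_of_ne W (by omega) s
  have hd : ∀ s, density (Function.update W k s) = density W := fun s =>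
    entry_update_of_ne W (by omega) s
  have hWk : W k = velocity W i := by rw [velocity, entry_eq _ hk]
  have hM : 1 ≤ M := by
    have := k.ell_add_deg_le
    omega
  have hax : ∀ l, (axisOrd l).natAbs ≤ 1 := fun l => by fin_cases l <;> simp [axisOrd]
  choose e he using fun l => Idx.exists_labels (M := M) (l := 1) (k := 0) (m := axisOrd l)
    (by omega) (hax l)
  have hder : ∀ p, deriv (fun s => localEq (Function.update W k s) p) (W k) =
      ∑ l : Fin 3, density W * (fourVel (velocity W) 0 / temperature W *
      ((if l = i then 1 else 0) + fourVel (velocity W) i.succ * fourVel (velocity W) l.succ /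
        (fourVel (velocity W) 0 + 1)) *
        (axisSign l / (orthoPoly 1 (temperature W)⁻¹ 0).leadingCoeff)) *
      basisAt (velocity W) (temperature W) (e l) p := fun p => by
    simp only [localEq, hv, ht, hd]
    rw [hWk, ((hasDerivAt_juttner_velocity hu (temperature W) i p).const_mul (density W)).deriv,
      Finset.mul_sum]
    refine Finset.sum_congr rfl fun l _ => ?_
    rw [juttner_mul_restMom hu hθ, basisAt, (he l).1, (he l).2.1, (he l).2.2]
    ring
  simp only [fluidMat, Matrix.of_apply, hder]
  rw [wInner_sum_left _ _ _ _ fun l _ => integrable_basisAt_mul hu hθ j (e l)]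
  refine Finset.sum_congr rfl fun l _ => ?_
  rw [wInner_basisAt hu hθ]
  simp only [Idx.ext_iff_labels, (he l).1, (he l).2.1, (he l).2.2]

theorem IsFluid.cases {k : Idx M} (hk : IsFluid k) :
    (k.ell = 0 ∧ k.deg = 0) ∨ (k.ell = 0 ∧ k.deg = 1) ∨
      ∃ i : Fin 3, k.ell = 1 ∧ k.deg = 0 ∧ k.ord = (i : ℤ) - 1 := by
  rcases hk with hk | hk
  · rcases Nat.lt_or_ge k.deg 1 with h | h
    · exact Or.inl ⟨hk.1, by omega⟩
    · exact Or.inr (Or.inl ⟨hk.1, by omega⟩)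
  · have := k.natAbs_ord_le
    exact Or.inr (Or.inr ⟨⟨(k.ord + 1).toNat, by omega⟩, hk.1, hk.2, by
      change k.ord = ((k.ord + 1).toNat : ℤ) - 1
      omega⟩)

/-- The derivative of the local equilibrium is a combination of the collision invariants `g`, `g E`
and `g q_i`. -/
theorem fluidMat_row_eq_zero {W : Idx M → ℝ} (hu : ∑ i, velocity W i ^ 2 < 1)
    (hθ : 0 < temperature W) {j : Idx M} (hj : ¬IsFluid j) (k : Idx M) : fluidMat W j k = 0 := by
  by_cases hk : IsFluid k
  swap
  · exact fluidMat_of_not_isFluid W hk j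
  rcases hk.cases with h | h | ⟨i, h⟩
  · rw [fluidMat_density hu hθ h, if_neg]
    rintro rfl
    exact hj hk
  · obtain ⟨κ, hκ⟩ := fluidMat_temperature hu hθ
    rw [hκ k h]
    split_ifs with hj0
    · have hdeg : ((C (temperature W ^ 2)⁻¹ * X + C κ) *
          orthoPoly 0 (temperature W)⁻¹ 0).degree < (j.deg : WithBot ℕ) := by
        have h2 : 2 ≤ j.deg := by
          by_contra h2
          exact hj (Or.inl ⟨hj0, by omega⟩)
        refine lt_of_lt_of_le ?_ (Nat.cast_le.2 h2)
        rw [Polynomial.degree_mul, orthoPoly_degree 0 (inv_pos.2 hθ), Nat.cast_zero, add_zero]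
        exact Polynomial.degree_linear_le.trans_lt (by norm_num)
      rw [polyInner_comm, polyInner_orthoPoly_eq_zero_of_degree_lt 0 (inv_pos.2 hθ) hdeg, mul_zero]
    · rfl
  · rw [fluidMat_velocity hu hθ h]
    refine Finset.sum_eq_zero fun l _ => ?_
    have hne : ¬(j.ell = 1 ∧ j.deg = 0 ∧ j.ord = axisOrd l) := fun h =>
      hj (Or.inr ⟨h.1, h.2.1⟩)
    rw [if_neg hne, mul_zero]

/-- The local equilibrium depends on `n`, `θ` and `u` through linearly independent collision
invariants. -/
theorem eq_zero_of_fluidMat_mulVec_eq_zero (hM : 1 ≤ M) {W : Idx M → ℝ}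
    (hu : ∑ i, velocity W i ^ 2 < 1) (hθ : 0 < temperature W) (hn : 0 < density W)
    {A : Idx M → ℝ} (hA : ∀ k, ¬IsFluid k → A k = 0) (hH : (fluidMat W).mulVec A = 0) : A = 0 := by
  have hζ := inv_pos.2 hθ
  obtain ⟨κ, hκ⟩ := fluidMat_temperature hu hθ
  obtain ⟨jn, hjn⟩ := Idx.exists_labels (M := M) (l := 0) (k := 0) (m := 0) (by omega) le_rfl
  obtain ⟨jt, hjt⟩ := Idx.exists_labels (M := M) (l := 0) (k := 1) (m := 0) (by omega) le_rfl
  choose ju hju using fun i : Fin 3 => Idx.exists_labels (M := M) (l := 1) (k := 0)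
    (m := (i : ℤ) - 1) (by omega) (by omega)
  have hax : ∀ l, (axisOrd l).natAbs ≤ 1 := fun l => by fin_cases l <;> simp [axisOrd]
  choose e he using fun l => Idx.exists_labels (M := M) (l := 1) (k := 0) (m := axisOrd l)
    (by omega) (hax l)
  have hrow : ∀ j, ∑ k, fluidMat W j k * A k = 0 := fun j => congrFun hH j
  have hA0 : ∀ k, k.ell = 0 → k ≠ jn → k ≠ jt → A k = 0 := by
    intro k h0 h1 h2
    refine hA k fun hk => ?_
    have := k.natAbs_ord_le
    rw [Ne, Idx.ext_iff_labels] at h1 h2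
    unfold IsFluid at hk
    omega
  have hu0 : ∀ j k, j.ell = 0 → k.ell ≠ 0 → fluidMat W j k * A k = 0 := by
    intro j k hj h0
    by_cases hk : IsFluid k
    · rcases hk.cases with h | h | ⟨i, h⟩
      · exact absurd h.1 h0
      · exact absurd h.1 h0
      · rw [fluidMat_velocity hu hθ h, Finset.sum_eq_zero, zero_mul]
        intro l _
        have hne : ¬(j.ell = 1 ∧ j.deg = 0 ∧ j.ord = axisOrd l) := by omega
        rw [if_neg hne, mul_zero]
    · rw [hA k hk, mul_zero]
  have hAt : A jt = 0 := by
    have h := hrow jt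
    rw [Finset.sum_eq_single jt] at h
    · refine (mul_eq_zero.1 h).resolve_left ?_
      rw [hκ jt ⟨hjt.1, hjt.2.1⟩, if_pos hjt.1, hjt.2.1]
      have h1 := polyInner_X_mul_orthoPoly_pos 0 hζ
      have h2 : polyInner 0 (temperature W)⁻¹ ((C (temperature W ^ 2)⁻¹ * X + C κ) *
          orthoPoly 0 (temperature W)⁻¹ 0) (orthoPoly 0 (temperature W)⁻¹ 1) =
          (temperature W ^ 2)⁻¹ * polyInner 0 (temperature W)⁻¹
            (X * orthoPoly 0 (temperature W)⁻¹ 0) (orthoPoly 0 (temperature W)⁻¹ 1) := by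
        rw [polyInner_comm, add_mul, polyInner_add_right 0 hζ, mul_assoc, polyInner_C_mul_right,
          polyInner_C_mul_right, polyInner_orthoPoly 0 hζ, polyInner_comm]
        simp
      rw [h2]
      have h3 := orthoPoly_leadingCoeff_pos 0 hζ 0
      positivity
    · intro k _ hk
      by_cases h0 : k.ell = 0
      · by_cases hkn : k = jn
        · subst hkn
          rw [fluidMat_density hu hθ ⟨hjn.1, hjn.2.1⟩, if_neg (Ne.symm hk), zero_mul]
        · rw [hA0 k h0 hkn hk, mul_zero]
      · exact hu0 jt k hjt.1 h0
    · simp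
  have hAn : A jn = 0 := by
    have h := hrow jn
    rw [Finset.sum_eq_single jn] at h
    · refine (mul_eq_zero.1 h).resolve_left ?_
      rw [fluidMat_density hu hθ ⟨hjn.1, hjn.2.1⟩, if_pos rfl]
      exact inv_ne_zero (orthoPoly_leadingCoeff_pos 0 hζ 0).ne'
    · intro k _ hk
      by_cases h0 : k.ell = 0
      · by_cases hkt : k = jt
        · rw [hkt, hAt, mul_zero]
        · rw [hA0 k h0 hk hkt, mul_zero]
      · exact hu0 jn k hjn.1 h0
    · simp
  have hjuinj : Function.Injective ju := fun a b h => by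
    have h1 := congrArg Idx.ord h
    rw [(hju a).2.2, (hju b).2.2] at h1
    exact Fin.ext (by omega)
  have hother : ∀ k, k ∉ range ju → A k = 0 := by
    intro k hk
    by_cases hf : IsFluid k
    · rcases hf.cases with h | h | ⟨i, h⟩
      · have : k = jn := by
          have := k.natAbs_ord_le
          rw [Idx.ext_iff_labels]
          omega
        rw [this, hAn]
      · have : k = jt := by
          have := k.natAbs_ord_le
          rw [Idx.ext_iff_labels]
          omega
        rw [this, hAt]
      · refine absurd ⟨i, ?_⟩ hk
        rw [Idx.ext_iff_labels, (hju i).1, (hju i).2.1, (hju i).2.2]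
        exact ⟨h.1.symm, h.2.1.symm, h.2.2.symm⟩
    · exact hA k hf
  set U : Fin 3 → ℝ := fun i => fourVel (velocity W) i.succ with hU
  have hU0 := fourVel_zero_pos hu
  set x : Fin 3 → ℝ := fun i => A (ju i) with hx
  -- The velocity block of the matrix is a nonzero multiple of `1 + U Uᵀ / (U⁰ + 1)`.
  have hvel : ∀ l, x l + U l * (∑ i, U i * x i) / (fourVel (velocity W) 0 + 1) = 0 := by
    intro l
    have h := hrow (e l)
    rw [← Fintype.sum_of_injective ju hjuinj (fun i => fluidMat W (e l) (ju i) * x i) _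
      (fun k hk => by rw [hother k hk, mul_zero]) fun i => rfl] at h
    have haxinj : Function.Injective axisOrd := by decide
    have hent : ∀ i, fluidMat W (e l) (ju i) = density W * (fourVel (velocity W) 0 / temperature W *
        ((if l = i then 1 else 0) + U i * U l / (fourVel (velocity W) 0 + 1)) *
        (axisSign l / (orthoPoly 1 (temperature W)⁻¹ 0).leadingCoeff)) := by
      intro i
      rw [fluidMat_velocity hu hθ (hju i), Finset.sum_eq_single l]
      · rw [if_pos (he l), mul_one]
      · intro l' _ hl'
        have hne : ¬((e l).ell = 1 ∧ (e l).deg = 0 ∧ (e l).ord = axisOrd l') := by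
          rintro ⟨-, -, h3⟩
          rw [(he l).2.2] at h3
          exact hl' (haxinj h3).symm
        rw [if_neg hne, mul_zero]
      · simp
    set d := density W * (fourVel (velocity W) 0 / temperature W) *
      (axisSign l / (orthoPoly 1 (temperature W)⁻¹ 0).leadingCoeff) with hd
    have hd0 : d ≠ 0 := by
      have h1 := orthoPoly_leadingCoeff_pos 1 hζ 0
      have h2 : axisSign l ≠ 0 := fun h => by simpa [h] using axisSign_mul_self l
      have h3 : fourVel (velocity W) 0 / temperature W ≠ 0 := by positivity
      exact mul_ne_zero (mul_ne_zero hn.ne' h3) (div_ne_zero h2 h1.ne')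
    refine (mul_eq_zero.1 (?_ : d * _ = 0)).resolve_left hd0
    rw [← h]
    simp only [hent]
    have : ∀ i, density W * (fourVel (velocity W) 0 / temperature W *
        ((if l = i then 1 else 0) + U i * U l / (fourVel (velocity W) 0 + 1)) *
        (axisSign l / (orthoPoly 1 (temperature W)⁻¹ 0).leadingCoeff)) * x i =
        d * ((if l = i then x i else 0) + U l * (U i * x i) / (fourVel (velocity W) 0 + 1)) := by
      intro i
      rw [hd]
      split_ifs <;> ring
    simp only [this]
    rw [← Finset.mul_sum, Finset.sum_add_distrib, Finset.sum_ite_eq, ← Finset.sum_div,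
      ← Finset.mul_sum]
    simp
  have hsq : ∑ l, x l ^ 2 + (∑ i, U i * x i) ^ 2 / (fourVel (velocity W) 0 + 1) = 0 := by
    have : ∑ l, x l * (x l + U l * (∑ i, U i * x i) / (fourVel (velocity W) 0 + 1)) = 0 :=
      Finset.sum_eq_zero fun l _ => by rw [hvel l, mul_zero]
    rw [← this, pow_two (∑ i, U i * x i)]
    conv_lhs => rw [Finset.sum_mul, Finset.sum_div, ← Finset.sum_add_distrib]
    refine Finset.sum_congr rfl fun l _ => ?_
    ring
  have hx0 : ∀ l, x l = 0 := by
    have h1 : 0 ≤ (∑ i, U i * x i) ^ 2 / (fourVel (velocity W) 0 + 1) := by positivity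
    have h2 : ∑ l, x l ^ 2 = 0 :=
      le_antisymm (by linarith) (Finset.sum_nonneg fun l _ => sq_nonneg _)
    intro l
    have := (Finset.sum_eq_zero_iff_of_nonneg fun l _ => sq_nonneg (x l)).1 h2 l
      (Finset.mem_univ l)
    exact pow_eq_zero_iff two_ne_zero |>.1 this
  funext k
  by_cases hk : k ∈ range ju
  · obtain ⟨i, rfl⟩ := hk
    exact hx0 i
  · exact hother k hk

/-! ### The matrices of the linearized system -/

theorem equilibrium_of_not_isFluid (n₀ : ℝ) (u₀ : Fin 3 → ℝ) (θ₀ : ℝ) {j : Idx M}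
    (hj : ¬IsFluid j) : equilibrium M n₀ u₀ θ₀ j = 0 := by
  unfold IsFluid at hj
  rw [equilibrium, if_neg (by omega), if_neg (by omega), if_neg (by omega)]

theorem density_equilibrium (n₀ : ℝ) (u₀ : Fin 3 → ℝ) (θ₀ : ℝ) :
    density (equilibrium M n₀ u₀ θ₀) = n₀ := by
  obtain ⟨j, hj⟩ := Idx.exists_labels (M := M) (l := 0) (k := 0) (m := 0) (by omega) le_rfl
  rw [density, entry_eq _ hj, equilibrium, if_pos ⟨hj.1, hj.2.1⟩]

theorem temperature_equilibrium (hM : 1 ≤ M) (n₀ : ℝ) (u₀ : Fin 3 → ℝ) (θ₀ : ℝ) :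
    temperature (equilibrium M n₀ u₀ θ₀) = θ₀ := by
  obtain ⟨j, hj⟩ := Idx.exists_labels (M := M) (l := 0) (k := 1) (m := 0) (by omega) le_rfl
  rw [temperature, entry_eq _ hj, equilibrium, if_neg (by omega), if_pos ⟨hj.1, hj.2.1⟩]

theorem velocity_equilibrium (hM : 1 ≤ M) (n₀ : ℝ) (u₀ : Fin 3 → ℝ) (θ₀ : ℝ) :
    velocity (equilibrium M n₀ u₀ θ₀) = u₀ := by
  funext i
  obtain ⟨j, hj⟩ := Idx.exists_labels (M := M) (l := 1) (k := 0) (m := (i : ℤ) - 1) (by omega)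
    (by omega)
  rw [velocity, entry_eq _ hj, equilibrium, if_neg (by omega), if_neg (by omega),
    if_pos ⟨hj.1, hj.2.1⟩]
  congr 1
  have h1 : (j.1 : ℕ) = 1 := hj.1
  have h2 : ((j.2.2 : ℕ) : ℤ) - ((j.1 : ℕ) : ℤ) = (i : ℤ) - 1 := hj.2.2
  apply Fin.ext
  change (j.2.2 : ℕ) % 3 = i
  omega

theorem eventually_temperature_update_pos {W : Idx M → ℝ} (hθ : 0 < temperature W) (k : Idx M) :
    ∀ᶠ s in 𝓝 (W k), 0 < temperature (Function.update W k s) := by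
  have hcont : Continuous fun s => temperature (Function.update W k s) := by
    have hup : Continuous fun s => Function.update W k s := continuous_const.update k continuous_id
    unfold temperature entry
    refine continuous_finsetSum _ fun j _ => ?_
    split_ifs
    · exact (continuous_apply j).comp hup
    · exact continuous_const
  refine continuousAt_const.eventually_lt hcont.continuousAt ?_
  rwa [Function.update_eq_self]

/-- Near an equilibrium the distribution is the local equilibrium plus a term that is linear in the
unknowns other than `n`, `θ` and `u`. -/
theorem distribution_update {W : Idx M → ℝ} (hW : ∀ j, ¬IsFluid j → W j = 0) {k : Idx M} {s : ℝ}
    (hθ : 0 < temperature (Function.update W k s)) (p : Mom) :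
    distribution (Function.update W k s) p = localEq (Function.update W k s) p +
      ∑ j, (s - W k) * devMat M (temperature (Function.update W k s))⁻¹ j k *
        basisAt (velocity (Function.update W k s)) (temperature (Function.update W k s)) j p := by
  rw [distribution_eq hθ]
  simp only [devCoeff_update hW, devMat, Matrix.of_apply]

theorem devMat_of_isFluid {k : Idx M} (hk : IsFluid k) (ζ : ℝ) (j : Idx M) :
    devMat M ζ j k = 0 :=
  devCoeff_single_of_isFluid hk ζ j

theorem diffMat_eq {W : Idx M → ℝ} (hW : ∀ j, ¬IsFluid j → W j = 0)
    (hu : ∑ i, velocity W i ^ 2 < 1) (hθ : 0 < temperature W) :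
    diffMat W = devMat M (temperature W)⁻¹ + fluidMat W := by
  ext j k
  rw [Matrix.add_apply]
  by_cases hk : IsFluid k
  · rw [devMat_of_isFluid hk, zero_add]
    simp only [diffMat, fluidMat, Matrix.of_apply]
    congr 1
    funext p
    refine Filter.EventuallyEq.deriv_eq ?_
    filter_upwards [eventually_temperature_update_pos hθ k] with s hs
    rw [distribution_update hW hs]
    simp [devMat_of_isFluid hk]
  · rw [fluidMat_of_not_isFluid W hk, add_zero]
    have hder : ∀ p, deriv (fun s => distribution (Function.update W k s) p) (W k) =
        ∑ i, devMat M (temperature W)⁻¹ i k * basisAt (velocity W) (temperature W) i p := fun p => by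
      have hfun : (fun s => distribution (Function.update W k s) p) = fun s => localEq W p +
          ∑ i, s * devMat M (temperature W)⁻¹ i k *
            basisAt (velocity W) (temperature W) i p := by
        funext s
        rw [distribution_update hW (by rwa [update_temperature hk])]
        simp only [localEq, update_temperature hk, update_velocity hk, update_density hk, hW k hk,
          sub_zero]
      rw [hfun]
      refine HasDerivAt.deriv ?_
      refine (HasDerivAt.fun_sum fun i _ => ?_).const_add _
      simpa using ((hasDerivAt_id (W k)).mul_const (devMat M (temperature W)⁻¹ i k)).mul_const
        (basisAt (velocity W) (temperature W) i p)
    simp only [diffMat, Matrix.of_apply, hder]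
    rw [wInner_sum_left _ _ _ _ fun i _ => integrable_basisAt_mul hu hθ j i]
    simp only [wInner_basisAt hu hθ]
    simp

/-- The source term is `-(1/τ) N` applied to the deviation. The deviation vanishes when a fluid
unknown varies and is linear in the other unknowns, along which `τ` is constant; so `τ` is never
differentiated. -/
theorem relaxMat_eq (τ : ℝ → ℝ → ℝ) {W : Idx M → ℝ} (hW : ∀ j, ¬IsFluid j → W j = 0)
    (hu : ∑ i, velocity W i ^ 2 < 1) (hθ : 0 < temperature W) :
    relaxMat τ W = -((1 / τ (density W) (temperature W)) •
      (mulMat M (velocity W) (temperature W) (restEnergy (velocity W)) *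
        devMat M (temperature W)⁻¹)) := by
  ext j k
  simp only [relaxMat, Matrix.of_apply, Matrix.neg_apply, Matrix.smul_apply, smul_eq_mul]
  by_cases hk : IsFluid k
  · have h0 : (fun s => source τ (Function.update W k s) j) =ᶠ[𝓝 (W k)] fun _ => (0 : ℝ) := by
      filter_upwards [eventually_temperature_update_pos hθ k] with s hs
      have hcol : collision τ (Function.update W k s) = fun _ => 0 := by
        funext p
        rw [collision, distribution_update hW hs]
        simp [devMat_of_isFluid hk, localEq]
      rw [source, hcol]
      simp [wInner]
    rw [h0.deriv_eq, deriv_const, Matrix.mul_apply]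
    simp [devMat_of_isFluid hk]
  · have hbound : ∀ p, |restEnergy (velocity W) p| ≤ 1 * restEnergy (velocity W) p := fun p => by
      rw [abs_of_pos (restEnergy_pos hu p), one_mul]
    have hsrc : ∀ s, source τ (Function.update W k s) j =
        s * -(1 / τ (density W) (temperature W) *
          (mulMat M (velocity W) (temperature W) (restEnergy (velocity W)) *
            devMat M (temperature W)⁻¹) j k) := by
      intro s
      have hcol : collision τ (Function.update W k s) = fun p =>
          ∑ i, (-(s / τ (density W) (temperature W)) * devMat M (temperature W)⁻¹ i k) *
            (restEnergy (velocity W) p * basisAt (velocity W) (temperature W) i p) := by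
        funext p
        rw [collision, distribution_update hW (by rwa [update_temperature hk])]
        simp only [localEq, update_temperature hk, update_velocity hk, update_density hk, hW k hk,
          sub_zero, add_sub_cancel_left]
        rw [Finset.mul_sum]
        refine Finset.sum_congr rfl fun i _ => ?_
        ring
      rw [source, hcol, update_temperature hk, update_velocity hk, wInner_sum_left _ _ _ _
        fun i _ => integrable_mul_basisAt_mul hu hθ (continuous_restEnergy _) hbound j i,
        Matrix.mul_apply, Finset.mul_sum, ← Finset.sum_neg_distrib, Finset.mul_sum]
      refine Finset.sum_congr rfl fun i _ => ?_
      rw [mulMat, Matrix.of_apply]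
      ring
    simp only [hsrc]
    simp

theorem dispersionMat_mulVec_eq_zero_of_solves (τ : ℝ → ℝ → ℝ) (W₀ : Idx M → ℝ) {A : Idx M → ℂ}
    {ω : ℂ} {k : Fin 3 → ℝ} (h : SolvesLinearized τ W₀ (planeWave A ω k)) :
    (dispersionMat τ W₀ ω k).mulVec A = 0 := by
  have hval : planeWave A ω k 0 = A := by
    funext j
    simp [planeWave]
  have hd0 : (fun j => deriv (fun s : ℝ => planeWave A ω k (Function.update 0 0 s) j) 0) =
      (Complex.I * ω) • A := by
    funext j
    have hfun : (fun s : ℝ => planeWave A ω k (Function.update 0 0 s) j) =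
        fun s : ℝ => A j * Complex.exp (Complex.I * ω * (s : ℂ)) := by
      funext s
      simp [planeWave, mul_assoc]
    rw [hfun]
    have h1 : HasDerivAt (fun s : ℝ => (s : ℂ)) 1 0 := Complex.ofRealCLM.hasDerivAt
    have h2 := ((h1.const_mul (Complex.I * ω)).cexp).const_mul (A j)
    rw [h2.deriv]
    simp
    ring
  have hdi : ∀ i : Fin 3,
      (fun j => deriv (fun s : ℝ => planeWave A ω k (Function.update 0 i.succ s) j) 0) =
        (-(Complex.I * (k i : ℂ))) • A := by
    intro i
    funext j
    have hfun : (fun s : ℝ => planeWave A ω k (Function.update 0 i.succ s) j) =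
        fun s : ℝ => A j * Complex.exp (-(Complex.I * (k i : ℂ)) * (s : ℂ)) := by
      funext s
      have hsum : ∑ l : Fin 3, (k l : ℂ) *
          ((Function.update (0 : Fin 4 → ℝ) i.succ s l.succ : ℝ) : ℂ) = (k i : ℂ) * (s : ℂ) := by
        rw [Finset.sum_eq_single i]
        · rw [Function.update_self]
        · intro l _ hl
          rw [Function.update_of_ne fun h => hl (Fin.succ_injective _ h)]
          simp
        · simp
      rw [planeWave, hsum, Function.update_of_ne (Fin.succ_ne_zero i).symm]
      congr 2
      simp
      ring
    rw [hfun]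
    have h1 : HasDerivAt (fun s : ℝ => (s : ℂ)) 1 0 := Complex.ofRealCLM.hasDerivAt
    have h2 := ((h1.const_mul (-(Complex.I * (k i : ℂ)))).cexp).const_mul (A j)
    rw [h2.deriv]
    simp
    ring
  have h0 := h 0
  rw [Fin.sum_univ_succ, hval] at h0
  simp only [Pi.zero_apply, hd0, hdi, Matrix.mulVec_smul] at h0
  rw [dispersionMat, Matrix.sub_mulVec, Matrix.sub_mulVec, Matrix.sum_mulVec, ← h0]
  simp only [Matrix.smul_mulVec, neg_smul, Finset.sum_neg_distrib]
  abel

theorem im_nonneg_of_dispersionMat_mulVec_eq_zero (hM : 1 ≤ M) {τ : ℝ → ℝ → ℝ} {n₀ : ℝ}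
    {u₀ : Fin 3 → ℝ} {θ₀ : ℝ} (hτ : 0 < τ n₀ θ₀) (hn : 0 < n₀) (hu : ∑ i, u₀ i ^ 2 < 1)
    (hθ : 0 < θ₀) {k : Fin 3 → ℝ} {ω : ℂ} {A : Idx M → ℂ} (hA : A ≠ 0)
    (h : (dispersionMat τ (equilibrium M n₀ u₀ θ₀) ω k).mulVec A = 0) : 0 ≤ ω.im := by
  have hW : ∀ j : Idx M, ¬IsFluid j → equilibrium M n₀ u₀ θ₀ j = 0 := fun j hj =>
    equilibrium_of_not_isFluid n₀ u₀ θ₀ hj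
  have hd := density_equilibrium (M := M) n₀ u₀ θ₀
  have ht := temperature_equilibrium hM n₀ u₀ θ₀
  have hv := velocity_equilibrium hM n₀ u₀ θ₀
  set W := equilibrium M n₀ u₀ θ₀ with hWdef
  have hdiff : diffMat W = devMat M θ₀⁻¹ + fluidMat W := by
    rw [diffMat_eq hW (by rwa [hv]) (by rwa [ht]), ht]
  have hflux : ∀ α, fluxMat W α =
      mulMat M u₀ θ₀ (fun p => fourMom p α) * (devMat M θ₀⁻¹ + fluidMat W) := fun α => by
    rw [fluxMat, hdiff, ← hv, ← ht]
    rfl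
  have hrelax := relaxMat_eq τ hW (by rwa [hv]) (by rwa [ht])
  rw [hd, ht, hv] at hrelax
  rw [dispersionMat, hrelax] at h
  simp only [hflux] at h
  obtain ⟨c, hc⟩ := exists_abs_fourMom_le hu 0
  have hbound : ∀ p, |restEnergy u₀ p| ≤ 1 * restEnergy u₀ p := fun p => by
    rw [abs_of_pos (restEnergy_pos hu p), one_mul]
  refine im_nonneg_of_energy_estimate _ (mulMat M u₀ θ₀ (restEnergy u₀)) _ _
    (fun i : Fin 3 => mulMat M u₀ θ₀ fun p => fourMom p i.succ) (one_div_pos.2 hτ)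
    (mulMat_isSymm _ _ _) (fun i => mulMat_isSymm _ _ _)
    (dotProduct_self_le_mulMat hu hθ (continuous_fourMom 0) hc one_le_fourMom_zero)
    (dotProduct_self_le_mulMat hu hθ (continuous_restEnergy u₀) hbound (one_le_restEnergy hu))
    ?_ ?_ k ω A hA h
  · ext i l
    rw [Matrix.mul_apply]
    refine Finset.sum_eq_zero fun j _ => ?_
    by_cases hj : IsFluid j
    · rw [mulMat_energy_mul_devMat hu hθ hj, mul_zero]
    · rw [Matrix.transpose_apply, fluidMat_row_eq_zero (by rwa [hv]) (by rwa [ht]) hj, zero_mul]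
  · intro x hC hH
    rw [devMat_mulVec] at hC
    exact eq_zero_of_fluidMat_mulVec_eq_zero hM (by rwa [hv]) (by rwa [ht]) (by rwa [hd])
      (fun j hj => eq_zero_of_devCoeff_eq_zero (inv_pos.2 hθ) hC hj) hH

end RelMoment

theorem mainTheorem2 (M : ℕ) (hM : 1 ≤ M)
    (τ : ℝ → ℝ → ℝ) (hτ : ∀ n θ : ℝ, 0 < n → 0 < θ → 0 < τ n θ)
    (n₀ : ℝ) (hn : 0 < n₀) (u₀ : Fin 3 → ℝ) (hu : ∑ i, u₀ i ^ 2 < 1) (θ₀ : ℝ) (hθ : 0 < θ₀)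
    (k : Fin 3 → ℝ) (ω : ℂ) :
    ((∃ A : RelMoment.Idx M → ℂ, A ≠ 0 ∧
        RelMoment.SolvesLinearized τ (RelMoment.equilibrium M n₀ u₀ θ₀)
          (RelMoment.planeWave A ω k)) → 0 ≤ ω.im) ∧
    ((RelMoment.dispersionMat τ (RelMoment.equilibrium M n₀ u₀ θ₀) ω k).det = 0 → 0 ≤ ω.im) := by
  refine ⟨?_, fun hdet => ?_⟩
  · rintro ⟨A, hA, hsol⟩
    exact RelMoment.im_nonneg_of_dispersionMat_mulVec_eq_zero hM (hτ n₀ θ₀ hn hθ) hn hu hθ hA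
      (RelMoment.dispersionMat_mulVec_eq_zero_of_solves τ _ hsol)
  · obtain ⟨A, hA, h⟩ := Matrix.exists_mulVec_eq_zero_iff.2 hdet
    exact RelMoment.im_nonneg_of_dispersionMat_mulVec_eq_zero hM (hτ n₀ θ₀ hn hθ) hn hu hθ hA h
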